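/- Let $\Omega\subset\mathbb R^2$ be a bounded domain with polygonal boundary (open, connected, lying on one side of its boundary, which is a finite union of closed polygonal curves; holes are allowed), and let $\Gamma_i$ be the sides of $\partial\Omega$, with outward unit normal $n$. Let $k\ge 1$ be an integer and $c_\rho,c_q\in\mathbb R$. Then there is a constant $c_s>0$, depending only on $\Omega$, $k$, $c_\rho$, $c_q$, such that the following holds for every conforming triangulation $\mathcal T_h$ of $\overline\Omega$ that satisfies: 1. (shape regularity) $h_K\le c_\rho\,\rho_K$ for all $K\in\mathcal T_h$, where $h_K$ is the diameter of $K$ and $\rho_K$ the radius of the largest ball inscribed in $K$; 2. (quasi-uniformity) $\max_{K'\in\mathcal T_h}h_{K'}\le c_q\,h_K$ for all $K\in\mathcal T_h$; 3. every side $\Gamma_i$ contains at least five element faces (edges of triangles of $\mathcal T_h$); 4. if $k=1$: some triangle of $\mathcal T_h$ with a face on $\partial\Omega$ has a vertex in $\Omega$ or has two faces on $\partial\Omega$. Let $V_h^k$ be the space of continuous functions on $\overline\Omega$ whose restriction to each $K\in\mathcal T_h$ is a polynomial of degree at most $k$, and put $$a_h(v,w)=(\nabla v,\nabla w)_{\Omega}-\langle\nabla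 v\cdot n,w\rangle_{\partial\Omega}+\langle v,\nabla w\cdot n\rangle_{\partial\Omega},\qquad \|v\|_{1,h}^2=\|\nabla v\|_{L^2(\Omega)}^2+\sum_{K\in\mathcal T_h}h_K^{-1}\|v\|^2_{L^2(\partial\Omega\cap\partial K)},$$ where $(\cdot,\cdot)_\Omega$ and $\langle\cdot,\cdot\rangle_{\partial\Omega}$ are the $L^2$ scalar products over $\Omega$ and $\partial\Omega$. Then for all $v_h\in V_h^k$ $$c_s\,\|v_h\|_{1,h}\le\sup_{w_h\in V_h^k,\ \|w_h\|_{1,h}\neq 0}\frac{a_h(v_h,w_h)}{\|w_h\|_{1,h}} .$$ -/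

import Mathlib

open MeasureTheory
open scoped Topology

/-- The Euclidean plane. -/
abbrev Plane : Type := EuclideanSpace ℝ (Fin 2)

/-- `Ω` is a bounded domain with polygonal boundary, and the segments `[a i, b i]` are the faces
(sides) `Γ i` of its boundary. Distinct sides meet at most at common end points, every end point of
a side is shared with exactly one other side, adjacent sides are not collinear, and `Ω` lies on one
side of its boundary (no slits). Holes are allowed. -/
structure IsPolygonalDomain (Ω : Set Plane) {m : ℕ} (a b : Fin m → Plane) : Prop where
  isOpen : IsOpen Ω
  isConnected : IsConnected Ω
  isBounded : Bornology.IsBounded Ω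
  regular : interior (closure Ω) = Ω
  ne : ∀ i, a i ≠ b i
  frontier_eq : frontier Ω = ⋃ i, segment ℝ (a i) (b i)
  inter : ∀ i j, i ≠ j →
    segment ℝ (a i) (b i) ∩ segment ℝ (a j) (b j) ⊆ {a i, b i} ∩ {a j, b j}
  left_shared : ∀ i, ∃! j, j ≠ i ∧ (a i = a j ∨ a i = b j)
  right_shared : ∀ i, ∃! j, j ≠ i ∧ (b i = a j ∨ b i = b j)
  not_collinear : ∀ i j, i ≠ j →
    (segment ℝ (a i) (b i) ∩ segment ℝ (a j) (b j)).Nonempty →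
    ¬ Collinear ℝ {a i, b i, a j, b j}

/-- The elements (triangles) of a planar simplicial complex, given by their vertex sets. -/
def elements (T : Geometry.SimplicialComplex ℝ Plane) : Set (Finset Plane) :=
  {K | K ∈ T.faces ∧ K.card = 3}

/-- The closed triangle with vertex set `K`. -/
def tri (K : Finset Plane) : Set Plane := convexHull ℝ (K : Set Plane)

/-- The diameter `h_K` of an element. -/
noncomputable def elementDiam (K : Finset Plane) : ℝ := Metric.diam (tri K)

/-- The radius `ρ_K` of the largest ball inscribed in an element. -/
noncomputable def elementInradius (K : Finset Plane) : ℝ :=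
  sSup {r : ℝ | ∃ x : Plane, Metric.closedBall x r ⊆ tri K}

/-- `T` is a (finite, conforming) triangulation fitted to `Ω`. -/
structure IsFittedTriangulation (Ω : Set Plane) (T : Geometry.SimplicialComplex ℝ Plane) :
    Prop where
  finite : T.faces.Finite
  pure : ∀ s ∈ T.faces, ∃ K ∈ elements T, s ⊆ K
  space_eq : T.space = closure Ω

/-- Shape regularity with constant `cρ`: `h_K / ρ_K ≤ cρ` for all elements. -/
def IsShapeRegular (cρ : ℝ) (T : Geometry.SimplicialComplex ℝ Plane) : Prop :=
  ∀ K ∈ elements T, elementDiam K ≤ cρ * elementInradius K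

/-- Quasi-uniformity with constant `cq`: `h ≤ cq * h_K` for all elements `K`, where `h` is the
largest element diameter. -/
def IsQuasiUniform (cq : ℝ) (T : Geometry.SimplicialComplex ℝ Plane) : Prop :=
  ∀ K ∈ elements T, ∀ K' ∈ elements T, elementDiam K' ≤ cq * elementDiam K

/-- The element faces (edges, given by their end points) of `T` that are contained in `Γ`. -/
def facesIn (T : Geometry.SimplicialComplex ℝ Plane) (Γ : Set Plane) : Set (Finset Plane) :=
  {e | e ∈ T.faces ∧ e.card = 2 ∧ convexHull ℝ (e : Set Plane) ⊆ Γ}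

/-- Some element with a face on the boundary either has a vertex in the open set `Ω` or has two
faces on the boundary. This fails only if every element with a face on the boundary has all three
vertices, but just one face, on the boundary, as in a mesh of an annular domain by a single layer of
triangles. -/
def ResolvesBoundary (Ω : Set Plane) (T : Geometry.SimplicialComplex ℝ Plane) : Prop :=
  ∃ K ∈ elements T, ∃ e ∈ facesIn T (frontier Ω), e ⊆ K ∧
    ((∃ x ∈ K, x ∈ Ω) ∨ ∃ e' ∈ facesIn T (frontier Ω), e' ⊆ K ∧ e' ≠ e)

/-- The finite element space `V_h^k` of continuous functions on the closure of `Ω` that are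
polynomials of degree at most `k` on each element. (Values outside the closure of `Ω` are
irrelevant.) -/
def feSpace (Ω : Set Plane) (T : Geometry.SimplicialComplex ℝ Plane) (k : ℕ) : Set (Plane → ℝ) :=
  {v | ContinuousOn v (closure Ω) ∧ ∀ K ∈ elements T, ∃ p : MvPolynomial (Fin 2) ℝ,
    p.totalDegree ≤ k ∧ ∀ x ∈ tri K, v x = MvPolynomial.eval (fun i => x i) p}

/-- `ν` is the outward unit normal of `Ω` at `x`: near `x`, the set `Ω` is the open half plane
`⟨ν, y - x⟩ < 0`. -/
def IsOutwardNormal (Ω : Set Plane) (x ν : Plane) : Prop :=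
  ‖ν‖ = 1 ∧ ∀ᶠ y in 𝓝 x, (y ∈ Ω ↔ inner ℝ ν (y - x) < 0)

open Classical in
/-- The outward unit normal `n` of `Ω` (zero at the points, such as corners, where there is
none). -/
noncomputable def outwardNormal (Ω : Set Plane) (x : Plane) : Plane :=
  if h : ∃ ν, IsOutwardNormal Ω x ν then h.choose else 0

/-- The gradient of `v` on the closure of `Ω`. For a finite element function it is the broken
gradient at points interior to an element and the one-sided trace of the gradient at points
interior to a boundary face; all other points form a null set for the integrals below. -/
noncomputable def grad (Ω : Set Plane) (v : Plane → ℝ) (x : Plane) : Plane :=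
  gradientWithin v (closure Ω) x

/-- The normal derivative `∇v · n` on the boundary. -/
noncomputable def normalDeriv (Ω : Set Plane) (v : Plane → ℝ) (x : Plane) : ℝ :=
  inner ℝ (grad Ω v x) (outwardNormal Ω x)

/-- The `L²` scalar product over the boundary of `Ω`, with respect to arc length. -/
noncomputable def bdryInner (Ω : Set Plane) (f g : Plane → ℝ) : ℝ :=
  ∫ x in frontier Ω, f x * g x ∂(Measure.hausdorffMeasure 1)

/-- The penalty-free non-symmetric Nitsche form
`a_h(v,w) = (∇v,∇w)_Ω - ⟨∇v·n, w⟩_∂Ω + ⟨v, ∇w·n⟩_∂Ω`. -/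
noncomputable def nitscheForm (Ω : Set Plane) (v w : Plane → ℝ) : ℝ :=
  (∫ x in Ω, inner ℝ (grad Ω v x) (grad Ω w x))
    - bdryInner Ω (normalDeriv Ω v) w + bdryInner Ω v (normalDeriv Ω w)

/-- The square of the weighted boundary norm, `∑_K ⟨h_K⁻¹ v, v⟩_{∂Ω ∩ ∂K}`. -/
noncomputable def bdryNormSq (Ω : Set Plane) (T : Geometry.SimplicialComplex ℝ Plane)
    (v : Plane → ℝ) : ℝ :=
  ∑ᶠ K ∈ elements T, ∫ x in frontier Ω ∩ frontier (tri K),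
    (elementDiam K)⁻¹ * v x * v x ∂(Measure.hausdorffMeasure 1)

/-- The norm `‖v‖_{1,h}`, with `‖v‖_{1,h}² = ‖∇v‖²_{L²(Ω)} + ∑_K ⟨h_K⁻¹ v, v⟩_{∂Ω ∩ ∂K}`. -/
noncomputable def norm1h (Ω : Set Plane) (T : Geometry.SimplicialComplex ℝ Plane)
    (v : Plane → ℝ) : ℝ :=
  Real.sqrt ((∫ x in Ω, ‖grad Ω v x‖ ^ 2) + bdryNormSq Ω T v)

/-! Tested with `v` itself, the two boundary terms of the form cancel and only the Dirichlet energy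
`D` remains (`form_self`). The boundary norm has to come from a perturbation of the test function,
`w = v - α * ∑ a s * Q s`, where each `Q s` is a local function whose flux through the boundary is
at most a negative constant `-c₀`, and `a s` is the value of `v` at a vertex in its support. In the
form evaluated at `(v, Q s)` the term with the normal derivative of `Q s` is `a s` times this flux,
up to the oscillation of `v`; the remaining terms contain the gradient of `v`. By the inverse
estimate all errors are bounded by local energies, so `-∑ a s * Q s` contributes `c₀ / 2 * ∑ a s ^
2` minus a multiple of `D` (`le_neg_form`). For small `α` the energy absorbs the loss, and
`exists_infsup_constant` gives stability in `D + ∑ a s ^ 2`.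

The functions `Q s` are, up to sign, products of one or two hat functions. If `s` lies in an element
with a boundary face but in no boundary face, the product vanishes on each boundary face of each
element that contains `s`, and being positive inside it has negative outward flux
(`IsInner.sum_faceFlux_le`). If an element has two boundary faces, their common vertex belongs to no
other element, and its hat function has positive flux through them, equal to minus the flux through
the third face (`IsEar.le_sum_faceFlux`).

It remains to bound the boundary norm of `v` by `D + ∑ a s ^ 2` (`IsTestFamily.mass_le`). This is
local on elements that contain some `s`. For `k ≥ 2` every boundary element does: one of its edges
is not on the boundary. For `k = 1` a boundary element is bad if its third vertex lies on the
boundary too and it has just one boundary face. In a fine mesh its vertices then lie on two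
different sides, which are close to each other only near a common corner; at that corner some
boundary element is good, and the number of elements in between is bounded independently of the mesh
size. In a coarse mesh there are boundedly many elements altogether, and the hypothesis on the
resolution of the boundary supplies one `s`. In both cases `v` varies between the bad element and
`s` by at most a constant times `√D` (`exists_isLinked`, `abs_sub_le_sqrt`). -/

/-! ### Barycentric coordinates of a triangle -/

/-- The vertex set of a nondegenerate triangle. -/
structure IsTri (K : Finset Plane) : Prop where
  indep : AffineIndependent ℝ ((↑) : K → Plane)
  card : K.card = 3

namespace IsTri

variable {K : Finset Plane} (hK : IsTri K)
include hK

/-- The vertices of a triangle as an affine basis of the plane. -/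
noncomputable def basis : AffineBasis K ℝ Plane where
  toFun := (↑)
  ind' := hK.indep
  tot' := by
    rw [hK.indep.affineSpan_eq_top_iff_card_eq_finrank_add_one]
    simp [hK.card]

theorem basis_apply (p : K) : hK.basis p = p := rfl

end IsTri

open Classical in
/-- The barycentric coordinate of the triangle `K` that belongs to the vertex `p` (zero if there is
none). -/
noncomputable def bary (K : Finset Plane) (p : Plane) : Plane →ᵃ[ℝ] ℝ :=
  if h : IsTri K ∧ p ∈ K then h.1.basis.coord ⟨p, h.2⟩ else 0

theorem bary_eq {K : Finset Plane} (hK : IsTri K) {p : Plane} (hp : p ∈ K) :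
    bary K p = hK.basis.coord ⟨p, hp⟩ := by
  simp [bary, hK, hp]

theorem bary_of_notMem {K : Finset Plane} {p : Plane} (hp : p ∉ K) : bary K p = 0 := by
  simp [bary, hp]

/-- The gradient of a barycentric coordinate. -/
noncomputable def baryGrad (K : Finset Plane) (p : Plane) : Plane :=
  (InnerProductSpace.toDual ℝ Plane).symm (LinearMap.toContinuousLinearMap (bary K p).linear)

theorem inner_baryGrad (K : Finset Plane) (p z : Plane) :
    inner ℝ (baryGrad K p) z = (bary K p).linear z := by
  rw [baryGrad, InnerProductSpace.toDual_symm_apply]; rfl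

theorem bary_sub (K : Finset Plane) (p x y : Plane) :
    bary K p y - bary K p x = inner ℝ (baryGrad K p) (y - x) := by
  rw [inner_baryGrad]
  simpa using ((bary K p).linearMap_vsub y x).symm

theorem bary_add (K : Finset Plane) (p x z : Plane) :
    bary K p (x + z) = bary K p x + inner ℝ (baryGrad K p) z := by
  have := bary_sub K p x (x + z)
  rw [add_sub_cancel_left] at this
  linarith

theorem baryGrad_of_notMem {K : Finset Plane} {p : Plane} (hp : p ∉ K) : baryGrad K p = 0 := by
  simp [baryGrad, bary_of_notMem hp]

theorem continuous_bary (K : Finset Plane) (p : Plane) : Continuous (bary K p) :=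
  (bary K p).continuous_of_finiteDimensional

theorem convex_tri (K : Finset Plane) : Convex ℝ (tri K) := convex_convexHull ℝ _

theorem isCompact_tri (K : Finset Plane) : IsCompact (tri K) :=
  K.finite_toSet.isCompact_convexHull ℝ

theorem isClosed_tri (K : Finset Plane) : IsClosed (tri K) := (isCompact_tri K).isClosed

theorem mem_tri_of_mem {K : Finset Plane} {p : Plane} (hp : p ∈ K) : p ∈ tri K :=
  subset_convexHull ℝ _ hp

theorem dist_le_elementDiam {K : Finset Plane} {x y : Plane} (hx : x ∈ tri K) (hy : y ∈ tri K) :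
    dist x y ≤ elementDiam K :=
  Metric.dist_le_diam_of_mem (isCompact_tri K).isBounded hx hy

namespace IsTri

variable {K : Finset Plane} (hK : IsTri K)
include hK

theorem bary_self {p : Plane} (hp : p ∈ K) : bary K p p = 1 := by
  rw [bary_eq hK hp]; exact hK.basis.coord_apply_eq ⟨p, hp⟩

theorem bary_of_ne {p q : Plane} (hq : q ∈ K) (h : q ≠ p) : bary K p q = 0 := by
  by_cases hp : p ∈ K
  · rw [bary_eq hK hp]
    exact hK.basis.coord_apply_ne (i := ⟨p, hp⟩) (j := ⟨q, hq⟩) (by simpa using h.symm)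
  · simp [bary_of_notMem hp]

theorem sum_bary (x : Plane) : ∑ p ∈ K, bary K p x = 1 := by
  rw [← hK.basis.sum_coord_apply_eq_one x, ← Finset.sum_coe_sort]
  exact Finset.sum_congr rfl fun p _ => by rw [bary_eq hK p.2]

theorem sum_bary_smul (x : Plane) : ∑ p ∈ K, bary K p x • p = x := by
  conv_rhs => rw [← hK.basis.linear_combination_coord_eq_self x]
  rw [← Finset.sum_coe_sort]
  exact Finset.sum_congr rfl fun p _ => by rw [bary_eq hK p.2, basis_apply]

theorem range_basis : Set.range hK.basis = (K : Set Plane) := by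
  ext x
  constructor
  · rintro ⟨p, rfl⟩; exact p.2
  · intro hx; exact ⟨⟨x, hx⟩, rfl⟩

theorem mem_tri_iff {x : Plane} : x ∈ tri K ↔ ∀ p ∈ K, 0 ≤ bary K p x := by
  rw [tri, ← hK.range_basis, hK.basis.convexHull_eq_nonneg_coord]
  constructor
  · intro h p hp; rw [bary_eq hK hp]; exact h ⟨p, hp⟩
  · intro h p; rw [← bary_eq hK p.2]; exact h p p.2

theorem mem_interior_tri_iff {x : Plane} : x ∈ interior (tri K) ↔ ∀ p ∈ K, 0 < bary K p x := by
  rw [tri, ← hK.range_basis, hK.basis.interior_convexHull]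
  constructor
  · intro h p hp; rw [bary_eq hK hp]; exact h ⟨p, hp⟩
  · intro h p; rw [← bary_eq hK p.2]; exact h p p.2

theorem bary_nonneg {x : Plane} (hx : x ∈ tri K) (p : Plane) : 0 ≤ bary K p x := by
  by_cases hp : p ∈ K
  · exact hK.mem_tri_iff.1 hx p hp
  · simp [bary_of_notMem hp]

theorem bary_le_one {x : Plane} (hx : x ∈ tri K) (p : Plane) : bary K p x ≤ 1 := by
  by_cases hp : p ∈ K
  · rw [← hK.sum_bary x]
    exact Finset.single_le_sum (f := fun q => bary K q x) (fun q _ => hK.bary_nonneg hx q) hp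
  · simp [bary_of_notMem hp]

theorem interior_nonempty : (interior (tri K)).Nonempty := by
  rw [tri, ← hK.range_basis]
  exact ⟨_, hK.basis.centroid_mem_interior_convexHull⟩

/-- On the hull of a set of vertices of `K` that omits `p`, the coordinate of `p` vanishes. -/
theorem bary_eq_zero_of_mem_convexHull {s : Set Plane} (hs : s ⊆ K) {p : Plane} (hp : p ∉ s)
    {x : Plane} (hx : x ∈ convexHull ℝ s) : bary K p x = 0 := by
  have hc : Convex ℝ {y | bary K p y = 0} := by
    have := (convex_singleton (0 : ℝ)).affine_preimage (bary K p)
    exact this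
  exact convexHull_min (fun q hq => hK.bary_of_ne (hs hq) (by rintro rfl; exact hp hq)) hc hx

/-- A point of the triangle lies on the hull of the vertices with positive coordinate. -/
theorem mem_convexHull_of_bary_eq_zero {x : Plane} (hx : x ∈ tri K) {s : Finset Plane}
    (hs : s ⊆ K) (h : ∀ p ∈ K, p ∉ s → bary K p x = 0) : x ∈ convexHull ℝ (s : Set Plane) := by
  have h1 : ∑ p ∈ s, bary K p x = 1 := by
    rw [← hK.sum_bary x]
    exact Finset.sum_subset hs h
  have h2 : ∑ p ∈ s, bary K p x • p = x := by
    conv_rhs => rw [← hK.sum_bary_smul x]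
    exact Finset.sum_subset hs fun p hp hps => by rw [h p hp hps, zero_smul]
  rw [← h2]
  exact (convex_convexHull ℝ _).sum_mem (fun p _ => hK.bary_nonneg hx p) h1
    (fun p hp => subset_convexHull ℝ _ hp)

theorem sum_baryGrad : ∑ p ∈ K, baryGrad K p = 0 := by
  refine ext_inner_right ℝ fun z => ?_
  rw [inner_zero_left, sum_inner]
  have h : ∀ p ∈ K, inner ℝ (baryGrad K p) z = bary K p (0 + z) - bary K p 0 := fun p _ => by
    rw [bary_sub]; simp
  rw [Finset.sum_congr rfl h, Finset.sum_sub_distrib, hK.sum_bary, hK.sum_bary, sub_self]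

theorem baryGrad_ne_zero {p : Plane} (hp : p ∈ K) : baryGrad K p ≠ 0 := by
  intro h
  obtain ⟨q, hq, hqp⟩ : ∃ q ∈ K, q ≠ p := by
    have := Finset.exists_mem_ne (s := K) (by rw [hK.card]; norm_num) p
    exact this
  have := bary_sub K p q p
  rw [hK.bary_self hp, hK.bary_of_ne hq hqp, h] at this
  simp at this

theorem norm_baryGrad_pos {p : Plane} (hp : p ∈ K) : 0 < ‖baryGrad K p‖ :=
  norm_pos_iff.2 (hK.baryGrad_ne_zero hp)

/-- Two vertices are at least the height apart. -/
theorem one_le_norm_baryGrad_mul_dist {p q : Plane} (hp : p ∈ K) (hq : q ∈ K) (h : q ≠ p) :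
    1 ≤ ‖baryGrad K p‖ * dist p q := by
  have := bary_sub K p q p
  rw [hK.bary_self hp, hK.bary_of_ne hq h, sub_zero] at this
  rw [this, dist_eq_norm]
  exact real_inner_le_norm _ _

/-- The heights are bounded below by the diameter of any inscribed ball. -/
theorem norm_baryGrad_mul_le {c : Plane} {r : ℝ} (hr : 0 ≤ r)
    (hb : Metric.closedBall c r ⊆ tri K) (p : Plane) : ‖baryGrad K p‖ * (2 * r) ≤ 1 := by
  rcases eq_or_ne (baryGrad K p) 0 with h | h
  · simp [h]
  have hn : 0 < ‖baryGrad K p‖ := norm_pos_iff.2 h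
  -- `c + u` and `c - u` are the ends of the diameter along the gradient. Between them the
  -- coordinate, which stays in `[0, 1]`, grows by `2 * r * ‖baryGrad K p‖`.
  set u : Plane := (r / ‖baryGrad K p‖) • baryGrad K p with hu
  have hun : ‖u‖ = r := by
    rw [hu, norm_smul, Real.norm_of_nonneg (by positivity)]
    field_simp
  have h1 : c + u ∈ tri K := hb (by simp [hun])
  have h2 : c - u ∈ tri K := hb (by simp [hun])
  have h3 := bary_sub K p (c - u) (c + u)
  have h4 : (c + u) - (c - u) = (2 : ℝ) • u := by rw [two_smul]; abel
  rw [h4, inner_smul_right, hu, inner_smul_right, real_inner_self_eq_norm_sq] at h3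
  have h5 : 2 * (r / ‖baryGrad K p‖ * ‖baryGrad K p‖ ^ 2) = ‖baryGrad K p‖ * (2 * r) := by
    field_simp
  have := hK.bary_le_one h1 p
  have := hK.bary_nonneg h2 p
  linarith

theorem elementDiam_pos : 0 < elementDiam K := by
  obtain ⟨p, hp, q, hq, hpq⟩ := Finset.one_lt_card.1 (by rw [hK.card]; norm_num : 1 < K.card)
  exact (dist_pos.2 hpq).trans_le (dist_le_elementDiam (mem_tri_of_mem hp) (mem_tri_of_mem hq))

theorem one_le_norm_baryGrad_mul_elementDiam {p : Plane} (hp : p ∈ K) :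
    1 ≤ ‖baryGrad K p‖ * elementDiam K := by
  obtain ⟨q, hq, hqp⟩ : ∃ q ∈ K, q ≠ p :=
    Finset.exists_mem_ne (s := K) (by rw [hK.card]; norm_num) p
  exact (hK.one_le_norm_baryGrad_mul_dist hp hq hqp).trans
    (mul_le_mul_of_nonneg_left (dist_le_elementDiam (mem_tri_of_mem hp) (mem_tri_of_mem hq))
      (norm_nonneg _))

end IsTri

/-! ### Polynomials and the inverse estimate on discs -/

/-- The function on the plane given by a polynomial. -/
noncomputable def polyFun (p : MvPolynomial (Fin 2) ℝ) (x : Plane) : ℝ :=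
  MvPolynomial.eval (fun i => x i) p

/-- The gradient of a polynomial. -/
noncomputable def gradPoly (p : MvPolynomial (Fin 2) ℝ) (x : Plane) : Plane :=
  WithLp.toLp 2 fun i => polyFun (MvPolynomial.pderiv i p) x

theorem gradPoly_apply (p : MvPolynomial (Fin 2) ℝ) (x : Plane) (i : Fin 2) :
    gradPoly p x i = polyFun (MvPolynomial.pderiv i p) x := rfl

theorem polyFun_add (p q : MvPolynomial (Fin 2) ℝ) (x : Plane) :
    polyFun (p + q) x = polyFun p x + polyFun q x := by simp [polyFun]

theorem polyFun_mul (p q : MvPolynomial (Fin 2) ℝ) (x : Plane) :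
    polyFun (p * q) x = polyFun p x * polyFun q x := by simp [polyFun]

theorem polyFun_smul (c : ℝ) (p : MvPolynomial (Fin 2) ℝ) (x : Plane) :
    polyFun (c • p) x = c * polyFun p x := by simp [polyFun]

theorem gradPoly_add (p q : MvPolynomial (Fin 2) ℝ) (x : Plane) :
    gradPoly (p + q) x = gradPoly p x + gradPoly q x := by
  ext i; simp [gradPoly_apply, polyFun]

theorem gradPoly_smul (c : ℝ) (p : MvPolynomial (Fin 2) ℝ) (x : Plane) :
    gradPoly (c • p) x = c • gradPoly p x := by
  ext i; simp [gradPoly_apply, polyFun]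

theorem gradPoly_mul (p q : MvPolynomial (Fin 2) ℝ) (x : Plane) :
    gradPoly (p * q) x = polyFun p x • gradPoly q x + polyFun q x • gradPoly p x := by
  ext i; simp [gradPoly_apply, polyFun]

theorem hasGradientAt_polyFun (p : MvPolynomial (Fin 2) ℝ) (x : Plane) :
    HasGradientAt (polyFun p) (gradPoly p x) x := by
  rw [hasGradientAt_iff_hasFDerivAt]
  induction p using MvPolynomial.induction_on with
  | C a =>
    have h1 : polyFun (MvPolynomial.C a) = fun _ => a := by funext y; simp [polyFun]
    have h2 : gradPoly (MvPolynomial.C a) x = 0 := by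
      ext i; simp [gradPoly_apply, polyFun]
    rw [h1, h2, map_zero]
    exact hasFDerivAt_const _ _
  | add p q hp hq =>
    rw [gradPoly_add, map_add]
    have h1 : polyFun (p + q) = fun y => polyFun p y + polyFun q y :=
      funext fun y => polyFun_add p q y
    rw [h1]
    exact hp.add hq
  | mul_X p i hp =>
    have h1 : polyFun (p * MvPolynomial.X i) = fun y => polyFun p y * y i := by
      funext y; simp [polyFun]
    have h2 : HasFDerivAt (fun y : Plane => y i) (EuclideanSpace.proj i : Plane →L[ℝ] ℝ) x :=
      (EuclideanSpace.proj i : Plane →L[ℝ] ℝ).hasFDerivAt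
    rw [h1]
    refine (hp.mul h2).congr_fderiv ?_
    ext z
    rw [gradPoly_mul]
    have h3 : inner ℝ (gradPoly (MvPolynomial.X i) x) z = z i := by
      rw [PiLp.inner_apply]
      simp [gradPoly_apply, polyFun, MvPolynomial.pderiv_X, Pi.single_apply]
    simp [h3, polyFun]

theorem continuous_polyFun (p : MvPolynomial (Fin 2) ℝ) : Continuous (polyFun p) :=
  continuous_iff_continuousAt.2 fun x =>
    ((hasGradientAt_iff_hasFDerivAt.1 (hasGradientAt_polyFun p x))).continuousAt

theorem continuous_gradPoly (p : MvPolynomial (Fin 2) ℝ) : Continuous (gradPoly p) :=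
  (PiLp.continuous_toLp 2 _).comp (continuous_pi fun _ => continuous_polyFun _)

theorem totalDegree_pderiv_le {p : MvPolynomial (Fin 2) ℝ} {k : ℕ} (hp : p.totalDegree ≤ k)
    (i : Fin 2) : (MvPolynomial.pderiv i p).totalDegree ≤ k := by
  conv_lhs => rw [p.as_sum, map_sum]
  refine MvPolynomial.totalDegree_finsetSum_le fun m hm => ?_
  rw [MvPolynomial.pderiv_monomial]
  refine (MvPolynomial.totalDegree_monomial_le _ _).trans ?_
  refine le_trans ?_ ((MvPolynomial.le_totalDegree hm).trans hp)
  rw [Finsupp.sum_fintype _ _ (fun _ => rfl), Finsupp.sum_fintype _ _ (fun _ => rfl)]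
  exact Finset.sum_le_sum fun j _ => by simp

/-- Polynomials are stable under scaling and translation. -/
theorem exists_polyFun_comp {p : MvPolynomial (Fin 2) ℝ} {k : ℕ} (hp : p.totalDegree ≤ k)
    (c : Plane) (r : ℝ) : ∃ q : MvPolynomial (Fin 2) ℝ, q.totalDegree ≤ k ∧
      ∀ x, polyFun q x = polyFun p (c + r • x) := by
  let f : Fin 2 → MvPolynomial (Fin 2) ℝ := fun i =>
    MvPolynomial.C (c i) + MvPolynomial.C r * MvPolynomial.X i
  have hf : ∀ i, (f i).totalDegree ≤ 1 := fun i => by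
    refine (MvPolynomial.totalDegree_add _ _).trans (max_le (by simp) ?_)
    refine (MvPolynomial.totalDegree_mul _ _).trans ?_
    simp
  refine ⟨MvPolynomial.aeval f p, ?_, fun x => ?_⟩
  · rw [MvPolynomial.aeval_def, MvPolynomial.eval₂_eq']
    refine MvPolynomial.totalDegree_finsetSum_le fun m hm => ?_
    refine (MvPolynomial.totalDegree_mul _ _).trans ?_
    rw [MvPolynomial.algebraMap_eq, MvPolynomial.totalDegree_C, zero_add]
    refine (MvPolynomial.totalDegree_finsetProd _ _).trans ?_
    refine le_trans ?_ ((MvPolynomial.le_totalDegree hm).trans hp)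
    rw [Finsupp.sum_fintype _ _ (fun _ => rfl)]
    refine Finset.sum_le_sum fun i _ => (MvPolynomial.totalDegree_pow _ _).trans ?_
    simpa using Nat.mul_le_mul_left (m i) (hf i)
  · clear hp
    induction p using MvPolynomial.induction_on with
    | C a => simp [polyFun]
    | add p q hp hq => rw [map_add, polyFun_add, polyFun_add, hp, hq]
    | mul_X p i hp =>
      rw [map_mul, polyFun_mul, polyFun_mul, hp]
      simp [polyFun, f]

/-- The disc contains a square, and a polynomial that vanishes on a product of infinite sets is
zero. -/
theorem polyFun_eq_zero_of_closedBall {p : MvPolynomial (Fin 2) ℝ}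
    (h : ∀ x ∈ Metric.closedBall (0 : Plane) 1, polyFun p x = 0) : p = 0 := by
  refine MvPolynomial.funext_set (fun _ => Set.Icc (0 : ℝ) (1 / 2))
    (fun _ => Set.Icc_infinite (by norm_num)) fun x hx => ?_
  have hx' : ∀ i, x i ∈ Set.Icc (0 : ℝ) (1 / 2) := fun i => hx i (Set.mem_univ i)
  have := h (WithLp.toLp 2 x) (by
    rw [mem_closedBall_zero_iff, EuclideanSpace.norm_eq, Real.sqrt_le_one]
    simp only [Fin.sum_univ_two, Real.norm_eq_abs, sq_abs]
    have := hx' 0; have := hx' 1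
    simp only [Set.mem_Icc] at *
    nlinarith)
  rw [map_zero]
  exact this

/-- On polynomials of bounded degree, the maximum over a large ball is controlled by the `L²` norm
over the unit ball. -/
theorem exists_sq_polyFun_le_unit (k : ℕ) (R : ℝ) : ∃ C : ℝ, 0 < C ∧
    ∀ q : MvPolynomial (Fin 2) ℝ, q.totalDegree ≤ k → ∀ x : Plane, ‖x‖ ≤ R →
      polyFun q x ^ 2 ≤ C * ∫ y in Metric.closedBall (0 : Plane) 1, polyFun q y ^ 2 := by
  classical
  set V := MvPolynomial.restrictTotalDegree (Fin 2) ℝ k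
  let b := Module.finBasis ℝ V
  set n := Module.finrank ℝ V
  let g : Fin n → Plane → ℝ := fun i => polyFun (b i : MvPolynomial (Fin 2) ℝ)
  have hgc : ∀ i, Continuous (g i) := fun i => continuous_polyFun _
  -- The squared `L²` norm is a quadratic form in the coefficients. It is positive definite, so
  -- compactness of the unit sphere bounds it below by a multiple `μ` of `‖c‖ ^ 2`.
  let Q : (Fin n → ℝ) → ℝ := fun c =>
    ∫ y in Metric.closedBall (0 : Plane) 1, (∑ i, c i * g i y) ^ 2
  have hint : ∀ f : Plane → ℝ, Continuous f →
      IntegrableOn f (Metric.closedBall (0 : Plane) 1) := fun f hf =>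
    hf.continuousOn.integrableOn_compact (isCompact_closedBall _ _)
  have hQ : ∀ c, Q c = ∑ i, ∑ j, c i * c j *
      ∫ y in Metric.closedBall (0 : Plane) 1, g i y * g j y := by
    intro c
    have h1 : ∀ y, (∑ i, c i * g i y) ^ 2 = ∑ i, ∑ j, c i * c j * (g i y * g j y) := fun y => by
      rw [sq, Finset.sum_mul_sum]
      exact Finset.sum_congr rfl fun i _ => Finset.sum_congr rfl fun j _ => by ring
    simp only [Q, h1]
    rw [integral_finsetSum _ fun i _ => hint _ (by fun_prop)]
    refine Finset.sum_congr rfl fun i _ => ?_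
    rw [integral_finsetSum _ fun j _ => hint _ (by fun_prop)]
    exact Finset.sum_congr rfl fun j _ => integral_const_mul _ _
  have hQc : Continuous Q := by
    rw [show Q = _ from funext hQ]
    fun_prop
  have hpoly : ∀ c : Fin n → ℝ, ∀ y,
      polyFun (∑ i, c i • b i : V) y = ∑ i, c i * g i y := fun c y => by
    simp [polyFun, g]
  have hQpos : ∀ c ∈ Metric.sphere (0 : Fin n → ℝ) 1, 0 < Q c := by
    intro c hc
    refine lt_of_le_of_ne (integral_nonneg fun y => sq_nonneg _) fun h0 => ?_
    have hz : ∀ y ∈ Metric.closedBall (0 : Plane) 1, (∑ i, c i * g i y) = 0 := by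
      have h1 := (setIntegral_eq_zero_iff_of_nonneg_ae (μ := volume)
        (s := Metric.closedBall (0 : Plane) 1) (f := fun y => (∑ i, c i * g i y) ^ 2)
        (Filter.Eventually.of_forall fun y => sq_nonneg _)
        (hint _ (by fun_prop))).1 h0.symm
      have h2 : ∀ y ∈ Metric.ball (0 : Plane) 1, (∑ i, c i * g i y) ^ 2 = 0 := by
        have h3 : (fun y => (∑ i, c i * g i y) ^ 2) =ᵐ[volume.restrict (Metric.ball (0 : Plane) 1)]
            (fun _ => (0 : ℝ)) :=
          ae_restrict_of_ae_restrict_of_subset Metric.ball_subset_closedBall h1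
        exact Measure.eqOn_open_of_ae_eq h3 Metric.isOpen_ball
          (by fun_prop) (by fun_prop)
      have h4 : Set.EqOn (fun y => (∑ i, c i * g i y) ^ 2) (fun _ => 0)
          (closure (Metric.ball (0 : Plane) 1)) :=
        Set.EqOn.closure h2 (by fun_prop) (by fun_prop)
      rw [closure_ball _ one_ne_zero] at h4
      exact fun y hy => by simpa using h4 hy
    have h5 : (∑ i, c i • b i : V) = 0 := by
      have := polyFun_eq_zero_of_closedBall (p := ((∑ i, c i • b i : V) : MvPolynomial (Fin 2) ℝ))
        (fun y hy => by rw [hpoly]; exact hz y hy)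
      exact Subtype.ext this
    have h6 : c = 0 := by
      funext i
      exact (Fintype.linearIndependent_iff.1 b.linearIndependent) c h5 i
    rw [h6] at hc
    simp at hc
  obtain ⟨μ, hμ, hμQ⟩ := (isCompact_sphere (0 : Fin n → ℝ) 1).exists_forall_le' hQc.continuousOn
    hQpos
  have hQlow : ∀ c, μ * ‖c‖ ^ 2 ≤ Q c := by
    intro c
    rcases eq_or_ne c 0 with rfl | hc
    · simp [Q]
    · have hn : 0 < ‖c‖ := norm_pos_iff.2 hc
      have h1 := hμQ (‖c‖⁻¹ • c) (by simp [norm_smul, hn.ne'])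
      have h2 : Q (‖c‖⁻¹ • c) = (‖c‖ ^ 2)⁻¹ * Q c := by
        rw [hQ, hQ, Finset.mul_sum]
        refine Finset.sum_congr rfl fun i _ => ?_
        rw [Finset.mul_sum]
        refine Finset.sum_congr rfl fun j _ => ?_
        simp only [Pi.smul_apply, smul_eq_mul]
        field_simp
      rw [h2, inv_mul_eq_div, le_div_iff₀ (by positivity)] at h1
      exact h1
  choose L hL using fun i => (isCompact_closedBall (0 : Plane) R).exists_bound_of_continuousOn
    (hgc i).continuousOn
  -- The summand `1` only makes the constant positive when all bounds `L i` vanish.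
  refine ⟨(∑ i, |L i|) ^ 2 / μ + 1, by positivity, fun q hq x hx => ?_⟩
  have hqV : q ∈ V := (MvPolynomial.mem_restrictTotalDegree _ _ _).2 hq
  set c : Fin n → ℝ := ⇑(b.repr ⟨q, hqV⟩)
  have hqc : ∀ y, polyFun q y = ∑ i, c i * g i y := fun y => by
    rw [← hpoly c y, b.sum_repr]
  have hQq : ∫ y in Metric.closedBall (0 : Plane) 1, polyFun q y ^ 2 = Q c := by
    simp only [hqc, Q]
  have hup : |polyFun q x| ≤ (∑ i, |L i|) * ‖c‖ := by
    rw [hqc, Finset.sum_mul]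
    refine (Finset.abs_sum_le_sum_abs _ _).trans (Finset.sum_le_sum fun i _ => ?_)
    rw [abs_mul, mul_comm]
    refine mul_le_mul ?_ (norm_le_pi_norm c i) (abs_nonneg _) (abs_nonneg _)
    exact (hL i x (mem_closedBall_zero_iff.2 hx)).trans (le_abs_self _)
  rw [hQq, ← sq_abs]
  have hQ0 : 0 ≤ Q c := (by positivity : 0 ≤ μ * ‖c‖ ^ 2).trans (hQlow c)
  calc |polyFun q x| ^ 2 ≤ ((∑ i, |L i|) * ‖c‖) ^ 2 := by gcongr
    _ = (∑ i, |L i|) ^ 2 / μ * (μ * ‖c‖ ^ 2) := by field_simp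
    _ ≤ (∑ i, |L i|) ^ 2 / μ * Q c := by gcongr; exact hQlow c
    _ ≤ _ := by nlinarith

open scoped Pointwise in
theorem setIntegral_closedBall_eq (f : Plane → ℝ) (c : Plane) {r : ℝ} (hr : 0 < r) :
    ∫ x in Metric.closedBall c r, f x
      = r ^ 2 * ∫ y in Metric.closedBall (0 : Plane) 1, f (c + r • y) := by
  have h1 := Measure.setIntegral_comp_smul_of_pos (volume : Measure Plane) (fun x => f (c + x))
    (Metric.closedBall (0 : Plane) 1) hr
  rw [h1]
  have h2 : r • Metric.closedBall (0 : Plane) 1 = Metric.closedBall (0 : Plane) r := by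
    rw [smul_closedBall _ _ zero_le_one]; simp [abs_of_pos hr]
  rw [h2]
  have h3 : ∫ x in Metric.closedBall c r, f x = ∫ x in Metric.closedBall (0 : Plane) r, f (c + x) := by
    rw [← (measurePreserving_add_left (volume : Measure Plane) c).setIntegral_preimage_emb
      (measurableEmbedding_addLeft c)]
    congr 2
    ext x; simp
  rw [h3]
  simp only [finrank_euclideanSpace, Fintype.card_fin, smul_eq_mul]
  field_simp

/-- The inverse estimate for gradients of polynomials. -/
theorem exists_norm_gradPoly_le (k : ℕ) (R : ℝ) : ∃ C : ℝ, 0 < C ∧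
    ∀ q : MvPolynomial (Fin 2) ℝ, q.totalDegree ≤ k → ∀ (c : Plane) (r : ℝ), 0 < r →
      ∀ x ∈ Metric.closedBall c (R * r),
        r ^ 2 * ‖gradPoly q x‖ ^ 2 ≤ C * ∫ y in Metric.closedBall c r, ‖gradPoly q y‖ ^ 2 := by
  obtain ⟨C, hC, h⟩ := exists_sq_polyFun_le_unit k R
  -- The scalar estimate, obtained by scaling to the unit disc; `r ^ 2` is the Jacobian. It is
  -- applied below to both partial derivatives.
  have key : ∀ q : MvPolynomial (Fin 2) ℝ, q.totalDegree ≤ k → ∀ (c : Plane) (r : ℝ), 0 < r →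
      ∀ x ∈ Metric.closedBall c (R * r),
        r ^ 2 * polyFun q x ^ 2 ≤ C * ∫ y in Metric.closedBall c r, polyFun q y ^ 2 := by
    intro q hq c r hr x hx
    obtain ⟨q', hq', hqq⟩ := exists_polyFun_comp hq c r
    have h1 := h q' hq' (r⁻¹ • (x - c)) (by
      rw [norm_smul, norm_inv, Real.norm_of_nonneg hr.le, inv_mul_le_iff₀ hr, mul_comm,
        ← dist_eq_norm]
      exact hx)
    rw [setIntegral_closedBall_eq _ _ hr]
    simp only [hqq] at h1
    rw [smul_inv_smul₀ hr.ne', add_sub_cancel] at h1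
    nlinarith [sq_nonneg r]
  refine ⟨C, hC, fun q hq c r hr x hx => ?_⟩
  have hs : ∀ y, ‖gradPoly q y‖ ^ 2 = polyFun (MvPolynomial.pderiv 0 q) y ^ 2
      + polyFun (MvPolynomial.pderiv 1 q) y ^ 2 := fun y => by
    rw [EuclideanSpace.norm_sq_eq]
    simp [Fin.sum_univ_two, gradPoly_apply]
  simp only [hs]
  have hi : ∀ i, IntegrableOn (fun y => polyFun (MvPolynomial.pderiv i q) y ^ 2)
      (Metric.closedBall c r) := fun i =>
    ((continuous_polyFun _).pow 2).continuousOn.integrableOn_compact (isCompact_closedBall _ _)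
  rw [integral_add (hi 0) (hi 1)]
  have h0 := key _ (totalDegree_pderiv_le hq 0) c r hr x hx
  have h1 := key _ (totalDegree_pderiv_le hq 1) c r hr x hx
  linarith

/-! ### The mesh near a boundary face -/

section Mesh

variable {Ω : Set Plane} {T : Geometry.SimplicialComplex ℝ Plane} {K K' : Finset Plane}

theorem isTri_of_mem_elements (hK : K ∈ elements T) : IsTri K := ⟨T.indep hK.1, hK.2⟩

theorem IsFittedTriangulation.finite_elements (hT : IsFittedTriangulation Ω T) :
    (elements T).Finite := hT.finite.subset fun _ h => h.1

theorem IsFittedTriangulation.tri_subset_closure (hT : IsFittedTriangulation Ω T)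
    (hK : K ∈ elements T) : tri K ⊆ closure Ω := by
  rw [← hT.space_eq]
  exact Geometry.SimplicialComplex.convexHull_subset_space hK.1

theorem IsFittedTriangulation.exists_mem_tri (hT : IsFittedTriangulation Ω T) {x : Plane}
    (hx : x ∈ closure Ω) : ∃ K ∈ elements T, x ∈ tri K := by
  rw [← hT.space_eq, Geometry.SimplicialComplex.mem_space_iff] at hx
  obtain ⟨s, hs, hxs⟩ := hx
  obtain ⟨K, hK, hsK⟩ := hT.pure s hs
  exact ⟨K, hK, convexHull_mono (by exact_mod_cast hsK) hxs⟩

theorem mem_convexHull_inter (hK : K ∈ elements T) (hK' : K' ∈ elements T) {x : Plane}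
    (hx : x ∈ tri K) (hx' : x ∈ tri K') : x ∈ convexHull ℝ ((K : Set Plane) ∩ K') :=
  T.inter_subset_convexHull hK.1 hK'.1 ⟨hx, hx'⟩

theorem bary_eq_zero_of_mem_inter (hK : K ∈ elements T) (hK' : K' ∈ elements T) {x p : Plane}
    (hx : x ∈ tri K) (hx' : x ∈ tri K') (hp : p ∉ K') : bary K p x = 0 :=
  (isTri_of_mem_elements hK).bary_eq_zero_of_mem_convexHull Set.inter_subset_left
    (fun h => hp h.2) (mem_convexHull_inter hK hK' hx hx')

/-- Barycentric coordinates of different elements agree where the elements meet. -/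
theorem bary_eq_of_mem_inter (hK : K ∈ elements T) (hK' : K' ∈ elements T) {x : Plane}
    (hx : x ∈ tri K) (hx' : x ∈ tri K') (p : Plane) : bary K p x = bary K' p x := by
  have hc : Convex ℝ {y | (bary K p - bary K' p) y = 0} :=
    (convex_singleton (0 : ℝ)).affine_preimage (bary K p - bary K' p)
  have h := convexHull_min (t := {y | (bary K p - bary K' p) y = 0}) ?_ hc
    (mem_convexHull_inter hK hK' hx hx')
  · simpa [sub_eq_zero] using h
  · rintro q ⟨hq, hq'⟩
    have hq : q ∈ K := hq
    have hq' : q ∈ K' := hq'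
    by_cases hqp : q = p
    · subst hqp
      simp [(isTri_of_mem_elements hK).bary_self hq, (isTri_of_mem_elements hK').bary_self hq']
    · simp [(isTri_of_mem_elements hK).bary_of_ne hq hqp,
        (isTri_of_mem_elements hK').bary_of_ne hq' hqp]

/-- At an interior point of `K` all coordinates are positive, whereas at a common point the
coordinates of vertices that are not shared vanish. Hence `K ⊆ K'`. -/
theorem eq_of_mem_interior (hK : K ∈ elements T) (hK' : K' ∈ elements T) {x : Plane}
    (hx : x ∈ interior (tri K)) (hx' : x ∈ tri K') : K' = K := by
  have hsub : K ⊆ K' := fun p hp => by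
    by_contra h
    have h1 := (isTri_of_mem_elements hK).mem_interior_tri_iff.1 hx p hp
    rw [bary_eq_zero_of_mem_inter hK hK' (interior_subset hx) hx' h] at h1
    exact lt_irrefl _ h1
  exact (Finset.eq_of_subset_of_card_le hsub (by rw [hK.2, hK'.2])).symm

/-- Near `x`, the closure of the domain is covered by the elements that contain `x`. -/
theorem IsFittedTriangulation.eventually_mem_tri (hT : IsFittedTriangulation Ω T) (x : Plane) :
    ∀ᶠ y in 𝓝 x, y ∈ closure Ω → ∃ K ∈ elements T, x ∈ tri K ∧ y ∈ tri K := by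
  have h1 : ∀ K ∈ elements T, ∀ᶠ y in 𝓝 x, y ∈ tri K → x ∈ tri K := fun K _ => by
    by_cases hx : x ∈ tri K
    · exact Filter.Eventually.of_forall fun _ _ => hx
    · filter_upwards [(isClosed_tri K).isOpen_compl.mem_nhds hx] with y hy hy'
      exact absurd hy' hy
  filter_upwards [(Filter.eventually_all_finite hT.finite_elements).2 h1] with y hy hyΩ
  obtain ⟨K, hK, hyK⟩ := hT.exists_mem_tri hyΩ
  exact ⟨K, hK, hy K hK hyK, hyK⟩

/-- `x` lies in the relative interior of the face of `K` opposite to the vertex `p`. -/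
structure OnFace (K : Finset Plane) (p x : Plane) : Prop where
  mem : p ∈ K
  eq_zero : bary K p x = 0
  pos : ∀ q ∈ K, q ≠ p → 0 < bary K q x

theorem OnFace.mem_tri (hK : IsTri K) {p x : Plane} (h : OnFace K p x) : x ∈ tri K := by
  rw [hK.mem_tri_iff]
  intro q hq
  rcases eq_or_ne q p with rfl | hqp
  · exact h.eq_zero.ge
  · exact (h.pos q hq hqp).le

theorem OnFace.erase_subset (hK : K ∈ elements T) (hK' : K' ∈ elements T) {p x : Plane}
    (h : OnFace K p x) (hx : x ∈ tri K') : K.erase p ⊆ K' := by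
  intro q hq
  rw [Finset.mem_erase] at hq
  by_contra hq'
  have h1 := h.pos q hq.2 hq.1
  rw [bary_eq_zero_of_mem_inter hK hK' (h.mem_tri (isTri_of_mem_elements hK)) hx hq'] at h1
  exact lt_irrefl _ h1

/-- Of the three inequalities that describe the triangle, only the one for `p` is not strict at `x`.
-/
theorem OnFace.eventually_mem_tri_iff (hK : IsTri K) {p x : Plane} (h : OnFace K p x) :
    ∀ᶠ y in 𝓝 x, (y ∈ tri K ↔ 0 ≤ bary K p y) := by
  have h1 : ∀ q ∈ K, ∀ᶠ y in 𝓝 x, q ≠ p → 0 < bary K q y := fun q hq => by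
    by_cases hqp : q = p
    · simp [hqp]
    · filter_upwards [(continuous_bary K q).continuousAt.eventually
        (lt_mem_nhds (h.pos q hq hqp))] with y hy _ using hy
  filter_upwards [(Filter.eventually_all_finset K).2 h1] with y hy
  rw [hK.mem_tri_iff]
  refine ⟨fun h' => h' p h.mem, fun h' q hq => ?_⟩
  rcases eq_or_ne q p with rfl | hqp
  · exact h'
  · exact (hy q hq hqp).le

/-- The barycentric coordinate is nonnegative near a point only if it is positive there. -/
theorem IsTri.eventually_bary_nonneg_iff (hK : IsTri K) {p : Plane} (hp : p ∈ K) (y : Plane) :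
    (∀ᶠ z in 𝓝 y, 0 ≤ bary K p z) ↔ 0 < bary K p y := by
  constructor
  · intro h
    -- Against its gradient the coordinate decreases strictly, so it cannot be zero at `y` and
    -- nonnegative around it.
    have ht : Filter.Tendsto (fun t : ℝ => y - t • baryGrad K p) (𝓝[>] 0) (𝓝 y) := by
      have : Continuous fun t : ℝ => y - t • baryGrad K p := by fun_prop
      have h0 := this.tendsto 0
      rw [zero_smul, sub_zero] at h0
      exact h0.mono_left nhdsWithin_le_nhds
    obtain ⟨t, ht0, ht⟩ := ((ht.eventually h).and self_mem_nhdsWithin).exists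
    rw [sub_eq_add_neg, bary_add, inner_neg_right, inner_smul_right,
      real_inner_self_eq_norm_sq] at ht0
    have : 0 < t * ‖baryGrad K p‖ ^ 2 := mul_pos ht (pow_pos (hK.norm_baryGrad_pos hp) 2)
    linarith
  · intro h
    exact ((continuous_bary K p).continuousAt.eventually (lt_mem_nhds h)).mono fun z hz => hz.le

/-- No further element contains the face of `K` opposite to the vertex `p`. -/
def IsOuterFace (T : Geometry.SimplicialComplex ℝ Plane) (K : Finset Plane) (p : Plane) : Prop :=
  ∀ K' ∈ elements T, K.erase p ⊆ K' → K' = K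

/-- Two elements with a common face cover a neighbourhood of its relative interior. -/
theorem OnFace.union_mem_nhds (hK : K ∈ elements T) (hK' : K' ∈ elements T) {p x : Plane}
    (h : OnFace K p x) (hsub : K.erase p ⊆ K') (hne : K' ≠ K) : tri K ∪ tri K' ∈ 𝓝 x := by
  have hT := isTri_of_mem_elements hK
  have hT' := isTri_of_mem_elements hK'
  have hxK := h.mem_tri hT
  have hpK' : p ∉ K' := fun hp => hne <| by
    refine (Finset.eq_of_subset_of_card_le (s := K) (fun q hq => ?_) (by rw [hK.2, hK'.2])).symm
    rcases eq_or_ne q p with rfl | hqp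
    · exact hp
    · exact hsub (Finset.mem_erase.2 ⟨hqp, hq⟩)
  obtain ⟨p', hp', hp'e⟩ : ∃ p' ∈ K', p' ∉ K.erase p := by
    refine Finset.exists_mem_notMem_of_card_lt_card ?_
    rw [Finset.card_erase_of_mem h.mem, hK.2, hK'.2]; norm_num
  have hee : K'.erase p' = K.erase p := by
    refine (Finset.eq_of_subset_of_card_le (fun q hq => ?_) ?_).symm
    · exact Finset.mem_erase.2 ⟨by rintro rfl; exact hp'e hq, hsub hq⟩
    · rw [Finset.card_erase_of_mem h.mem, Finset.card_erase_of_mem hp', hK.2, hK'.2]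
  have hpp : p' ≠ p := by rintro rfl; exact hpK' hp'
  have hp'K : p' ∉ K := fun hh => hp'e (Finset.mem_erase.2 ⟨hpp, hh⟩)
  have hxK' : x ∈ tri K' := by
    refine convexHull_mono (by exact_mod_cast hsub) (hT.mem_convexHull_of_bary_eq_zero hxK
      (Finset.erase_subset _ _) fun q hq hq' => ?_)
    have : q = p := by by_contra hqp; exact hq' (Finset.mem_erase.2 ⟨hqp, hq⟩)
    rw [this]; exact h.eq_zero
  -- Both sides are affine, vanish on the common face and agree at `p'`.
  have hprop : ∀ y, bary K p y = bary K' p' y * bary K p p' := by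
    intro y
    have h1 : bary K p y = ∑ q ∈ K', bary K' q y * bary K p q := by
      have hz : ∀ z, bary K p z = bary K p 0 + inner ℝ (baryGrad K p) z := fun z => by
        simpa using bary_add K p 0 z
      rw [hz y, Finset.sum_congr rfl fun q _ => by rw [hz q]]
      conv_lhs => rw [← hT'.sum_bary_smul y]
      rw [inner_sum]
      simp_rw [mul_add, Finset.sum_add_distrib, ← Finset.sum_mul, hT'.sum_bary, inner_smul_right]
      ring
    rw [h1, Finset.sum_eq_single p']
    · intro q hq hqp'
      have : q ∈ K.erase p := by rw [← hee]; exact Finset.mem_erase.2 ⟨hqp', hq⟩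
      rw [Finset.mem_erase] at this
      rw [hT.bary_of_ne this.2 this.1, mul_zero]
    · intro h; exact absurd hp' h
  have h' : OnFace K' p' x := by
    refine ⟨hp', bary_eq_zero_of_mem_inter hK' hK hxK' hxK hp'K, fun q hq hqp' => ?_⟩
    have : q ∈ K.erase p := by rw [← hee]; exact Finset.mem_erase.2 ⟨hqp', hq⟩
    rw [Finset.mem_erase] at this
    rw [bary_eq_of_mem_inter hK' hK hxK' hxK]
    exact h.pos q this.2 this.1
  -- The third vertices of the two elements lie on opposite sides of the common face.
  have hneg : bary K p p' < 0 := by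
    by_contra hnn
    push Not at hnn
    have hpos : 0 < bary K p p' := by
      refine lt_of_le_of_ne hnn fun h0 => ?_
      have h1 := hprop p
      rw [← h0, mul_zero, hT.bary_self h.mem] at h1
      exact one_ne_zero h1
    -- the two elements would overlap
    have hboth : ∀ᶠ y in 𝓝 x, 0 ≤ - bary K p y := by
      filter_upwards [h.eventually_mem_tri_iff hT, h'.eventually_mem_tri_iff hT'] with y hy hy'
      rcases le_or_gt (bary K p y) 0 with h0 | h0
      · linarith
      · have h1 : y ∈ tri K := hy.2 h0.le
        have h2 : y ∈ tri K' := hy'.2 (by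
          rw [hprop y] at h0
          exact (pos_of_mul_pos_left h0 hpos.le).le)
        rw [bary_eq_zero_of_mem_inter hK hK' h1 h2 hpK'] at h0
        exact absurd h0 (lt_irrefl _)
    have ht : Filter.Tendsto (fun t : ℝ => x + t • baryGrad K p) (𝓝[>] 0) (𝓝 x) := by
      have : Continuous fun t : ℝ => x + t • baryGrad K p := by fun_prop
      have h0 := this.tendsto 0
      rw [zero_smul, add_zero] at h0
      exact h0.mono_left nhdsWithin_le_nhds
    obtain ⟨t, ht0, ht⟩ := ((ht.eventually hboth).and self_mem_nhdsWithin).exists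
    rw [bary_add, inner_smul_right, real_inner_self_eq_norm_sq, h.eq_zero] at ht0
    have : 0 < t * ‖baryGrad K p‖ ^ 2 := mul_pos ht (pow_pos (hT.norm_baryGrad_pos h.mem) 2)
    linarith
  filter_upwards [h.eventually_mem_tri_iff hT, h'.eventually_mem_tri_iff hT'] with y hy hy'
  rcases le_or_gt 0 (bary K p y) with h0 | h0
  · exact Or.inl (hy.2 h0)
  · refine Or.inr (hy'.2 ?_)
    rw [hprop y] at h0
    by_contra hc
    push Not at hc
    nlinarith

/-- With a second element at the face, a neighbourhood of `x` would lie in the closure of `Ω`, and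
`x` in its interior `Ω`. -/
theorem OnFace.isOuterFace (hT : IsFittedTriangulation Ω T) (hreg : interior (closure Ω) = Ω)
    (hK : K ∈ elements T) {p x : Plane} (h : OnFace K p x) (hx : x ∉ Ω) : IsOuterFace T K p := by
  intro K' hK' hsub
  by_contra hne
  refine hx ?_
  rw [← hreg, mem_interior_iff_mem_nhds]
  exact Filter.mem_of_superset (h.union_mem_nhds hK hK' hsub hne)
    (Set.union_subset (hT.tri_subset_closure hK) (hT.tri_subset_closure hK'))

/-- Each element that contains `x` contains the whole face, so `K` is the only element near `x`. -/
theorem OnFace.eventually_closure (hT : IsFittedTriangulation Ω T)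
    (hK : K ∈ elements T) {p x : Plane} (h : OnFace K p x) (ho : IsOuterFace T K p) :
    ∀ᶠ y in 𝓝 x, (y ∈ closure Ω ↔ y ∈ tri K) := by
  filter_upwards [hT.eventually_mem_tri x] with y hy
  refine ⟨fun hyΩ => ?_, fun hyK => hT.tri_subset_closure hK hyK⟩
  obtain ⟨K', hK', hxK', hyK'⟩ := hy hyΩ
  rwa [← ho K' hK' (h.erase_subset hK hK' hxK')]

/-- Near `x` the closure of `Ω` is a closed half plane, and `Ω`, being the interior of its closure,
is the open one. -/
theorem OnFace.eventually_mem_iff (hT : IsFittedTriangulation Ω T)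
    (hreg : interior (closure Ω) = Ω) (hK : K ∈ elements T) {p x : Plane} (h : OnFace K p x)
    (ho : IsOuterFace T K p) : ∀ᶠ y in 𝓝 x, (y ∈ Ω ↔ 0 < bary K p y) := by
  have h1 : ∀ᶠ y in 𝓝 x, (y ∈ closure Ω ↔ 0 ≤ bary K p y) := by
    filter_upwards [h.eventually_closure hT hK ho,
      h.eventually_mem_tri_iff (isTri_of_mem_elements hK)] with y h1 h2
    rw [h1, h2]
  filter_upwards [eventually_eventually_nhds.2 h1] with y hy
  conv_lhs => rw [← hreg, mem_interior_iff_mem_nhds]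
  rw [← (isTri_of_mem_elements hK).eventually_bary_nonneg_iff h.mem]
  exact Filter.eventually_congr hy

theorem OnFace.mem_frontier (hT : IsFittedTriangulation Ω T)
    (hreg : interior (closure Ω) = Ω) (hK : K ∈ elements T) {p x : Plane} (h : OnFace K p x)
    (ho : IsOuterFace T K p) : x ∈ frontier Ω := by
  refine ⟨hT.tri_subset_closure hK (h.mem_tri (isTri_of_mem_elements hK)), fun hx => ?_⟩
  have h1 := (h.eventually_mem_iff hT hreg hK ho).self_of_nhds.1 (interior_subset hx)
  rw [h.eq_zero] at h1
  exact lt_irrefl _ h1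

theorem IsTri.erase_card (hK : IsTri K) {p : Plane} (hp : p ∈ K) : (K.erase p).card = 2 := by
  rw [Finset.card_erase_of_mem hp, hK.card]

theorem IsTri.bary_mem_face (hK : IsTri K) {p x : Plane}
    (hx : x ∈ convexHull ℝ (K.erase p : Set Plane)) : bary K p x = 0 :=
  hK.bary_eq_zero_of_mem_convexHull (by simp)
    (by simp) hx

theorem face_subset_tri (K : Finset Plane) (p : Plane) :
    convexHull ℝ (K.erase p : Set Plane) ⊆ tri K :=
  convexHull_mono (by exact_mod_cast Finset.erase_subset _ _)

theorem IsTri.exists_onFace (hK : IsTri K) {p : Plane} (hp : p ∈ K) : ∃ x, OnFace K p x := by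
  obtain ⟨q, r, hqr, he⟩ := Finset.card_eq_two.1 (hK.erase_card hp)
  have hq : q ∈ K.erase p := by simp [he]
  have hr : r ∈ K.erase p := by simp [he]
  have hq' := Finset.mem_erase.1 hq
  have hr' := Finset.mem_erase.1 hr
  have hv : ∀ s, bary K s (midpoint ℝ q r) = (bary K s q + bary K s r) / 2 := fun s => by
    have h := (bary K s).map_midpoint q r
    rw [h, midpoint_eq_smul_add, smul_eq_mul]
    simp; ring
  refine ⟨midpoint ℝ q r, hp, ?_, fun s hs hsp => ?_⟩
  · rw [hv, hK.bary_of_ne hq'.2 hq'.1, hK.bary_of_ne hr'.2 hr'.1]; simp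
  · have : s ∈ K.erase p := Finset.mem_erase.2 ⟨hsp, hs⟩
    rw [he] at this
    rcases Finset.mem_insert.1 this with rfl | h
    · rw [hv, hK.bary_self hs, hK.bary_of_ne hr'.2 hqr.symm]; norm_num
    · rw [Finset.mem_singleton] at h; subst h
      rw [hv, hK.bary_self hs, hK.bary_of_ne hq'.2 hqr]; norm_num

/-- A closed set that contains the relative interior of a face contains the face. -/
theorem IsTri.face_subset_of_onFace (hK : IsTri K) {p : Plane} (hp : p ∈ K) {F : Set Plane}
    (hF : IsClosed F) (h : ∀ x, OnFace K p x → x ∈ F) :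
    convexHull ℝ (K.erase p : Set Plane) ⊆ F := by
  intro x hx
  obtain ⟨m, hm⟩ := hK.exists_onFace hp
  -- On the way from `x` to a point `m` of the relative interior all intermediate points are in the
  -- relative interior.
  have hsub : openSegment ℝ x m ⊆ F := by
    rintro y ⟨a, b, ha, hb, hab, rfl⟩
    have hv : ∀ s, bary K s (a • x + b • m) = a * bary K s x + b * bary K s m := fun s =>
      Convex.combo_affine_apply hab
    refine h _ ⟨hp, ?_, fun q hq hqp => ?_⟩
    · rw [hv, hK.bary_mem_face hx, hm.eq_zero]; simp
    · rw [hv]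
      have := hK.bary_nonneg (face_subset_tri K p hx) q
      have := hm.pos q hq hqp
      positivity
  have := closure_minimal hsub hF
  rw [closure_openSegment] at this
  exact this (left_mem_segment ℝ x m)

theorem erase_mem_faces (hK : K ∈ elements T) {p : Plane} (hp : p ∈ K) : K.erase p ∈ T.faces :=
  T.down_closed hK.1 (Finset.erase_subset _ _) (Finset.card_pos.1 (by
    rw [(isTri_of_mem_elements hK).erase_card hp]; norm_num))

/-- The bridge between geometry (the edge lies in the frontier) and combinatorics (it belongs to one
element only). -/
theorem erase_mem_facesIn_iff (hT : IsFittedTriangulation Ω T) (hreg : interior (closure Ω) = Ω)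
    (hK : K ∈ elements T) {p : Plane} (hp : p ∈ K) :
    K.erase p ∈ facesIn T (frontier Ω) ↔ IsOuterFace T K p := by
  have hKt := isTri_of_mem_elements hK
  constructor
  · rintro ⟨-, -, h⟩
    obtain ⟨x, hx⟩ := hKt.exists_onFace hp
    have hxe : x ∈ convexHull ℝ (K.erase p : Set Plane) := by
      refine hKt.mem_convexHull_of_bary_eq_zero (hx.mem_tri hKt)
        (Finset.erase_subset _ _) fun q hq hq' => ?_
      have : q = p := by by_contra hqp; exact hq' (Finset.mem_erase.2 ⟨hqp, hq⟩)
      rw [this]; exact hx.eq_zero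
    refine hx.isOuterFace hT hreg hK fun hxΩ => ?_
    have h2 := (h hxe).2
    rw [← hreg, interior_interior] at h2
    rw [← hreg] at hxΩ
    exact h2 hxΩ
  · intro ho
    refine ⟨erase_mem_faces hK hp, hKt.erase_card hp, ?_⟩
    exact hKt.face_subset_of_onFace hp isClosed_frontier
      fun x hx => hx.mem_frontier hT hreg hK ho

open Classical in
/-- The pairs of an element `K` and a vertex `p` such that the face of `K` opposite to `p` lies on
the boundary. -/
noncomputable def IsFittedTriangulation.bdryPairs (hT : IsFittedTriangulation Ω T) :
    Finset (Finset Plane × Plane) :=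
  (hT.finite_elements.toFinset.biUnion fun K => K.image fun p => (K, p)).filter
    fun c => c.1.erase c.2 ∈ facesIn T (frontier Ω)

theorem IsFittedTriangulation.mem_bdryPairs (hT : IsFittedTriangulation Ω T)
    {c : Finset Plane × Plane} : c ∈ hT.bdryPairs ↔
      c.1 ∈ elements T ∧ c.2 ∈ c.1 ∧ c.1.erase c.2 ∈ facesIn T (frontier Ω) := by
  rcases c with ⟨K, p⟩
  simp only [bdryPairs, Finset.mem_filter, Finset.mem_biUnion, Set.Finite.mem_toFinset,
    Finset.mem_image, Prod.mk.injEq]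
  constructor
  · rintro ⟨⟨K', hK', p', hp', rfl, rfl⟩, h⟩; exact ⟨hK', hp', h⟩
  · rintro ⟨hK, hp, h⟩; exact ⟨⟨K, hK, p, hp, rfl, rfl⟩, h⟩

theorem IsTri.mem_face_of_bary_eq_zero (hK : IsTri K) {p x : Plane} (hx : x ∈ tri K)
    (h : bary K p x = 0) : x ∈ convexHull ℝ (K.erase p : Set Plane) := by
  refine hK.mem_convexHull_of_bary_eq_zero hx (Finset.erase_subset _ _) fun q hq hq' => ?_
  have : q = p := by by_contra hqp; exact hq' (Finset.mem_erase.2 ⟨hqp, hq⟩)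
  rw [this]; exact h

theorem IsTri.mem_of_two_eq_zero (hK : IsTri K) {p q x : Plane} (hp : p ∈ K) (hq : q ∈ K)
    (hpq : p ≠ q) (h1 : bary K p x = 0) (h2 : bary K q x = 0) : x ∈ K := by
  have hq' : q ∈ K.erase p := Finset.mem_erase.2 ⟨hpq.symm, hq⟩
  have hc : ((K.erase p).erase q).card = 1 := by
    rw [Finset.card_erase_of_mem hq', hK.erase_card hp]
  obtain ⟨r, hr⟩ := Finset.card_eq_one.1 hc
  have hz : ∀ s ∈ K, s ∉ (K.erase p).erase q → bary K s x = 0 := by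
    intro s hs hs'
    by_cases h : s = p
    · rw [h, h1]
    by_cases h' : s = q
    · rw [h', h2]
    exact absurd (Finset.mem_erase.2 ⟨h', Finset.mem_erase.2 ⟨h, hs⟩⟩) hs'
  have hsub : (K.erase p).erase q ⊆ K :=
    (Finset.erase_subset _ _).trans (Finset.erase_subset _ _)
  have hs1 : ∑ s ∈ (K.erase p).erase q, bary K s x = 1 := by
    rw [← hK.sum_bary x]; exact Finset.sum_subset hsub hz
  have hs2 : ∑ s ∈ (K.erase p).erase q, bary K s x • s = x := by
    conv_rhs => rw [← hK.sum_bary_smul x]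
    exact Finset.sum_subset hsub fun s hs hs' => by rw [hz s hs hs', zero_smul]
  rw [hr, Finset.sum_singleton] at hs1 hs2
  rw [hs1, one_smul] at hs2
  rw [← hs2]
  exact hsub (by simp [hr])

/-- The boundary is the union of the boundary faces of the mesh. -/
theorem IsFittedTriangulation.exists_bdryPair (hT : IsFittedTriangulation Ω T)
    (hreg : interior (closure Ω) = Ω) (hperf : Preperfect (frontier Ω)) {x : Plane}
    (hx : x ∈ frontier Ω) : ∃ c ∈ hT.bdryPairs, x ∈ convexHull ℝ (c.1.erase c.2 : Set Plane) := by
  set V : Set Plane := ⋃ K ∈ elements T, (K : Set Plane)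
  have hV : V.Finite := hT.finite_elements.biUnion fun K _ => K.finite_toSet
  set F : Set Plane := ⋃ c ∈ hT.bdryPairs, convexHull ℝ (c.1.erase c.2 : Set Plane)
  have hF : IsClosed F := by
    refine Set.Finite.isClosed_biUnion hT.bdryPairs.finite_toSet fun c _ => ?_
    exact ((Finset.finite_toSet _).isCompact_convexHull ℝ).isClosed
  have hsub : ∀ y ∈ frontier Ω, y ∉ V → y ∈ F := by
    intro y hy hyV
    obtain ⟨K, hK, hyK⟩ := hT.exists_mem_tri hy.1
    have hKt := isTri_of_mem_elements hK
    have hyΩ : y ∉ Ω := fun h => hy.2 (by rw [← hreg, interior_interior]; rwa [hreg])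
    obtain ⟨p, hp, hp0⟩ : ∃ p ∈ K, bary K p y = 0 := by
      by_contra hcon
      push Not at hcon
      refine hyΩ ?_
      rw [← hreg]
      refine interior_mono (hT.tri_subset_closure hK) (hKt.mem_interior_tri_iff.2 fun p hp => ?_)
      exact lt_of_le_of_ne (hKt.bary_nonneg hyK p) (hcon p hp).symm
    have hon : OnFace K p y := by
      refine ⟨hp, hp0, fun q hq hqp => lt_of_le_of_ne (hKt.bary_nonneg hyK q) fun h0 => hyV ?_⟩
      exact Set.mem_biUnion hK (hKt.mem_of_two_eq_zero hp hq hqp.symm hp0 h0.symm)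
    have ho := hon.isOuterFace hT hreg hK hyΩ
    refine Set.mem_biUnion (x := (K, p)) ?_ (hKt.mem_face_of_bary_eq_zero hyK hp0)
    exact hT.mem_bdryPairs.2 ⟨hK, hp, (erase_mem_facesIn_iff hT hreg hK hp).2 ho⟩
  have hxF : x ∈ F := by
    -- The preceding argument excludes vertices. Since the frontier has no isolated points, a vertex
    -- on it is a limit of frontier points that are not vertices.
    have h1 := accPt_iff_frequently.1 (hperf x hx)
    have h2 : ∀ᶠ y in 𝓝 x, y ∉ V \ {x} :=
      (hV.subset Set.sdiff_subset).isClosed.isOpen_compl.mem_nhds (by simp)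
    have h3 : ∃ᶠ y in 𝓝 x, y ∈ F := by
      refine (h1.and_eventually h2).mono fun y hy => hsub y hy.1.2 fun hyV => hy.2 ⟨hyV, hy.1.1⟩
    exact hF.mem_of_frequently_of_tendsto h3 Filter.tendsto_id
  simpa [F] using hxF

theorem IsFittedTriangulation.face_subset_frontier (hT : IsFittedTriangulation Ω T)
    {c : Finset Plane × Plane} (hc : c ∈ hT.bdryPairs) :
    convexHull ℝ (c.1.erase c.2 : Set Plane) ⊆ frontier Ω :=
  (hT.mem_bdryPairs.1 hc).2.2.2.2

theorem IsFittedTriangulation.isOuterFace (hT : IsFittedTriangulation Ω T)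
    (hreg : interior (closure Ω) = Ω) {c : Finset Plane × Plane} (hc : c ∈ hT.bdryPairs) :
    IsOuterFace T c.1 c.2 := by
  obtain ⟨h1, h2, h3⟩ := hT.mem_bdryPairs.1 hc
  exact (erase_mem_facesIn_iff hT hreg h1 h2).1 h3

/-- The gradient of a function that is a polynomial on the only element near `x`. -/
theorem grad_eq_gradPoly (hK : IsTri K) {v : Plane → ℝ} {p : MvPolynomial (Fin 2) ℝ}
    (hv : ∀ x ∈ tri K, v x = polyFun p x) (hKΩ : tri K ⊆ closure Ω) {x : Plane} (hx : x ∈ tri K)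
    (hloc : ∀ᶠ y in 𝓝 x, y ∈ closure Ω → y ∈ tri K) : grad Ω v x = gradPoly p x := by
  -- A triangle inside the closure of `Ω` already determines the derivative, also at points of the
  -- boundary.
  have hu : UniqueDiffWithinAt ℝ (closure Ω) x :=
    (uniqueDiffWithinAt_convex (convex_tri K) hK.interior_nonempty (subset_closure hx)).mono hKΩ
  have h1 : HasFDerivWithinAt (polyFun p)
      (InnerProductSpace.toDual ℝ Plane (gradPoly p x)) (closure Ω) x :=
    (hasGradientAt_iff_hasFDerivAt.1 (hasGradientAt_polyFun p x)).hasFDerivWithinAt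
  have h2 : v =ᶠ[𝓝[closure Ω] x] polyFun p := by
    filter_upwards [mem_nhdsWithin_of_mem_nhds hloc, self_mem_nhdsWithin] with y hy hyΩ
    exact hv y (hy hyΩ)
  have h3 := (h1.congr_of_eventuallyEq h2 (hv x hx)).fderivWithin hu
  rw [grad, gradientWithin, h3]
  simp

/-- In the direction `ν' - ν` one enters the half plane of `ν` and leaves that of `ν'`. Uniqueness
makes the choice in `outwardNormal` harmless. -/
theorem IsOutwardNormal.unique {x ν ν' : Plane} (h : IsOutwardNormal Ω x ν)
    (h' : IsOutwardNormal Ω x ν') : ν = ν' := by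
  by_contra hne
  have hlt : inner ℝ ν ν' < 1 := (inner_lt_one_iff_real_of_norm_eq_one h.1 h'.1).2 hne
  have ht : Filter.Tendsto (fun t : ℝ => x + t • (ν' - ν)) (𝓝[>] 0) (𝓝 x) := by
    have : Continuous fun t : ℝ => x + t • (ν' - ν) := by fun_prop
    have h0 := this.tendsto 0
    rw [zero_smul, add_zero] at h0
    exact h0.mono_left nhdsWithin_le_nhds
  obtain ⟨t, ⟨h1, h2⟩, ht⟩ := ((ht.eventually (h.2.and h'.2)).and self_mem_nhdsWithin).exists
  have ht : 0 < t := ht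
  rw [h1, add_sub_cancel_left, inner_smul_right, inner_smul_right, inner_sub_right,
    inner_sub_right, real_inner_self_eq_norm_sq, real_inner_self_eq_norm_sq, h.1, h'.1,
    real_inner_comm ν ν'] at h2
  have h3 := h2.1 (mul_neg_of_pos_of_neg ht (by linarith))
  have : 0 < t * (1 ^ 2 - inner ℝ ν ν') := mul_pos ht (by linarith)
  linarith

/-- The outward unit normal of the element `K` on the face opposite to the vertex `p`. -/
noncomputable def faceNormal (K : Finset Plane) (p : Plane) : Plane :=
  -(‖baryGrad K p‖⁻¹ • baryGrad K p)

theorem IsTri.norm_faceNormal (hK : IsTri K) {p : Plane} (hp : p ∈ K) : ‖faceNormal K p‖ = 1 := by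
  rw [faceNormal, norm_neg, norm_smul, norm_inv, norm_norm,
    inv_mul_cancel₀ (hK.norm_baryGrad_pos hp).ne']

theorem OnFace.outwardNormal_eq (hT : IsFittedTriangulation Ω T)
    (hreg : interior (closure Ω) = Ω) (hK : K ∈ elements T) {p x : Plane} (h : OnFace K p x)
    (ho : IsOuterFace T K p) : outwardNormal Ω x = faceNormal K p := by
  have hKt := isTri_of_mem_elements hK
  have hn : IsOutwardNormal Ω x (faceNormal K p) := by
    refine ⟨hKt.norm_faceNormal h.mem, ?_⟩
    filter_upwards [h.eventually_mem_iff hT hreg hK ho] with y hy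
    have h1 := bary_sub K p x y
    rw [h.eq_zero, sub_zero] at h1
    rw [hy, h1, faceNormal, inner_neg_left, real_inner_smul_left, neg_lt_zero,
      mul_pos_iff_of_pos_left (inv_pos.2 (hKt.norm_baryGrad_pos h.mem))]
  have hex : ∃ ν, IsOutwardNormal Ω x ν := ⟨_, hn⟩
  rw [outwardNormal, dif_pos hex]
  exact hex.choose_spec.unique hn

end Mesh

/-! ### Integrals as sums over elements and boundary faces -/

/-- The face of the triangle `K` opposite to the vertex `p`. -/
def face (K : Finset Plane) (p : Plane) : Set Plane := convexHull ℝ (K.erase p : Set Plane)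

/-- Arc length in the plane. -/
noncomputable abbrev arcLength : Measure Plane := Measure.hausdorffMeasure 1

theorem isCompact_face (K : Finset Plane) (p : Plane) : IsCompact (face K p) :=
  (Finset.finite_toSet _).isCompact_convexHull ℝ

theorem arcLength_finite {s : Set Plane} (hs : s.Finite) : arcLength s = 0 := by
  have : NullSingletonClass arcLength := Measure.nullSingletonClass_hausdorff Plane one_pos
  exact hs.measure_zero _

theorem IsTri.exists_face_eq_segment {K : Finset Plane} (hK : IsTri K) {p : Plane} (hp : p ∈ K) :
    ∃ q r, q ≠ r ∧ K.erase p = {q, r} ∧ face K p = segment ℝ q r := by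
  obtain ⟨q, r, hqr, he⟩ := Finset.card_eq_two.1 (hK.erase_card hp)
  refine ⟨q, r, hqr, he, ?_⟩
  rw [face, he, Finset.coe_pair, convexHull_pair]

theorem arcLength_segment (q r : Plane) : arcLength.real (segment ℝ q r) = dist q r := by
  rw [Measure.real, hausdorffMeasure_segment, edist_dist, ENNReal.toReal_ofReal dist_nonneg]

theorem IsTri.arcLength_face_ne_top {K : Finset Plane} (hK : IsTri K) {p : Plane} (hp : p ∈ K) :
    arcLength (face K p) ≠ ⊤ := by
  obtain ⟨q, r, -, -, h⟩ := hK.exists_face_eq_segment hp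
  rw [h, hausdorffMeasure_segment]
  exact edist_ne_top _ _

theorem IsTri.arcLength_face_le {K : Finset Plane} (hK : IsTri K) {p : Plane} (hp : p ∈ K) :
    arcLength.real (face K p) ≤ elementDiam K := by
  obtain ⟨q, r, -, he, h⟩ := hK.exists_face_eq_segment hp
  rw [h, arcLength_segment]
  have hq : q ∈ K.erase p := by simp [he]
  have hr : r ∈ K.erase p := by simp [he]
  exact dist_le_elementDiam (mem_tri_of_mem (Finset.mem_of_mem_erase hq))
    (mem_tri_of_mem (Finset.mem_of_mem_erase hr))

theorem IsTri.integrableOn_face {K : Finset Plane} (hK : IsTri K) {p : Plane} (hp : p ∈ K)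
    {f : Plane → ℝ} (hf : Continuous f) : IntegrableOn f (face K p) arcLength := by
  obtain ⟨C, hC⟩ := (isCompact_face K p).exists_bound_of_continuousOn hf.continuousOn
  refine Measure.integrableOn_of_bounded (hK.arcLength_face_ne_top hp)
    hf.aestronglyMeasurable (M := C) ?_
  exact (ae_restrict_iff' (isCompact_face K p).measurableSet).2 (Filter.Eventually.of_forall hC)

theorem integrableOn_tri (K : Finset Plane) {f : Plane → ℝ} (hf : Continuous f) :
    IntegrableOn f (tri K) :=
  hf.continuousOn.integrableOn_compact (isCompact_tri K)

theorem setIntegral_eq_sum_of_ae {ι : Type*} {μ : Measure Plane} (t : Finset ι)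
    {A : ι → Set Plane} {S : Set Plane} {f : Plane → ℝ} (hm : ∀ i ∈ t, MeasurableSet (A i))
    (hd : ∀ i ∈ t, ∀ j ∈ t, i ≠ j → μ (A i ∩ A j) = 0) (hS : S =ᵐ[μ] ⋃ i ∈ t, A i)
    (hf : ∀ i ∈ t, IntegrableOn f (A i) μ) : ∫ x in S, f x ∂μ = ∑ i ∈ t, ∫ x in A i, f x ∂μ := by
  rw [setIntegral_congr_set hS]
  have h1 : ⋃ i ∈ t, A i = ⋃ i : t, A i := by
    rw [Set.iUnion_subtype]
  have hfi : IntegrableOn f (⋃ i ∈ t, A i) μ := (integrableOn_finset_iUnion).2 hf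
  rw [h1] at hfi ⊢
  rw [integral_iUnion_ae (s := fun i : t => A i) (fun i => (hm i i.2).nullMeasurableSet) (fun i j hij => ?_) hfi,
    tsum_fintype, Finset.sum_coe_sort t fun i => ∫ x in A i, f x ∂μ]
  exact hd i i.2 j j.2 (fun h => hij (Subtype.ext h))

/-- The polynomials `P K` represent the function `v` on the elements of the mesh. -/
def Represents (T : Geometry.SimplicialComplex ℝ Plane) (k : ℕ)
    (P : Finset Plane → MvPolynomial (Fin 2) ℝ) (v : Plane → ℝ) : Prop :=
  ∀ K ∈ elements T, (P K).totalDegree ≤ k ∧ ∀ x ∈ tri K, v x = polyFun (P K) x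

section Mesh

variable {Ω : Set Plane} {T : Geometry.SimplicialComplex ℝ Plane} {k : ℕ}

/-- Continuity is automatic: a single function that agrees with a polynomial on each of finitely
many closed sets is continuous on their union. -/
theorem mem_feSpace_iff (hT : IsFittedTriangulation Ω T) {v : Plane → ℝ} :
    v ∈ feSpace Ω T k ↔ ∃ P, Represents T k P v := by
  classical
  constructor
  · rintro ⟨-, h⟩
    choose! P hP using h
    exact ⟨P, hP⟩
  · rintro ⟨P, hP⟩
    refine ⟨?_, fun K hK => ⟨P K, hP K hK⟩⟩
    have hcl : closure Ω = ⋃ K : elements T, tri K := by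
      ext x
      simp only [Set.mem_iUnion]
      constructor
      · intro hx
        obtain ⟨K, hK, hxK⟩ := hT.exists_mem_tri hx
        exact ⟨⟨K, hK⟩, hxK⟩
      · rintro ⟨K, hxK⟩; exact hT.tri_subset_closure K.2 hxK
    rw [hcl]
    have : Finite (elements T) := hT.finite_elements
    refine (locallyFinite_of_finite _).continuousOn_iUnion (fun K => isClosed_tri K) fun K => ?_
    exact (continuous_polyFun (P K)).continuousOn.congr fun x hx => (hP K K.2).2 x hx

theorem volume_inter_tri {K K' : Finset Plane} (hK : K ∈ elements T) (hK' : K' ∈ elements T)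
    (hne : K ≠ K') : volume (tri K ∩ tri K') = 0 := by
  refine measure_mono_null (fun x hx => ?_) ((convex_tri K).addHaar_frontier volume)
  refine ⟨subset_closure hx.1, fun hxi => hne ?_⟩
  exact (eq_of_mem_interior hK hK' hxi hx.2).symm

theorem domain_ae_eq (hT : IsFittedTriangulation Ω T) (hreg : interior (closure Ω) = Ω) :
    Ω =ᵐ[volume] ⋃ K ∈ hT.finite_elements.toFinset, tri K := by
  have hn : volume (⋃ K ∈ hT.finite_elements.toFinset, frontier (tri K)) = 0 :=
    (measure_biUnion_null_iff (Finset.countable_toSet _)).2 fun K _ =>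
      (convex_tri K).addHaar_frontier volume
  rw [← compl_mem_ae_iff] at hn
  filter_upwards [hn] with x hx
  refine propext ⟨fun h => ?_, fun h => ?_⟩
  · obtain ⟨K, hK, hxK⟩ := hT.exists_mem_tri (subset_closure h)
    exact Set.mem_biUnion (by simpa using hK) hxK
  · obtain ⟨K, hK, hxK⟩ := Set.mem_iUnion₂.1 h
    have hK' : K ∈ elements T := by simpa using hK
    change x ∈ Ω
    rw [← hreg]
    refine interior_mono (hT.tri_subset_closure hK') ?_
    by_contra hxi
    exact hx (Set.mem_biUnion hK ⟨subset_closure hxK, hxi⟩)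

theorem Represents.grad_eq_ae {P : Finset Plane → MvPolynomial (Fin 2) ℝ} {v : Plane → ℝ}
    (hv : Represents T k P v) (hT : IsFittedTriangulation Ω T) {K : Finset Plane}
    (hK : K ∈ elements T) : ∀ᵐ x ∂(volume.restrict (tri K)), grad Ω v x = gradPoly (P K) x := by
  rw [ae_restrict_iff' (isClosed_tri K).measurableSet]
  have hn := compl_mem_ae_iff.2 ((convex_tri K).addHaar_frontier volume)
  filter_upwards [hn] with x hx hxK
  refine grad_eq_gradPoly (isTri_of_mem_elements hK) (hv K hK).2 (hT.tri_subset_closure hK) hxK ?_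
  have hxi : x ∈ interior (tri K) := by
    by_contra h
    exact hx ⟨subset_closure hxK, h⟩
  filter_upwards [mem_interior_iff_mem_nhds.1 hxi] with y hy _ using hy

theorem integral_inner_grad (hT : IsFittedTriangulation Ω T) (hreg : interior (closure Ω) = Ω)
    {P Q : Finset Plane → MvPolynomial (Fin 2) ℝ} {v w : Plane → ℝ} (hv : Represents T k P v)
    (hw : Represents T k Q w) : ∫ x in Ω, inner ℝ (grad Ω v x) (grad Ω w x)
      = ∑ K ∈ hT.finite_elements.toFinset,
        ∫ x in tri K, inner ℝ (gradPoly (P K) x) (gradPoly (Q K) x) := by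
  have hae : ∀ K ∈ hT.finite_elements.toFinset,
      (fun x => inner ℝ (grad Ω v x) (grad Ω w x)) =ᵐ[volume.restrict (tri K)]
        fun x => inner ℝ (gradPoly (P K) x) (gradPoly (Q K) x) := fun K hK => by
    have hK : K ∈ elements T := by simpa using hK
    filter_upwards [hv.grad_eq_ae hT hK, hw.grad_eq_ae hT hK] with x h1 h2
    rw [h1, h2]
  rw [setIntegral_eq_sum_of_ae hT.finite_elements.toFinset
    (fun K _ => (isClosed_tri K).measurableSet) (fun K hK K' hK' hne => ?_)
    (domain_ae_eq hT hreg) (fun K hK => ?_)]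
  · exact Finset.sum_congr rfl fun K hK => integral_congr_ae (hae K hK)
  · exact volume_inter_tri (by simpa using hK) (by simpa using hK') hne
  · refine IntegrableOn.congr_fun_ae ?_ (hae K hK).symm
    exact integrableOn_tri K ((continuous_gradPoly _).inner (continuous_gradPoly _))

/-- A simplex that does not contain the face shares at most one vertex with it, and a point has
length zero. -/
theorem arcLength_inter_face (hT : IsFittedTriangulation Ω T)
    {c : Finset Plane × Plane} (hc : c ∈ hT.bdryPairs) {s : Finset Plane} (hs : s ∈ T.faces)
    (hcs : ¬ c.1.erase c.2 ⊆ s) :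
    arcLength (face c.1 c.2 ∩ convexHull ℝ (s : Set Plane)) = 0 := by
  obtain ⟨h1, h2, h3⟩ := hT.mem_bdryPairs.1 hc
  refine measure_mono_null (T.inter_subset_convexHull h3.1 hs) (arcLength_finite ?_)
  have hcard : (c.1.erase c.2 ∩ s).card ≤ 1 := by
    have hlt : (c.1.erase c.2 ∩ s).card < (c.1.erase c.2).card := by
      refine Finset.card_lt_card ⟨Finset.inter_subset_left, fun h => hcs ?_⟩
      exact h.trans Finset.inter_subset_right
    rw [h3.2.1] at hlt
    omega
  rw [← Finset.coe_inter]
  rcases Finset.card_le_one_iff_subset_singleton.1 hcard with ⟨q, hq⟩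
  refine (Set.finite_singleton q).subset ?_
  have : (↑(c.1.erase c.2 ∩ s) : Set Plane) ⊆ {q} := by exact_mod_cast hq
  exact (convexHull_mono this).trans (by rw [convexHull_singleton])

/-- A boundary face belongs to one element only, so different pairs stand for different faces. -/
theorem arcLength_face_inter_face (hT : IsFittedTriangulation Ω T)
    (hreg : interior (closure Ω) = Ω) {c d : Finset Plane × Plane} (hc : c ∈ hT.bdryPairs)
    (hd : d ∈ hT.bdryPairs) (hne : c ≠ d) : arcLength (face c.1 c.2 ∩ face d.1 d.2) = 0 := by
  obtain ⟨h1, h2, h3⟩ := hT.mem_bdryPairs.1 hc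
  obtain ⟨h1', h2', h3'⟩ := hT.mem_bdryPairs.1 hd
  refine arcLength_inter_face hT hc h3'.1 fun hsub => hne ?_
  have hee : c.1.erase c.2 = d.1.erase d.2 :=
    Finset.eq_of_subset_of_card_le hsub (by rw [h3.2.1, h3'.2.1])
  have hK : d.1 = c.1 := hT.isOuterFace hreg hc d.1 h1' (hsub.trans (Finset.erase_subset _ _))
  refine Prod.ext hK.symm ?_
  by_contra hp
  rw [hK] at hee h2'
  have : c.2 ∈ c.1.erase d.2 := Finset.mem_erase.2 ⟨hp, h2⟩
  rw [← hee] at this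
  exact Finset.notMem_erase _ _ this

theorem ae_onFace {K : Finset Plane} (hK : IsTri K) {p : Plane} (hp : p ∈ K) :
    ∀ᵐ x ∂(arcLength.restrict (face K p)), OnFace K p x := by
  rw [ae_restrict_iff' (isCompact_face K p).measurableSet]
  have hn := compl_mem_ae_iff.2 (arcLength_finite K.finite_toSet)
  filter_upwards [hn] with x hx hxf
  have hxK : x ∈ tri K := face_subset_tri K p hxf
  refine ⟨hp, hK.bary_mem_face hxf, fun q hq hqp =>
    lt_of_le_of_ne (hK.bary_nonneg hxK q) fun h0 => hx ?_⟩
  exact hK.mem_of_two_eq_zero hp hq hqp.symm (hK.bary_mem_face hxf) h0.symm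

theorem Represents.normalDeriv_eq_ae {P : Finset Plane → MvPolynomial (Fin 2) ℝ} {v : Plane → ℝ}
    (hv : Represents T k P v) (hT : IsFittedTriangulation Ω T) (hreg : interior (closure Ω) = Ω)
    {c : Finset Plane × Plane} (hc : c ∈ hT.bdryPairs) :
    ∀ᵐ x ∂(arcLength.restrict (face c.1 c.2)),
      normalDeriv Ω v x = inner ℝ (gradPoly (P c.1) x) (faceNormal c.1 c.2) := by
  obtain ⟨h1, h2, h3⟩ := hT.mem_bdryPairs.1 hc
  have hKt := isTri_of_mem_elements h1
  have ho := hT.isOuterFace hreg hc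
  filter_upwards [ae_onFace hKt h2] with x hx
  rw [normalDeriv, hx.outwardNormal_eq hT hreg h1 ho,
    grad_eq_gradPoly hKt (hv _ h1).2 (hT.tri_subset_closure h1) (hx.mem_tri hKt)
      ((hx.eventually_closure hT h1 ho).mono fun y hy => hy.1)]

theorem frontier_eq_biUnion (hT : IsFittedTriangulation Ω T) (hreg : interior (closure Ω) = Ω)
    (hperf : Preperfect (frontier Ω)) :
    frontier Ω = ⋃ c ∈ hT.bdryPairs, face c.1 c.2 := by
  ext x
  constructor
  · intro hx
    obtain ⟨c, hc, hxc⟩ := hT.exists_bdryPair hreg hperf hx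
    exact Set.mem_biUnion hc hxc
  · intro hx
    obtain ⟨c, hc, hxc⟩ := Set.mem_iUnion₂.1 hx
    exact hT.face_subset_frontier hc hxc

theorem integral_frontier (hT : IsFittedTriangulation Ω T) (hreg : interior (closure Ω) = Ω)
    (hperf : Preperfect (frontier Ω)) {f : Plane → ℝ} {g : Finset Plane × Plane → Plane → ℝ}
    (hg : ∀ c, Continuous (g c))
    (h : ∀ c ∈ hT.bdryPairs, f =ᵐ[arcLength.restrict (face c.1 c.2)] g c) :
    ∫ x in frontier Ω, f x ∂arcLength = ∑ c ∈ hT.bdryPairs, ∫ x in face c.1 c.2, g c x ∂arcLength := by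
  rw [frontier_eq_biUnion hT hreg hperf, setIntegral_eq_sum_of_ae hT.bdryPairs
    (fun c _ => (isCompact_face c.1 c.2).measurableSet)
    (fun c hc d hd hne => arcLength_face_inter_face hT hreg hc hd hne)
    (Filter.EventuallyEq.refl _ _) (fun c hc => ?_)]
  · exact Finset.sum_congr rfl fun c hc => integral_congr_ae (h c hc)
  · obtain ⟨h1, h2, -⟩ := hT.mem_bdryPairs.1 hc
    exact ((isTri_of_mem_elements h1).integrableOn_face h2 (hg c)).congr_fun_ae (h c hc).symm

theorem bdryInner_normalDeriv (hT : IsFittedTriangulation Ω T) (hreg : interior (closure Ω) = Ω)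
    (hperf : Preperfect (frontier Ω)) {P Q : Finset Plane → MvPolynomial (Fin 2) ℝ}
    {v w : Plane → ℝ} (hv : Represents T k P v) (hw : Represents T k Q w) :
    bdryInner Ω (normalDeriv Ω v) w = ∑ c ∈ hT.bdryPairs, ∫ x in face c.1 c.2,
      inner ℝ (gradPoly (P c.1) x) (faceNormal c.1 c.2) * polyFun (Q c.1) x ∂arcLength := by
  refine integral_frontier hT hreg hperf
    (g := fun c x => inner ℝ (gradPoly (P c.1) x) (faceNormal c.1 c.2) * polyFun (Q c.1) x)
    (fun c => ((continuous_gradPoly _).inner continuous_const).mul (continuous_polyFun _))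
    fun c hc => ?_
  obtain ⟨h1, h2, -⟩ := hT.mem_bdryPairs.1 hc
  filter_upwards [hv.normalDeriv_eq_ae hT hreg hc,
    ae_restrict_mem (isCompact_face c.1 c.2).measurableSet] with x hx hxf
  rw [hx, (hw _ h1).2 x (face_subset_tri _ _ hxf)]

theorem bdryInner_comm (f g : Plane → ℝ) : bdryInner Ω f g = bdryInner Ω g f := by
  simp only [bdryInner, mul_comm]

/-- The boundary of `K` may also touch boundary faces of other elements, but only in single points.
So the elementwise boundary norm regroups into a sum over boundary faces. -/
theorem frontier_inter_ae_eq (hT : IsFittedTriangulation Ω T) (hreg : interior (closure Ω) = Ω)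
    (hperf : Preperfect (frontier Ω)) {K : Finset Plane} (hK : K ∈ elements T) :
    (frontier Ω ∩ frontier (tri K) : Set Plane) =ᵐ[arcLength]
      ⋃ c ∈ hT.bdryPairs.filter fun c => c.1 = K, face c.1 c.2 := by
  have hn : arcLength (⋃ c ∈ hT.bdryPairs.filter fun c => c.1 ≠ K, face c.1 c.2 ∩ tri K) = 0 := by
    refine (measure_biUnion_null_iff (Finset.countable_toSet _)).2 fun c hc => ?_
    have hc' := Finset.mem_filter.1 (Finset.mem_coe.1 hc)
    refine arcLength_inter_face hT hc'.1 hK.1 fun hsub => hc'.2 ?_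
    exact (hT.isOuterFace hreg hc'.1 K hK hsub).symm
  rw [← compl_mem_ae_iff] at hn
  filter_upwards [hn] with x hx
  refine propext ⟨fun h => ?_, fun h => ?_⟩
  · have h' : x ∈ frontier Ω ∩ frontier (tri K) := h
    obtain ⟨c, hc, hxc⟩ := hT.exists_bdryPair hreg hperf h'.1
    refine Set.mem_biUnion (x := c) ?_ hxc
    refine Finset.mem_coe.2 (Finset.mem_filter.2 ⟨hc, ?_⟩)
    by_contra hne
    refine hx (Set.mem_biUnion (x := c) (Finset.mem_coe.2 (Finset.mem_filter.2 ⟨hc, hne⟩))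
      ⟨hxc, ?_⟩)
    exact (isClosed_tri K).frontier_subset h'.2
  · obtain ⟨c, hc, hxc⟩ := Set.mem_iUnion₂.1 h
    obtain ⟨hcB, rfl⟩ := Finset.mem_filter.1 hc
    obtain ⟨h1, h2, -⟩ := hT.mem_bdryPairs.1 hcB
    change x ∈ frontier Ω ∩ frontier (tri c.1)
    refine ⟨hT.face_subset_frontier hcB hxc, subset_closure (face_subset_tri _ _ hxc), fun hi => ?_⟩
    have h3 := (isTri_of_mem_elements h1).mem_interior_tri_iff.1 hi _ h2
    rw [(isTri_of_mem_elements h1).bary_mem_face hxc] at h3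
    exact lt_irrefl _ h3

theorem bdryNormSq_eq (hT : IsFittedTriangulation Ω T) (hreg : interior (closure Ω) = Ω)
    (hperf : Preperfect (frontier Ω)) {P : Finset Plane → MvPolynomial (Fin 2) ℝ}
    {v : Plane → ℝ} (hv : Represents T k P v) :
    bdryNormSq Ω T v = ∑ c ∈ hT.bdryPairs,
      (elementDiam c.1)⁻¹ * ∫ x in face c.1 c.2, polyFun (P c.1) x ^ 2 ∂arcLength := by
  have hloc : ∀ K ∈ hT.finite_elements.toFinset,
      ∫ x in frontier Ω ∩ frontier (tri K), (elementDiam K)⁻¹ * v x * v x ∂arcLength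
        = ∑ c ∈ hT.bdryPairs.filter fun c => c.1 = K,
          (elementDiam c.1)⁻¹ * ∫ x in face c.1 c.2, polyFun (P c.1) x ^ 2 ∂arcLength := by
    intro K hK
    have hK : K ∈ elements T := by simpa using hK
    have hae : ∀ c ∈ hT.bdryPairs.filter (fun c => c.1 = K),
        (fun x => (elementDiam K)⁻¹ * v x * v x) =ᵐ[arcLength.restrict (face c.1 c.2)]
          fun x => (elementDiam c.1)⁻¹ * polyFun (P c.1) x ^ 2 := fun c hc => by
      obtain ⟨hc, rfl⟩ := Finset.mem_filter.1 hc
      filter_upwards [ae_restrict_mem (isCompact_face c.1 c.2).measurableSet] with x hxf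
      rw [(hv _ hK).2 x (face_subset_tri _ _ hxf)]
      ring
    have hS := frontier_inter_ae_eq hT hreg hperf hK
    have hint : ∀ c ∈ hT.bdryPairs.filter (fun c => c.1 = K),
        IntegrableOn (fun x => (elementDiam K)⁻¹ * v x * v x) (face c.1 c.2) arcLength := by
      intro c hc
      obtain ⟨h1, h2, -⟩ := hT.mem_bdryPairs.1 (Finset.mem_filter.1 hc).1
      exact ((isTri_of_mem_elements h1).integrableOn_face h2
        (continuous_const.mul ((continuous_polyFun _).pow 2))).congr_fun_ae (hae c hc).symm
    have hsum := setIntegral_eq_sum_of_ae (μ := arcLength) _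
      (fun c _ => (isCompact_face c.1 c.2).measurableSet) (fun c hc d hd hne =>
        arcLength_face_inter_face hT hreg (Finset.mem_filter.1 hc).1
          (Finset.mem_filter.1 hd).1 hne) hS hint
    rw [hsum]
    refine Finset.sum_congr rfl fun c hc => ?_
    rw [integral_congr_ae (hae c hc), integral_const_mul]
  rw [bdryNormSq, finsum_mem_eq_finite_toFinset_sum _ hT.finite_elements,
    Finset.sum_congr rfl hloc]
  refine Finset.sum_fiberwise_of_maps_to (fun c hc => ?_) _
  simpa using (hT.mem_bdryPairs.1 hc).1

end Mesh

/-! ### Scaled estimates on a single element -/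

/-- Families of polynomials, one for each triangle. -/
abbrev PolyFamily : Type := Finset Plane → MvPolynomial (Fin 2) ℝ

/-- The Dirichlet form on an element. -/
noncomputable def energy (K : Finset Plane) (p q : MvPolynomial (Fin 2) ℝ) : ℝ :=
  ∫ x in tri K, inner ℝ (gradPoly p x) (gradPoly q x)

/-- The normal derivative of `p` on a face, tested with `q`. -/
noncomputable def fluxForm (c : Finset Plane × Plane) (p q : MvPolynomial (Fin 2) ℝ) : ℝ :=
  ∫ x in face c.1 c.2, inner ℝ (gradPoly p x) (faceNormal c.1 c.2) * polyFun q x ∂arcLength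

/-- The flux of the gradient of `p` through a face. -/
noncomputable def faceFlux (c : Finset Plane × Plane) (p : MvPolynomial (Fin 2) ℝ) : ℝ :=
  ∫ x in face c.1 c.2, inner ℝ (gradPoly p x) (faceNormal c.1 c.2) ∂arcLength

/-- The weighted squared `L²` norm on a face. -/
noncomputable def faceMass (c : Finset Plane × Plane) (p : MvPolynomial (Fin 2) ℝ) : ℝ :=
  (elementDiam c.1)⁻¹ * ∫ x in face c.1 c.2, polyFun p x ^ 2 ∂arcLength

section Local

variable {K : Finset Plane}

theorem energy_add_right (K : Finset Plane) (p q r : MvPolynomial (Fin 2) ℝ) :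
    energy K p (q + r) = energy K p q + energy K p r := by
  simp only [energy, gradPoly_add, inner_add_right]
  exact integral_add
    (integrableOn_tri K ((continuous_gradPoly _).inner (continuous_gradPoly _)))
    (integrableOn_tri K ((continuous_gradPoly _).inner (continuous_gradPoly _)))

theorem energy_smul_right (K : Finset Plane) (p q : MvPolynomial (Fin 2) ℝ) (a : ℝ) :
    energy K p (a • q) = a * energy K p q := by
  simp only [energy, gradPoly_smul, inner_smul_right]
  exact integral_const_mul _ _

theorem energy_self_nonneg (K : Finset Plane) (p : MvPolynomial (Fin 2) ℝ) : 0 ≤ energy K p p :=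
  integral_nonneg fun _ => real_inner_self_nonneg

theorem IsTri.integrableOn_fluxForm (hK : IsTri K) {z : Plane} (hz : z ∈ K)
    (p q : MvPolynomial (Fin 2) ℝ) :
    IntegrableOn (fun x => inner ℝ (gradPoly p x) (faceNormal K z) * polyFun q x) (face K z)
      arcLength :=
  hK.integrableOn_face hz
    (((continuous_gradPoly _).inner continuous_const).mul (continuous_polyFun _))

theorem IsTri.fluxForm_add_right (hK : IsTri K) {z : Plane} (hz : z ∈ K)
    (p q r : MvPolynomial (Fin 2) ℝ) :
    fluxForm (K, z) p (q + r) = fluxForm (K, z) p q + fluxForm (K, z) p r := by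
  simp only [fluxForm, polyFun_add, mul_add]
  exact integral_add (hK.integrableOn_fluxForm hz _ _) (hK.integrableOn_fluxForm hz _ _)

theorem IsTri.fluxForm_add_left (hK : IsTri K) {z : Plane} (hz : z ∈ K)
    (p q r : MvPolynomial (Fin 2) ℝ) :
    fluxForm (K, z) (p + q) r = fluxForm (K, z) p r + fluxForm (K, z) q r := by
  simp only [fluxForm, gradPoly_add, inner_add_left, add_mul]
  exact integral_add (hK.integrableOn_fluxForm hz _ _) (hK.integrableOn_fluxForm hz _ _)

theorem fluxForm_smul_right (c : Finset Plane × Plane) (p q : MvPolynomial (Fin 2) ℝ) (a : ℝ) :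
    fluxForm c p (a • q) = a * fluxForm c p q := by
  simp only [fluxForm, polyFun_smul, mul_left_comm _ a]
  exact integral_const_mul _ _

theorem fluxForm_smul_left (c : Finset Plane × Plane) (p q : MvPolynomial (Fin 2) ℝ) (a : ℝ) :
    fluxForm c (a • p) q = a * fluxForm c p q := by
  simp only [fluxForm, gradPoly_smul, real_inner_smul_left, mul_assoc]
  exact integral_const_mul _ _

/-- The area of the unit disc. -/
noncomputable def discArea : ℝ := volume.real (Metric.ball (0 : Plane) 1)

theorem discArea_pos : 0 < discArea :=
  ENNReal.toReal_pos (Metric.measure_ball_pos _ _ one_pos).ne' measure_ball_lt_top.ne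

theorem volume_closedBall (c : Plane) {r : ℝ} (hr : 0 ≤ r) :
    volume.real (Metric.closedBall c r) = r ^ 2 * discArea := by
  rw [Measure.real, Measure.addHaar_closedBall _ _ hr, ENNReal.toReal_mul,
    ENNReal.toReal_ofReal (by positivity)]
  simp [discArea, Measure.real]

theorem IsTri.volume_tri_le (hK : IsTri K) :
    volume.real (tri K) ≤ discArea * elementDiam K ^ 2 := by
  obtain ⟨x, hx⟩ := hK.interior_nonempty
  rw [mul_comm, ← volume_closedBall x hK.elementDiam_pos.le]
  refine measureReal_mono (fun y hy => ?_) measure_closedBall_lt_top.ne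
  exact dist_le_elementDiam hy (interior_subset hx)

variable {p q : MvPolynomial (Fin 2) ℝ} {γ b : ℝ}

/-- In the plane the Dirichlet form is scale invariant: two gradients contribute `h⁻²`, and the area
is at most `discArea * h ^ 2`. -/
theorem IsTri.abs_energy_le (hK : IsTri K)
    (hp : ∀ x ∈ tri K, elementDiam K * ‖gradPoly p x‖ ≤ γ)
    (hq : ∀ x ∈ tri K, elementDiam K * ‖gradPoly q x‖ ≤ b) :
    |energy K p q| ≤ discArea * (γ * b) := by
  have hh := hK.elementDiam_pos
  have h1 : ∀ x ∈ tri K, ‖inner ℝ (gradPoly p x) (gradPoly q x)‖ ≤ γ * b / elementDiam K ^ 2 := by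
    intro x hx
    refine (norm_inner_le_norm _ _).trans ?_
    rw [le_div_iff₀ (by positivity)]
    calc ‖gradPoly p x‖ * ‖gradPoly q x‖ * elementDiam K ^ 2
        = (elementDiam K * ‖gradPoly p x‖) * (elementDiam K * ‖gradPoly q x‖) := by ring
      _ ≤ γ * b := mul_le_mul (hp x hx) (hq x hx) (by positivity)
          ((by positivity : 0 ≤ elementDiam K * ‖gradPoly p x‖).trans (hp x hx))
  have h2 := norm_setIntegral_le_of_norm_le_const (μ := volume) (s := tri K)
    (isCompact_tri K).measure_lt_top h1
  obtain ⟨x, hx⟩ := hK.interior_nonempty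
  have h0 : 0 ≤ γ * b / elementDiam K ^ 2 := (norm_nonneg _).trans (h1 x (interior_subset hx))
  calc |energy K p q| ≤ γ * b / elementDiam K ^ 2 * volume.real (tri K) := h2
    _ ≤ γ * b / elementDiam K ^ 2 * (discArea * elementDiam K ^ 2) := by
        gcongr; exact hK.volume_tri_le
    _ = discArea * (γ * b) := by field_simp

theorem IsTri.abs_integral_face_le (hK : IsTri K) {z : Plane} (hz : z ∈ K) {f : Plane → ℝ} {M : ℝ}
    (h : ∀ x ∈ tri K, elementDiam K * |f x| ≤ M) :
    |∫ x in face K z, f x ∂arcLength| ≤ M := by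
  have hh := hK.elementDiam_pos
  have h1 : ∀ x ∈ face K z, ‖f x‖ ≤ M / elementDiam K := fun x hx => by
    rw [le_div_iff₀ hh, mul_comm]; exact h x (face_subset_tri K z hx)
  have h2 := norm_setIntegral_le_of_norm_le_const
    (hK.arcLength_face_ne_top hz).lt_top h1
  obtain ⟨x, hx⟩ := hK.interior_nonempty
  have hM : 0 ≤ M := (by positivity : 0 ≤ elementDiam K * |f x|).trans (h x (interior_subset hx))
  calc |∫ x in face K z, f x ∂arcLength| ≤ M / elementDiam K * arcLength.real (face K z) := h2
    _ ≤ M / elementDiam K * elementDiam K := by gcongr; exact hK.arcLength_face_le hz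
    _ = M := by field_simp

theorem IsTri.abs_inner_faceNormal_le (hK : IsTri K) {z : Plane} (hz : z ∈ K) (y : Plane) :
    |inner ℝ y (faceNormal K z)| ≤ ‖y‖ := by
  have := abs_real_inner_le_norm y (faceNormal K z)
  rwa [hK.norm_faceNormal hz, mul_one] at this

theorem IsTri.abs_fluxForm_le (hK : IsTri K) {z : Plane} (hz : z ∈ K)
    (hp : ∀ x ∈ tri K, elementDiam K * ‖gradPoly p x‖ ≤ γ)
    (hq : ∀ x ∈ tri K, |polyFun q x| ≤ b) : |fluxForm (K, z) p q| ≤ γ * b := by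
  have hh := hK.elementDiam_pos
  refine hK.abs_integral_face_le hz fun x hx => ?_
  rw [abs_mul, ← mul_assoc]
  refine mul_le_mul ?_ (hq x hx) (abs_nonneg _)
    ((by positivity : 0 ≤ elementDiam K * ‖gradPoly p x‖).trans (hp x hx))
  exact (mul_le_mul_of_nonneg_left (hK.abs_inner_faceNormal_le hz _) hh.le).trans (hp x hx)

/-- Here `p` is the test function and `q` the trial function: replacing `q` by a constant turns the
boundary term into a multiple of the flux of `p`, at the cost of the oscillation `γ`. -/
theorem IsTri.abs_fluxForm_sub_le (hK : IsTri K) {z : Plane} (hz : z ∈ K) {a : ℝ}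
    (hp : ∀ x ∈ tri K, elementDiam K * ‖gradPoly p x‖ ≤ b)
    (hq : ∀ x ∈ tri K, |polyFun q x - a| ≤ γ) :
    |fluxForm (K, z) p q - a * faceFlux (K, z) p| ≤ γ * b := by
  have hh := hK.elementDiam_pos
  have hi : IntegrableOn (fun x => inner ℝ (gradPoly p x) (faceNormal K z)) (face K z) arcLength :=
    hK.integrableOn_face hz ((continuous_gradPoly _).inner continuous_const)
  rw [fluxForm, faceFlux, ← integral_const_mul,
    ← integral_sub (hK.integrableOn_fluxForm hz _ _) (hi.const_mul a)]
  refine hK.abs_integral_face_le hz fun x hx => ?_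
  have : inner ℝ (gradPoly p x) (faceNormal K z) * polyFun q x
      - a * inner ℝ (gradPoly p x) (faceNormal K z)
      = (polyFun q x - a) * inner ℝ (gradPoly p x) (faceNormal K z) := by ring
  rw [this, abs_mul, mul_left_comm]
  refine mul_le_mul (hq x hx) ?_ (by positivity) ((abs_nonneg _).trans (hq x hx))
  exact (mul_le_mul_of_nonneg_left (hK.abs_inner_faceNormal_le hz _) hh.le).trans (hp x hx)

theorem IsTri.faceMass_le (hK : IsTri K) {z : Plane} (hz : z ∈ K)
    (hq : ∀ x ∈ tri K, polyFun q x ^ 2 ≤ b) : faceMass (K, z) q ≤ b := by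
  have hh := hK.elementDiam_pos
  rw [faceMass, inv_mul_le_iff₀ hh]
  refine (le_abs_self _).trans (hK.abs_integral_face_le hz fun x hx => ?_)
  rw [abs_of_nonneg (sq_nonneg _)]
  exact mul_le_mul_of_nonneg_left (hq x hx) hh.le

theorem faceMass_nonneg (c : Finset Plane × Plane) (q : MvPolynomial (Fin 2) ℝ) :
    0 ≤ faceMass c q :=
  mul_nonneg (inv_nonneg.2 Metric.diam_nonneg) (integral_nonneg fun _ => sq_nonneg _)

theorem energy_add_self_le (K : Finset Plane) (p q : MvPolynomial (Fin 2) ℝ) :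
    energy K (p + q) (p + q) ≤ 2 * energy K p p + 2 * energy K q q := by
  simp only [energy, ← integral_const_mul]
  have hi : ∀ r s : MvPolynomial (Fin 2) ℝ,
      IntegrableOn (fun x => inner ℝ (gradPoly r x) (gradPoly s x)) (tri K) := fun r s =>
    integrableOn_tri K ((continuous_gradPoly _).inner (continuous_gradPoly _))
  rw [← integral_add ((hi p p).const_mul 2) ((hi q q).const_mul 2)]
  refine integral_mono (hi _ _) (((hi p p).const_mul 2).add ((hi q q).const_mul 2)) fun x => ?_
  simp only [gradPoly_add]
  have := parallelogram_law_with_norm ℝ (gradPoly p x) (gradPoly q x)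
  simp only [real_inner_self_eq_norm_sq]
  nlinarith [mul_self_nonneg ‖gradPoly p x - gradPoly q x‖]

theorem IsTri.faceMass_add_le (hK : IsTri K) {z : Plane} (hz : z ∈ K)
    (p q : MvPolynomial (Fin 2) ℝ) :
    faceMass (K, z) (p + q) ≤ 2 * faceMass (K, z) p + 2 * faceMass (K, z) q := by
  have hi : ∀ r : MvPolynomial (Fin 2) ℝ,
      IntegrableOn (fun x => polyFun r x ^ 2) (face K z) arcLength := fun r =>
    hK.integrableOn_face hz ((continuous_polyFun _).pow 2)
  have h : ∫ x in face K z, polyFun (p + q) x ^ 2 ∂arcLength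
      ≤ 2 * ∫ x in face K z, polyFun p x ^ 2 ∂arcLength
        + 2 * ∫ x in face K z, polyFun q x ^ 2 ∂arcLength := by
    rw [← integral_const_mul, ← integral_const_mul,
      ← integral_add ((hi p).const_mul 2) ((hi q).const_mul 2)]
    refine integral_mono (hi _) (((hi p).const_mul 2).add ((hi q).const_mul 2)) fun x => ?_
    simp only [polyFun_add]
    nlinarith [sq_nonneg (polyFun p x - polyFun q x)]
  have hh : 0 ≤ (elementDiam K)⁻¹ := inv_nonneg.2 hK.elementDiam_pos.le
  simp only [faceMass]
  nlinarith [mul_le_mul_of_nonneg_left h hh]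

/-- The oscillation on an element is bounded by the scaled gradient. -/
theorem IsTri.abs_sub_le (hK : IsTri K)
    (hp : ∀ x ∈ tri K, elementDiam K * ‖gradPoly p x‖ ≤ γ) {x y : Plane} (hx : x ∈ tri K)
    (hy : y ∈ tri K) : |polyFun p x - polyFun p y| ≤ γ := by
  have hh := hK.elementDiam_pos
  have h1 := (convex_tri K).norm_image_sub_le_of_norm_hasFDerivWithin_le
    (f := polyFun p) (f' := fun x => InnerProductSpace.toDual ℝ Plane (gradPoly p x))
    (C := γ / elementDiam K)
    (fun x _ => (hasGradientAt_iff_hasFDerivAt.1 (hasGradientAt_polyFun p x)).hasFDerivWithinAt)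
    (fun x hx => by
      rw [LinearIsometryEquiv.norm_map, le_div_iff₀ hh, mul_comm]
      exact hp x hx) hy hx
  have h0 : 0 ≤ γ := (by positivity : 0 ≤ elementDiam K * ‖gradPoly p x‖).trans (hp x hx)
  calc |polyFun p x - polyFun p y| ≤ γ / elementDiam K * ‖x - y‖ := h1
    _ ≤ γ / elementDiam K * elementDiam K := by
        gcongr; rw [← dist_eq_norm]; exact dist_le_elementDiam hx hy
    _ = γ := by field_simp

/-- The inverse estimate on elements that contain a ball of radius comparable to the diameter. -/
theorem exists_inverse_estimate (k : ℕ) {κ : ℝ} (hκ : 0 < κ) : ∃ C : ℝ, 0 < C ∧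
    ∀ K : Finset Plane, IsTri K →
      (∃ c, Metric.closedBall c (κ * elementDiam K) ⊆ tri K) →
      ∀ p : MvPolynomial (Fin 2) ℝ, p.totalDegree ≤ k → ∀ x ∈ tri K,
        elementDiam K * ‖gradPoly p x‖ ≤ C * √(energy K p p) := by
  -- The inscribed ball of radius `κ * h`, enlarged by the factor `κ⁻¹`, has radius `h` and covers
  -- the element.
  obtain ⟨C, hC, h⟩ := exists_norm_gradPoly_le k κ⁻¹
  refine ⟨√C / κ, by positivity, fun K hK ⟨c, hc⟩ p hp x hx => ?_⟩
  have hh := hK.elementDiam_pos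
  have hcK : c ∈ tri K := hc (Metric.mem_closedBall_self (by positivity))
  have h1 := h p hp c (κ * elementDiam K) (by positivity) x (by
    rw [inv_mul_cancel_left₀ hκ.ne']
    exact dist_le_elementDiam hx hcK)
  have h2 : ∫ y in Metric.closedBall c (κ * elementDiam K), ‖gradPoly p y‖ ^ 2 ≤ energy K p p := by
    simp only [energy, real_inner_self_eq_norm_sq]
    exact setIntegral_mono_set (integrableOn_tri K ((continuous_gradPoly p).norm.pow 2))
      (Filter.Eventually.of_forall fun _ => sq_nonneg _) (Filter.Eventually.of_forall hc)
  rw [div_mul_eq_mul_div, le_div_iff₀ hκ, ← Real.sqrt_mul hC.le]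
  refine Real.le_sqrt_of_sq_le ?_
  calc (elementDiam K * ‖gradPoly p x‖ * κ) ^ 2
      = (κ * elementDiam K) ^ 2 * ‖gradPoly p x‖ ^ 2 := by ring
    _ ≤ _ := h1.trans (mul_le_mul_of_nonneg_left h2 hC.le)

end Local

/-! ### The Nitsche form and the norms in terms of polynomials -/

section Mesh

variable {Ω : Set Plane} {T : Geometry.SimplicialComplex ℝ Plane} {k : ℕ}

namespace IsFittedTriangulation

/-- The elements as a finite set. -/
noncomputable def elems (hT : IsFittedTriangulation Ω T) : Finset (Finset Plane) :=
  hT.finite_elements.toFinset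

theorem mem_elems (hT : IsFittedTriangulation Ω T) {K : Finset Plane} :
    K ∈ hT.elems ↔ K ∈ elements T := Set.Finite.mem_toFinset _

theorem isTri (hT : IsFittedTriangulation Ω T) {K : Finset Plane} (hK : K ∈ hT.elems) : IsTri K :=
  isTri_of_mem_elements (hT.mem_elems.1 hK)

theorem fst_mem_elems (hT : IsFittedTriangulation Ω T) {c : Finset Plane × Plane}
    (hc : c ∈ hT.bdryPairs) : c.1 ∈ hT.elems := hT.mem_elems.2 (hT.mem_bdryPairs.1 hc).1

theorem snd_mem (hT : IsFittedTriangulation Ω T) {c : Finset Plane × Plane}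
    (hc : c ∈ hT.bdryPairs) : c.2 ∈ c.1 := (hT.mem_bdryPairs.1 hc).2.1

theorem card_filter_bdryPairs_le (hT : IsFittedTriangulation Ω T) {K : Finset Plane}
    (hK : K ∈ hT.elems) : (hT.bdryPairs.filter fun c => c.1 = K).card ≤ 3 := by
  rw [← (hT.isTri hK).card]
  refine Finset.card_le_card_of_injOn Prod.snd (fun c hc => ?_) fun c hc d hd h => ?_
  · obtain ⟨hcB, rfl⟩ := Finset.mem_filter.1 hc
    exact hT.snd_mem hcB
  · have h1 := (Finset.mem_filter.1 hc).2
    have h2 := (Finset.mem_filter.1 hd).2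
    exact Prod.ext (h1.trans h2.symm) h

/-- An element has at most three boundary faces. -/
theorem sum_bdryPairs_le (hT : IsFittedTriangulation Ω T) {f : Finset Plane → ℝ}
    (hf : ∀ K ∈ hT.elems, 0 ≤ f K) : ∑ c ∈ hT.bdryPairs, f c.1 ≤ 3 * ∑ K ∈ hT.elems, f K := by
  rw [← Finset.sum_fiberwise_of_maps_to (fun c hc => hT.fst_mem_elems hc), Finset.mul_sum]
  refine Finset.sum_le_sum fun K hK => ?_
  have : ∑ c ∈ hT.bdryPairs with c.1 = K, f c.1 = ∑ c ∈ hT.bdryPairs with c.1 = K, f K :=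
    Finset.sum_congr rfl fun c hc => by rw [(Finset.mem_filter.1 hc).2]
  rw [this, Finset.sum_const, nsmul_eq_mul]
  exact mul_le_mul_of_nonneg_right (by exact_mod_cast hT.card_filter_bdryPairs_le hK) (hf K hK)

/-- The Nitsche form in terms of the representing polynomials, linear in the test function. -/
noncomputable def form (hT : IsFittedTriangulation Ω T) (P : PolyFamily) : PolyFamily →ₗ[ℝ] ℝ where
  toFun Q := ∑ K ∈ hT.elems, energy K (P K) (Q K)
    - ∑ c ∈ hT.bdryPairs, fluxForm c (P c.1) (Q c.1)
    + ∑ c ∈ hT.bdryPairs, fluxForm c (Q c.1) (P c.1)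
  map_add' Q R := by
    have h1 : ∀ c ∈ hT.bdryPairs, fluxForm c (P c.1) ((Q + R) c.1)
        = fluxForm c (P c.1) (Q c.1) + fluxForm c (P c.1) (R c.1) := fun c hc =>
      (hT.isTri (hT.fst_mem_elems hc)).fluxForm_add_right (hT.snd_mem hc) _ _ _
    have h2 : ∀ c ∈ hT.bdryPairs, fluxForm c ((Q + R) c.1) (P c.1)
        = fluxForm c (Q c.1) (P c.1) + fluxForm c (R c.1) (P c.1) := fun c hc =>
      (hT.isTri (hT.fst_mem_elems hc)).fluxForm_add_left (hT.snd_mem hc) _ _ _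
    rw [Finset.sum_congr rfl h1, Finset.sum_congr rfl h2]
    simp only [Pi.add_apply, energy_add_right, Finset.sum_add_distrib]
    ring
  map_smul' a Q := by
    simp only [Pi.smul_apply, energy_smul_right, fluxForm_smul_left, fluxForm_smul_right,
      ← Finset.mul_sum, RingHom.id_apply, smul_eq_mul]
    ring

theorem form_apply (hT : IsFittedTriangulation Ω T) (P Q : PolyFamily) :
    hT.form P Q = ∑ K ∈ hT.elems, energy K (P K) (Q K)
      - ∑ c ∈ hT.bdryPairs, fluxForm c (P c.1) (Q c.1)
      + ∑ c ∈ hT.bdryPairs, fluxForm c (Q c.1) (P c.1) := rfl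

/-- The Dirichlet energy. -/
noncomputable def dirichlet (hT : IsFittedTriangulation Ω T) (P : PolyFamily) : ℝ :=
  ∑ K ∈ hT.elems, energy K (P K) (P K)

/-- The square of the weighted boundary norm in terms of the representing polynomials. -/
noncomputable def mass (hT : IsFittedTriangulation Ω T) (P : PolyFamily) : ℝ :=
  ∑ c ∈ hT.bdryPairs, faceMass c (P c.1)

theorem dirichlet_nonneg (hT : IsFittedTriangulation Ω T) (P : PolyFamily) :
    0 ≤ hT.dirichlet P := Finset.sum_nonneg fun K _ => energy_self_nonneg K _

theorem mass_nonneg (hT : IsFittedTriangulation Ω T) (P : PolyFamily) :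
    0 ≤ hT.mass P := Finset.sum_nonneg fun _ _ => faceMass_nonneg _ _

/-- The boundary terms are skew-symmetric. The diagonal therefore controls the energy but not the
boundary norm. -/
theorem form_self (hT : IsFittedTriangulation Ω T) (P : PolyFamily) :
    hT.form P P = hT.dirichlet P := by
  rw [form_apply, dirichlet]; ring

theorem dirichlet_add_le (hT : IsFittedTriangulation Ω T) (P Q : PolyFamily) :
    hT.dirichlet (P + Q) ≤ 2 * hT.dirichlet P + 2 * hT.dirichlet Q := by
  simp only [dirichlet, Finset.mul_sum, ← Finset.sum_add_distrib]
  exact Finset.sum_le_sum fun K _ => energy_add_self_le K _ _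

theorem mass_add_le (hT : IsFittedTriangulation Ω T) (P Q : PolyFamily) :
    hT.mass (P + Q) ≤ 2 * hT.mass P + 2 * hT.mass Q := by
  simp only [mass, Finset.mul_sum, ← Finset.sum_add_distrib]
  exact Finset.sum_le_sum fun c hc =>
    (hT.isTri (hT.fst_mem_elems hc)).faceMass_add_le (hT.snd_mem hc) _ _

theorem nitscheForm_eq (hT : IsFittedTriangulation Ω T) (hreg : interior (closure Ω) = Ω)
    (hperf : Preperfect (frontier Ω)) {P Q : PolyFamily} {v w : Plane → ℝ}
    (hv : Represents T k P v) (hw : Represents T k Q w) :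
    nitscheForm Ω v w = hT.form P Q := by
  rw [nitscheForm, integral_inner_grad hT hreg hv hw, bdryInner_comm v,
    bdryInner_normalDeriv hT hreg hperf hv hw, bdryInner_normalDeriv hT hreg hperf hw hv]
  rfl

theorem norm1h_eq (hT : IsFittedTriangulation Ω T) (hreg : interior (closure Ω) = Ω)
    (hperf : Preperfect (frontier Ω)) {P : PolyFamily} {v : Plane → ℝ}
    (hv : Represents T k P v) : norm1h Ω T v = √(hT.dirichlet P + hT.mass P) := by
  have h := integral_inner_grad hT hreg hv hv
  simp only [real_inner_self_eq_norm_sq] at h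
  rw [norm1h, h, bdryNormSq_eq hT hreg hperf hv, dirichlet, mass]
  simp only [energy, faceMass, real_inner_self_eq_norm_sq]
  rfl

end IsFittedTriangulation

end Mesh

theorem polyFun_sum (t : Finset (Finset Plane)) (f : Finset Plane → MvPolynomial (Fin 2) ℝ)
    (x : Plane) : polyFun (∑ s ∈ t, f s) x = ∑ s ∈ t, polyFun (f s) x := by
  simp [polyFun]

theorem gradPoly_sum (t : Finset (Finset Plane)) (f : Finset Plane → MvPolynomial (Fin 2) ℝ)
    (x : Plane) : gradPoly (∑ s ∈ t, f s) x = ∑ s ∈ t, gradPoly (f s) x := by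
  ext i
  simp [gradPoly_apply, polyFun]

/-! ### Inf-sup stability from a family of local test functions -/

section Mesh

variable {Ω : Set Plane} {T : Geometry.SimplicialComplex ℝ Plane}

/-- A family of local functions, given by the polynomials `Q s`, each of which is supported on the
elements that contain the simplex `s` and has outward boundary flux at most `-c₀`. -/
structure IsTestFamily (hT : IsFittedTriangulation Ω T) (G : Finset (Finset Plane))
    (Q : Finset Plane → PolyFamily) (b c₀ M : ℝ) : Prop where
  zero : ∀ s ∈ G, ∀ K ∈ hT.elems, ¬ s ⊆ K → Q s K = 0
  bound : ∀ s ∈ G, ∀ K ∈ hT.elems, ∀ x ∈ tri K, |polyFun (Q s K) x| ≤ b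
  grad_bound : ∀ s ∈ G, ∀ K ∈ hT.elems, ∀ x ∈ tri K, elementDiam K * ‖gradPoly (Q s K) x‖ ≤ b
  flux : ∀ s ∈ G, ∑ c ∈ hT.bdryPairs, faceFlux c (Q s c.1) ≤ -c₀
  card_elems : ∀ s ∈ G, ((hT.elems.filter fun K => s ⊆ K).card : ℝ) ≤ M
  card_family : ∀ K ∈ hT.elems, ((G.filter fun s => s ⊆ K).card : ℝ) ≤ M

namespace IsTestFamily

variable {hT : IsFittedTriangulation Ω T} {G : Finset (Finset Plane)}
  {Q : Finset Plane → PolyFamily} {b c₀ M : ℝ}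

theorem sum_elems_le (h : IsTestFamily hT G Q b c₀ M) {f : Finset Plane → ℝ}
    (hf : ∀ s ∈ G, 0 ≤ f s) :
    ∑ K ∈ hT.elems, ∑ s ∈ G with s ⊆ K, f s ≤ M * ∑ s ∈ G, f s := by
  rw [Finset.sum_comm' (t' := G) (s' := fun s => hT.elems.filter fun K => s ⊆ K)
    (by intro K s; simp only [Finset.mem_filter]; tauto), Finset.mul_sum]
  refine Finset.sum_le_sum fun s hs => ?_
  rw [Finset.sum_const, nsmul_eq_mul]
  exact mul_le_mul_of_nonneg_right (h.card_elems s hs) (hf s hs)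

theorem sum_family_le (h : IsTestFamily hT G Q b c₀ M) {f : Finset Plane → ℝ}
    (hf : ∀ K ∈ hT.elems, 0 ≤ f K) :
    ∑ s ∈ G, ∑ K ∈ hT.elems with s ⊆ K, f K ≤ M * ∑ K ∈ hT.elems, f K := by
  rw [Finset.sum_comm' (t' := hT.elems) (s' := fun K => G.filter fun s => s ⊆ K)
    (by intro K s; simp only [Finset.mem_filter]; tauto), Finset.mul_sum]
  refine Finset.sum_le_sum fun K hK => ?_
  rw [Finset.sum_const, nsmul_eq_mul]
  exact mul_le_mul_of_nonneg_right (h.card_family K hK) (hf K hK)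

/-- Only the term with the normal derivative of `Q s` sees the values of `P`, and there `P` may be
replaced by the constant `a`. All errors are bounded by `γ` on the support: `discArea` comes from
the energy, and `3 + 3` from the two boundary terms with at most three faces per element. -/
theorem abs_form_sub_le (h : IsTestFamily hT G Q b c₀ M) {P : PolyFamily} {γ : Finset Plane → ℝ}
    (hγ : ∀ K ∈ hT.elems, ∀ x ∈ tri K, elementDiam K * ‖gradPoly (P K) x‖ ≤ γ K)
    {s : Finset Plane} (hs : s ∈ G) {a : ℝ}
    (ha : ∀ K ∈ hT.elems, s ⊆ K → ∀ x ∈ tri K, |polyFun (P K) x - a| ≤ γ K) :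
    |hT.form P (Q s) - a * ∑ c ∈ hT.bdryPairs, faceFlux c (Q s c.1)|
      ≤ (discArea + 6) * b * ∑ K ∈ hT.elems with s ⊆ K, γ K := by
  classical
  set f : Finset Plane → ℝ := fun K => if s ⊆ K then γ K * b else 0 with hf
  have hbase : ∀ K ∈ hT.elems, 0 ≤ γ K ∧ 0 ≤ b := fun K hK => by
    obtain ⟨x, hx⟩ := (hT.isTri hK).interior_nonempty
    have hx := interior_subset hx
    have h0 := (hT.isTri hK).elementDiam_pos
    exact ⟨(by positivity : 0 ≤ elementDiam K * ‖gradPoly (P K) x‖).trans (hγ K hK x hx),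
      (abs_nonneg _).trans (h.bound s hs K hK x hx)⟩
  have hf0 : ∀ K ∈ hT.elems, 0 ≤ f K := fun K hK => by
    have := hbase K hK
    simp only [hf]
    split_ifs
    · exact mul_nonneg this.1 this.2
    · exact le_rfl
  have h1 : |∑ K ∈ hT.elems, energy K (P K) (Q s K)| ≤ discArea * ∑ K ∈ hT.elems, f K := by
    rw [Finset.mul_sum]
    refine (Finset.abs_sum_le_sum_abs _ _).trans (Finset.sum_le_sum fun K hK => ?_)
    by_cases hsK : s ⊆ K
    · simp only [hf, if_pos hsK]
      exact (hT.isTri hK).abs_energy_le (hγ K hK) (h.grad_bound s hs K hK)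
    · have : energy K (P K) (0 : MvPolynomial (Fin 2) ℝ) = 0 := by
        simpa using energy_smul_right K (P K) 0 0
      simp [hf, if_neg hsK, h.zero s hs K hK hsK, this]
  have h2 : |∑ c ∈ hT.bdryPairs, fluxForm c (P c.1) (Q s c.1)| ≤ 3 * ∑ K ∈ hT.elems, f K := by
    refine le_trans ?_ (hT.sum_bdryPairs_le hf0)
    refine (Finset.abs_sum_le_sum_abs _ _).trans (Finset.sum_le_sum fun c hc => ?_)
    have hK := hT.fst_mem_elems hc
    by_cases hsK : s ⊆ c.1
    · simp only [hf, if_pos hsK]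
      exact (hT.isTri hK).abs_fluxForm_le (hT.snd_mem hc) (hγ _ hK) (h.bound s hs _ hK)
    · have : fluxForm c (P c.1) (0 : MvPolynomial (Fin 2) ℝ) = 0 := by
        simpa using fluxForm_smul_right c (P c.1) 0 0
      simp [hf, if_neg hsK, h.zero s hs _ hK hsK, this]
  have h3 : |∑ c ∈ hT.bdryPairs, fluxForm c (Q s c.1) (P c.1)
      - a * ∑ c ∈ hT.bdryPairs, faceFlux c (Q s c.1)| ≤ 3 * ∑ K ∈ hT.elems, f K := by
    refine le_trans ?_ (hT.sum_bdryPairs_le hf0)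
    rw [Finset.mul_sum, ← Finset.sum_sub_distrib]
    refine (Finset.abs_sum_le_sum_abs _ _).trans (Finset.sum_le_sum fun c hc => ?_)
    have hK := hT.fst_mem_elems hc
    by_cases hsK : s ⊆ c.1
    · simp only [hf, if_pos hsK]
      exact (hT.isTri hK).abs_fluxForm_sub_le (hT.snd_mem hc) (h.grad_bound s hs _ hK)
        (ha _ hK hsK)
    · have h4 : fluxForm c (0 : MvPolynomial (Fin 2) ℝ) (P c.1) = 0 := by
        simpa using fluxForm_smul_left c 0 (P c.1) 0
      have h5 : faceFlux c (0 : MvPolynomial (Fin 2) ℝ) = 0 := by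
        have : ∀ x, gradPoly (0 : MvPolynomial (Fin 2) ℝ) x = 0 := fun x => by
          simpa using gradPoly_smul 0 0 x
        simp [faceFlux, this]
      simp [hf, if_neg hsK, h.zero s hs _ hK hsK, h4, h5]
  have hfs : ∑ K ∈ hT.elems, f K = b * ∑ K ∈ hT.elems with s ⊆ K, γ K := by
    rw [Finset.mul_sum, Finset.sum_filter]
    exact Finset.sum_congr rfl fun K _ => by simp only [hf]; split_ifs <;> ring
  rw [hT.form_apply]
  calc _ ≤ discArea * ∑ K ∈ hT.elems, f K + 3 * ∑ K ∈ hT.elems, f K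
        + 3 * ∑ K ∈ hT.elems, f K := by
        rw [abs_le] at h1 h2 h3 ⊢
        constructor <;> linarith
    _ = _ := by rw [hfs]; ring

theorem sum_smul_apply (a : Finset Plane → ℝ) (K : Finset Plane) :
    (∑ s ∈ G, a s • Q s) K = ∑ s ∈ G, a s • Q s K := by simp

/-- The combination of the test functions is controlled by its coefficients. -/
theorem norm_sum_le (h : IsTestFamily hT G Q b c₀ M) (hM : 0 ≤ M) (hb : 0 ≤ b)
    (a : Finset Plane → ℝ) :
    hT.dirichlet (∑ s ∈ G, a s • Q s) + hT.mass (∑ s ∈ G, a s • Q s)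
      ≤ (discArea + 3) * (M * b) ^ 2 * ∑ s ∈ G, a s ^ 2 := by
  classical
  set W := ∑ s ∈ G, a s • Q s with hW
  -- A common bound on `K` for the values and the scaled gradients of the combination.
  set β : Finset Plane → ℝ := fun K => (∑ s ∈ G with s ⊆ K, |a s|) * b with hβ
  have hβ0 : ∀ K, 0 ≤ β K := fun K => mul_nonneg (Finset.sum_nonneg fun _ _ => abs_nonneg _) hb
  have hWK : ∀ K ∈ hT.elems, W K = ∑ s ∈ G with s ⊆ K, a s • Q s K := fun K hK => by
    rw [hW, sum_smul_apply, Finset.sum_filter]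
    refine Finset.sum_congr rfl fun s hs => ?_
    split_ifs with hsK
    · rfl
    · rw [h.zero s hs K hK hsK, smul_zero]
  have hval : ∀ K ∈ hT.elems, ∀ x ∈ tri K, |polyFun (W K) x| ≤ β K := fun K hK x hx => by
    rw [hWK K hK, polyFun_sum]
    simp only [hβ]
    rw [Finset.sum_mul]
    refine (Finset.abs_sum_le_sum_abs _ _).trans (Finset.sum_le_sum fun s hs => ?_)
    rw [polyFun_smul, abs_mul]
    exact mul_le_mul_of_nonneg_left (h.bound s (Finset.mem_filter.1 hs).1 K hK x hx) (abs_nonneg _)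
  have hgrad : ∀ K ∈ hT.elems, ∀ x ∈ tri K, elementDiam K * ‖gradPoly (W K) x‖ ≤ β K :=
      fun K hK x hx => by
    have hd := (hT.isTri hK).elementDiam_pos
    rw [hWK K hK, gradPoly_sum]
    simp only [hβ]
    rw [Finset.sum_mul]
    refine (mul_le_mul_of_nonneg_left (_root_.norm_sum_le _ _) hd.le).trans ?_
    rw [Finset.mul_sum]
    refine Finset.sum_le_sum fun s hs => ?_
    rw [gradPoly_smul, norm_smul, mul_left_comm]
    exact mul_le_mul_of_nonneg_left (h.grad_bound s (Finset.mem_filter.1 hs).1 K hK x hx)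
      (norm_nonneg _)
  have hβsq : ∑ K ∈ hT.elems, β K ^ 2 ≤ (M * b) ^ 2 * ∑ s ∈ G, a s ^ 2 := by
    have h1 : ∀ K ∈ hT.elems, β K ^ 2 ≤ M * b ^ 2 * ∑ s ∈ G with s ⊆ K, a s ^ 2 := fun K hK => by
      -- Cauchy-Schwarz, with at most `M` test functions on an element; the second factor `M` comes
      -- from exchanging the sums.
      have h2 := sq_sum_le_card_mul_sum_sq (s := G.filter fun s => s ⊆ K) (f := fun s => |a s|)
      simp only [sq_abs] at h2
      have h3 : 0 ≤ ∑ s ∈ G with s ⊆ K, a s ^ 2 := Finset.sum_nonneg fun _ _ => sq_nonneg _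
      rw [hβ, mul_pow]
      calc _ ≤ (((G.filter fun s => s ⊆ K).card : ℝ) * ∑ s ∈ G with s ⊆ K, a s ^ 2) * b ^ 2 := by
            gcongr
        _ ≤ (M * ∑ s ∈ G with s ⊆ K, a s ^ 2) * b ^ 2 := by
            gcongr; exact h.card_family K hK
        _ = _ := by ring
    calc _ ≤ ∑ K ∈ hT.elems, M * b ^ 2 * ∑ s ∈ G with s ⊆ K, a s ^ 2 := Finset.sum_le_sum h1
      _ = M * b ^ 2 * ∑ K ∈ hT.elems, ∑ s ∈ G with s ⊆ K, a s ^ 2 := by rw [Finset.mul_sum]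
      _ ≤ M * b ^ 2 * (M * ∑ s ∈ G, a s ^ 2) := by
          gcongr; exact h.sum_elems_le fun _ _ => sq_nonneg _
      _ = _ := by ring
  have hD : hT.dirichlet W ≤ discArea * ∑ K ∈ hT.elems, β K ^ 2 := by
    rw [IsFittedTriangulation.dirichlet, Finset.mul_sum]
    refine Finset.sum_le_sum fun K hK => (le_abs_self _).trans ?_
    rw [sq]
    exact (hT.isTri hK).abs_energy_le (hgrad K hK) (hgrad K hK)
  have hm : hT.mass W ≤ 3 * ∑ K ∈ hT.elems, β K ^ 2 := by
    refine le_trans ?_ (hT.sum_bdryPairs_le fun K _ => sq_nonneg (β K))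
    refine Finset.sum_le_sum fun c hc => ?_
    have hK := hT.fst_mem_elems hc
    refine (hT.isTri hK).faceMass_le (hT.snd_mem hc) fun x hx => ?_
    rw [← sq_abs]
    exact pow_le_pow_left₀ (abs_nonneg _) (hval _ hK x hx) 2
  have := discArea_pos
  nlinarith [mul_le_mul_of_nonneg_left hβsq (by positivity : 0 ≤ discArea + 3)]

/-- The combination of the test functions controls the coefficients up to the Dirichlet energy. -/
theorem le_neg_form (h : IsTestFamily hT G Q b c₀ M) (hM : 0 < M) (hb : 0 < b) (hc₀ : 0 < c₀)
    {P : PolyFamily} {C : ℝ}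
    (hγ : ∀ K ∈ hT.elems, ∀ x ∈ tri K,
      elementDiam K * ‖gradPoly (P K) x‖ ≤ C * √(energy K (P K) (P K)))
    {a : Finset Plane → ℝ}
    (ha : ∀ s ∈ G, ∀ K ∈ hT.elems, s ⊆ K → ∀ x ∈ tri K,
      |polyFun (P K) x - a s| ≤ C * √(energy K (P K) (P K))) :
    c₀ / 2 * ∑ s ∈ G, a s ^ 2
      - ((discArea + 6) * b * M * C) ^ 2 / (2 * c₀) * hT.dirichlet P
      ≤ - hT.form P (∑ s ∈ G, a s • Q s) := by
  set L := (discArea + 6) * b with hL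
  have hdA := discArea_pos
  have hLpos : 0 < L := by positivity
  set γ : Finset Plane → ℝ := fun K => C * √(energy K (P K) (P K)) with hγdef
  -- The flux yields `c₀ * a s ^ 2`. One half is kept, the other is reserved for the error terms.
  have hterm : ∀ s ∈ G, c₀ / 2 * a s ^ 2 + (c₀ / 2 * a s ^ 2 - L * ∑ K ∈ hT.elems with s ⊆ K,
      |a s| * γ K) ≤ - (a s * hT.form P (Q s)) := by
    intro s hs
    have h1 := h.abs_form_sub_le hγ hs (ha s hs)
    have h2 := h.flux s hs
    have h3 : a s * (hT.form P (Q s) - a s * ∑ c ∈ hT.bdryPairs, faceFlux c (Q s c.1))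
        ≤ |a s| * (L * ∑ K ∈ hT.elems with s ⊆ K, γ K) := by
      refine (le_abs_self _).trans ?_
      rw [abs_mul]
      exact mul_le_mul_of_nonneg_left h1 (abs_nonneg _)
    have h4 : a s ^ 2 * ∑ c ∈ hT.bdryPairs, faceFlux c (Q s c.1) ≤ a s ^ 2 * (-c₀) :=
      mul_le_mul_of_nonneg_left h2 (sq_nonneg _)
    rw [← Finset.mul_sum]
    nlinarith
  -- The weights are such that, with at most `M` elements for each `s` and after multiplication by
  -- `L`, the squares of `a s` add up to the reserved half.
  have hyoung : ∀ s ∈ G, ∀ K, |a s| * γ K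
      ≤ c₀ / (2 * (L * M)) * a s ^ 2 + L * M / (2 * c₀) * γ K ^ 2 := by
    intro s _ K
    have h0 : c₀ / (2 * (L * M)) * a s ^ 2 + L * M / (2 * c₀) * γ K ^ 2 - |a s| * γ K
        = (c₀ * |a s| - L * M * γ K) ^ 2 / (2 * (L * M) * c₀) := by
      rw [← sq_abs (a s)]
      field_simp
      ring
    have h1 : 0 ≤ (c₀ * |a s| - L * M * γ K) ^ 2 / (2 * (L * M) * c₀) := by positivity
    linarith
  have hsum : ∑ s ∈ G, ∑ K ∈ hT.elems with s ⊆ K, |a s| * γ K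
      ≤ c₀ / (2 * L) * ∑ s ∈ G, a s ^ 2 + L * M ^ 2 / (2 * c₀) * ∑ K ∈ hT.elems, γ K ^ 2 := by
    calc _ ≤ ∑ s ∈ G, ∑ K ∈ hT.elems with s ⊆ K,
          (c₀ / (2 * (L * M)) * a s ^ 2 + L * M / (2 * c₀) * γ K ^ 2) :=
          Finset.sum_le_sum fun s hs => Finset.sum_le_sum fun K _ => hyoung s hs K
      _ = ∑ s ∈ G, ((hT.elems.filter fun K => s ⊆ K).card : ℝ) * (c₀ / (2 * (L * M)) * a s ^ 2)
          + ∑ s ∈ G, ∑ K ∈ hT.elems with s ⊆ K, L * M / (2 * c₀) * γ K ^ 2 := by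
          simp only [Finset.sum_add_distrib, Finset.sum_const, nsmul_eq_mul]
      _ ≤ ∑ s ∈ G, M * (c₀ / (2 * (L * M)) * a s ^ 2)
          + M * ∑ K ∈ hT.elems, L * M / (2 * c₀) * γ K ^ 2 := by
          refine add_le_add (Finset.sum_le_sum fun s hs => ?_)
            (h.sum_family_le fun K _ => by positivity)
          exact mul_le_mul_of_nonneg_right (h.card_elems s hs) (by positivity)
      _ = _ := by
          simp only [Finset.mul_sum]
          congr 1
          · exact Finset.sum_congr rfl fun s _ => by field_simp
          · exact Finset.sum_congr rfl fun s _ => by field_simp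
  have hγsq : ∑ K ∈ hT.elems, γ K ^ 2 = C ^ 2 * hT.dirichlet P := by
    rw [IsFittedTriangulation.dirichlet, Finset.mul_sum]
    refine Finset.sum_congr rfl fun K _ => ?_
    rw [hγdef, mul_pow, Real.sq_sqrt (energy_self_nonneg _ _)]
  have hfin := Finset.sum_le_sum hterm
  rw [Finset.sum_neg_distrib, Finset.sum_add_distrib, Finset.sum_sub_distrib, ← Finset.mul_sum,
    ← Finset.mul_sum] at hfin
  have hform : hT.form P (∑ s ∈ G, a s • Q s) = ∑ s ∈ G, a s * hT.form P (Q s) := by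
    rw [map_sum]; simp
  rw [hform]
  rw [hγsq] at hsum
  have h5 := mul_le_mul_of_nonneg_left hsum hLpos.le
  have h6 : L * (c₀ / (2 * L) * ∑ s ∈ G, a s ^ 2 + L * M ^ 2 / (2 * c₀) * (C ^ 2 * hT.dirichlet P))
      = c₀ / 2 * ∑ s ∈ G, a s ^ 2 + (L * M * C) ^ 2 / (2 * c₀) * hT.dirichlet P := by
    field_simp
  rw [h6] at h5
  linarith

end IsTestFamily

/-- Inf-sup stability from a suitable family of test functions. -/
theorem exists_infsup_constant {b c₀ M C Cb : ℝ} (hb : 0 < b) (hc₀ : 0 < c₀) (hM : 0 < M)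
    (hCb : 0 < Cb) : ∃ cs α : ℝ, 0 < cs ∧
      ∀ (Ω : Set Plane) (T : Geometry.SimplicialComplex ℝ Plane) (hT : IsFittedTriangulation Ω T)
        (G : Finset (Finset Plane)) (Q : Finset Plane → PolyFamily),
        IsTestFamily hT G Q b c₀ M → ∀ (P : PolyFamily) (a : Finset Plane → ℝ),
        (∀ K ∈ hT.elems, ∀ x ∈ tri K,
          elementDiam K * ‖gradPoly (P K) x‖ ≤ C * √(energy K (P K) (P K))) →
        (∀ s ∈ G, ∀ K ∈ hT.elems, s ⊆ K → ∀ x ∈ tri K,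
          |polyFun (P K) x - a s| ≤ C * √(energy K (P K) (P K))) →
        hT.mass P ≤ Cb * (∑ s ∈ G, a s ^ 2 + hT.dirichlet P) →
        cs * (hT.dirichlet P + hT.mass P) ≤ hT.form P (P + α • ∑ s ∈ G, a s • Q s) ∧
        cs * √(hT.dirichlet P + hT.mass P) *
          √(hT.dirichlet (P + α • ∑ s ∈ G, a s • Q s) + hT.mass (P + α • ∑ s ∈ G, a s • Q s))
          ≤ hT.form P (P + α • ∑ s ∈ G, a s • Q s) := by
  -- The factor of the energy in `le_neg_form`. The choice of `α` gives `α * C₁ ≤ 1 / 2`, so that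
  -- half of the energy survives.
  set C₁ := ((discArea + 6) * b * M * C) ^ 2 / (2 * c₀) with hC₁
  have hC₁0 : 0 ≤ C₁ := by positivity
  set α := 1 / (2 * (C₁ + 1)) with hα
  have hα0 : 0 < α := by positivity
  set c₁ := min (1 / 2) (α * c₀ / 2) with hc₁
  have hc₁0 : 0 < c₁ := lt_min (by norm_num) (by positivity)
  have hdA := discArea_pos
  -- With this factor `D + S` bounds the squared norms of both the trial and the test function.
  set C₂ := 2 * (1 + Cb) + 2 * (α ^ 2 * ((discArea + 3) * (M * b) ^ 2)) with hC₂
  have hC₂0 : 0 < C₂ := by positivity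
  refine ⟨c₁ / C₂, -α, by positivity, ?_⟩
  intro Ω T hT G Q h P a hγ ha hmass
  set S := ∑ s ∈ G, a s ^ 2 with hS
  set D := hT.dirichlet P with hD
  set W := ∑ s ∈ G, a s • Q s with hW
  have hS0 : 0 ≤ S := Finset.sum_nonneg fun _ _ => sq_nonneg _
  have hD0 : 0 ≤ D := hT.dirichlet_nonneg P
  have hlow := h.le_neg_form hM hb hc₀ hγ ha
  have hform : hT.form P (P + (-α) • W) = D + α * (- hT.form P W) := by
    rw [map_add, map_smul, hT.form_self, smul_eq_mul]; ring
  have hαC : α * C₁ ≤ 1 / 2 := by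
    rw [hα, div_mul_eq_mul_div, div_le_div_iff₀ (by positivity) (by norm_num)]
    linarith
  have h1 : c₁ * (D + S) ≤ hT.form P (P + (-α) • W) := by
    rw [hform]
    have h2 := mul_le_mul_of_nonneg_left hlow hα0.le
    have h3 : c₁ * D ≤ 1 / 2 * D := mul_le_mul_of_nonneg_right (min_le_left _ _) hD0
    have h4 : c₁ * S ≤ α * c₀ / 2 * S := mul_le_mul_of_nonneg_right (min_le_right _ _) hS0
    have h5 := mul_le_mul_of_nonneg_right hαC hD0
    nlinarith
  have hN1 : hT.dirichlet P + hT.mass P ≤ C₂ * (D + S) := by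
    have : 0 ≤ α ^ 2 * ((discArea + 3) * (M * b) ^ 2) * (D + S) := by positivity
    nlinarith
  have hN2 : hT.dirichlet (P + (-α) • W) + hT.mass (P + (-α) • W) ≤ C₂ * (D + S) := by
    have h2 := hT.dirichlet_add_le P ((-α) • W)
    have h3 := hT.mass_add_le P ((-α) • W)
    have h4 : (-α) • W = ∑ s ∈ G, (-α * a s) • Q s := by
      rw [hW, Finset.smul_sum]
      exact Finset.sum_congr rfl fun s _ => by rw [smul_smul]
    have h5 := h.norm_sum_le hM.le hb.le fun s => -α * a s
    rw [← h4] at h5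
    have h6 : ∑ s ∈ G, (-α * a s) ^ 2 = α ^ 2 * S := by
      rw [hS, Finset.mul_sum]
      exact Finset.sum_congr rfl fun s _ => by ring
    rw [h6] at h5
    have h7 : 0 ≤ α ^ 2 * ((discArea + 3) * (M * b) ^ 2) * D := by positivity
    nlinarith
  have hs1 := Real.sqrt_le_sqrt hN1
  have hs2 := Real.sqrt_le_sqrt hN2
  have hX : 0 ≤ C₂ * (D + S) := by positivity
  refine ⟨?_, ?_⟩
  · calc c₁ / C₂ * (D + hT.mass P) ≤ c₁ / C₂ * (C₂ * (D + S)) := by gcongr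
      _ = c₁ * (D + S) := by field_simp
      _ ≤ _ := h1
  calc _ = c₁ / C₂ * (√(D + hT.mass P) *
        √(hT.dirichlet (P + (-α) • W) + hT.mass (P + (-α) • W))) := by ring
    _ ≤ c₁ / C₂ * (√(C₂ * (D + S)) * √(C₂ * (D + S))) := by gcongr
    _ = c₁ * (D + S) := by rw [Real.mul_self_sqrt hX]; field_simp
    _ ≤ _ := h1

end Mesh

/-! ### Consequences of shape regularity and quasi-uniformity -/

section Shape

variable {Ω : Set Plane} {T : Geometry.SimplicialComplex ℝ Plane}

/-- Every element contains a ball of radius at least `κ` times its diameter. -/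
def HasInscribedBalls (κ : ℝ) (T : Geometry.SimplicialComplex ℝ Plane) : Prop :=
  ∀ K ∈ elements T, ∃ c, Metric.closedBall c (κ * elementDiam K) ⊆ tri K

/-- The inradius is a supremum; the factor `2` puts the radius strictly below it, so that an actual
ball exists. The maximum with `1` keeps the constant positive. -/
theorem IsShapeRegular.hasInscribedBalls {cρ : ℝ} (h : IsShapeRegular cρ T) :
    HasInscribedBalls (1 / (2 * max cρ 1)) T := by
  intro K hK
  have hh := (isTri_of_mem_elements hK).elementDiam_pos
  have hc : 0 < max cρ 1 := lt_max_of_lt_right one_pos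
  obtain ⟨x, hx⟩ := (isTri_of_mem_elements hK).interior_nonempty
  have h0 : (0 : ℝ) ∈ {r : ℝ | ∃ x : Plane, Metric.closedBall x r ⊆ tri K} :=
    ⟨x, by rw [Metric.closedBall_zero]; simpa using interior_subset hx⟩
  have hρ : 0 ≤ elementInradius K := Real.sSup_nonneg' ⟨0, h0, le_rfl⟩
  have h1 : elementDiam K ≤ max cρ 1 * elementInradius K :=
    (h K hK).trans (mul_le_mul_of_nonneg_right (le_max_left _ _) hρ)
  have h2 : 1 / (2 * max cρ 1) * elementDiam K < elementInradius K := by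
    rw [one_div, inv_mul_lt_iff₀ (by positivity)]
    nlinarith
  obtain ⟨r, ⟨c, hc⟩, hr⟩ := exists_lt_of_lt_csSup ⟨0, h0⟩ h2
  exact ⟨c, (Metric.closedBall_subset_closedBall hr.le).trans hc⟩

/-- The number of elements in a ball is bounded by the ratio of areas. -/
theorem IsFittedTriangulation.card_mul_le (hT : IsFittedTriangulation Ω T) {κ : ℝ} (hκ : 0 < κ)
    (hb : HasInscribedBalls κ T) {𝒦 : Finset (Finset Plane)} (h𝒦 : 𝒦 ⊆ hT.elems) {x : Plane}
    {R δ : ℝ} (hδ : 0 ≤ δ) (hR : 0 ≤ R) (hsub : ∀ K ∈ 𝒦, tri K ⊆ Metric.closedBall x R)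
    (hdiam : ∀ K ∈ 𝒦, δ ≤ elementDiam K) : (𝒦.card : ℝ) * (κ * δ) ^ 2 ≤ R ^ 2 := by
  have h1 : ∫ _ in ⋃ K ∈ 𝒦, tri K, (1 : ℝ) = ∑ K ∈ 𝒦, ∫ _ in tri K, (1 : ℝ) :=
    setIntegral_eq_sum_of_ae 𝒦 (fun K _ => (isClosed_tri K).measurableSet)
      (fun K hK K' hK' hne => volume_inter_tri (hT.mem_elems.1 (h𝒦 hK))
        (hT.mem_elems.1 (h𝒦 hK')) hne) (Filter.EventuallyEq.refl _ _)
      (fun K _ => integrableOn_tri K continuous_const)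
  simp only [setIntegral_const, smul_eq_mul, mul_one] at h1
  have h2 : volume.real (⋃ K ∈ 𝒦, tri K) ≤ R ^ 2 * discArea := by
    rw [← volume_closedBall x hR]
    exact measureReal_mono (Set.iUnion₂_subset hsub) measure_closedBall_lt_top.ne
  have h3 : ∀ K ∈ 𝒦, (κ * δ) ^ 2 * discArea ≤ volume.real (tri K) := by
    intro K hK
    obtain ⟨c, hc⟩ := hb K (hT.mem_elems.1 (h𝒦 hK))
    rw [← volume_closedBall c (by positivity)]
    refine measureReal_mono ((Metric.closedBall_subset_closedBall ?_).trans hc)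
      (isCompact_tri K).measure_lt_top.ne
    exact mul_le_mul_of_nonneg_left (hdiam K hK) hκ.le
  have h4 := Finset.sum_le_sum h3
  rw [Finset.sum_const, nsmul_eq_mul, ← h1] at h4
  have h5 := h4.trans h2
  rw [← mul_assoc] at h5
  exact le_of_mul_le_mul_right h5 discArea_pos

/-- Compared with one fixed element at `z`, all elements at `z` lie in a ball of radius `cq * h` and
have diameter at least `h / cq`. -/
theorem IsFittedTriangulation.card_star_le (hT : IsFittedTriangulation Ω T) {κ cq : ℝ}
    (hκ : 0 < κ) (hcq : 0 < cq) (hb : HasInscribedBalls κ T) (hq : IsQuasiUniform cq T)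
    (z : Plane) : ((hT.elems.filter fun K => z ∈ K).card : ℝ) ≤ (cq ^ 2 / κ) ^ 2 := by
  rcases (hT.elems.filter fun K => z ∈ K).eq_empty_or_nonempty with he | ⟨K₀, hK₀⟩
  · rw [he, Finset.card_empty, Nat.cast_zero]; positivity
  · obtain ⟨hK₀, hz₀⟩ := Finset.mem_filter.1 hK₀
    have hh := (hT.isTri hK₀).elementDiam_pos
    have h1 := hT.card_mul_le hκ hb (Finset.filter_subset (fun K => z ∈ K) hT.elems)
      (x := z) (R := cq * elementDiam K₀) (δ := elementDiam K₀ / cq) (by positivity)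
      (by positivity) (fun K hK y hy => ?_) (fun K hK => ?_)
    · rw [div_pow, le_div_iff₀ (by positivity)]
      have h2 : (κ * (elementDiam K₀ / cq)) ^ 2 = κ ^ 2 * (elementDiam K₀ ^ 2 / cq ^ 2) := by
        field_simp
      rw [h2] at h1
      have h3 : 0 < elementDiam K₀ ^ 2 := by positivity
      refine le_of_mul_le_mul_right ?_ h3
      have h4 := mul_le_mul_of_nonneg_left h1 (by positivity : 0 ≤ cq ^ 2)
      calc _ = cq ^ 2 * (((hT.elems.filter fun K => z ∈ K).card : ℝ)
            * (κ ^ 2 * (elementDiam K₀ ^ 2 / cq ^ 2))) := by field_simp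
        _ ≤ _ := h4
        _ = _ := by ring
    · obtain ⟨hK, hz⟩ := Finset.mem_filter.1 hK
      exact (dist_le_elementDiam hy (mem_tri_of_mem hz)).trans
        (hq K₀ (hT.mem_elems.1 hK₀) K (hT.mem_elems.1 hK))
    · obtain ⟨hK, -⟩ := Finset.mem_filter.1 hK
      rw [div_le_iff₀ hcq, mul_comm]
      exact hq K (hT.mem_elems.1 hK) K₀ (hT.mem_elems.1 hK₀)

end Shape

/-! ### Products of hat functions and their fluxes -/

/-- A barycentric coordinate as a polynomial. -/
noncomputable def baryPoly (K : Finset Plane) (p : Plane) : MvPolynomial (Fin 2) ℝ :=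
  MvPolynomial.C (bary K p 0) + ∑ i, MvPolynomial.C (baryGrad K p i) * MvPolynomial.X i

theorem polyFun_baryPoly (K : Finset Plane) (p x : Plane) :
    polyFun (baryPoly K p) x = bary K p x := by
  have h := bary_add K p 0 x
  rw [zero_add] at h
  rw [h, PiLp.inner_apply]
  simp [polyFun, baryPoly, Fin.sum_univ_two]
  ring

theorem gradPoly_baryPoly (K : Finset Plane) (p x : Plane) :
    gradPoly (baryPoly K p) x = baryGrad K p := by
  ext i
  fin_cases i <;> simp [gradPoly_apply, polyFun, baryPoly, Fin.sum_univ_two,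
    MvPolynomial.pderiv_X]

theorem totalDegree_baryPoly (K : Finset Plane) (p : Plane) : (baryPoly K p).totalDegree ≤ 1 := by
  refine (MvPolynomial.totalDegree_add _ _).trans (max_le (by simp) ?_)
  refine MvPolynomial.totalDegree_finsetSum_le fun i _ => ?_
  exact (MvPolynomial.totalDegree_mul _ _).trans (by simp)

theorem baryPoly_of_notMem {K : Finset Plane} {p : Plane} (hp : p ∉ K) : baryPoly K p = 0 := by
  simp [baryPoly, bary_of_notMem hp, baryGrad_of_notMem hp]

/-- The product of the hat functions of the vertices in `s`. -/
noncomputable def hatPoly (s : Finset Plane) : PolyFamily := fun K => ∏ p ∈ s, baryPoly K p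

theorem hatPoly_of_not_subset {s K : Finset Plane} (h : ¬ s ⊆ K) : hatPoly s K = 0 := by
  obtain ⟨p, hp, hpK⟩ := Finset.not_subset.1 h
  exact Finset.prod_eq_zero hp (baryPoly_of_notMem hpK)

theorem totalDegree_hatPoly (s K : Finset Plane) : (hatPoly s K).totalDegree ≤ s.card := by
  refine (MvPolynomial.totalDegree_finsetProd _ _).trans ?_
  refine (Finset.sum_le_sum fun p _ => totalDegree_baryPoly K p).trans ?_
  simp

theorem polyFun_hatPoly (s K : Finset Plane) (x : Plane) :
    polyFun (hatPoly s K) x = ∏ p ∈ s, bary K p x := by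
  simp only [hatPoly, ← polyFun_baryPoly]
  simp [polyFun]

theorem IsTri.abs_polyFun_hatPoly_le {K : Finset Plane} (hK : IsTri K) (s : Finset Plane)
    {x : Plane} (hx : x ∈ tri K) : |polyFun (hatPoly s K) x| ≤ 1 := by
  rw [polyFun_hatPoly, Finset.abs_prod]
  refine Finset.prod_le_one (fun _ _ => abs_nonneg _) fun p _ => ?_
  rw [abs_of_nonneg (hK.bary_nonneg hx p)]
  exact hK.bary_le_one hx p

theorem gradPoly_hatPoly_singleton (K : Finset Plane) (p x : Plane) :
    gradPoly (hatPoly {p} K) x = baryGrad K p := by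
  rw [hatPoly, Finset.prod_singleton, gradPoly_baryPoly]

theorem gradPoly_hatPoly_pair (K : Finset Plane) {p q : Plane} (hpq : p ≠ q) (x : Plane) :
    gradPoly (hatPoly {p, q} K) x = bary K p x • baryGrad K q + bary K q x • baryGrad K p := by
  rw [hatPoly, Finset.prod_pair hpq, gradPoly_mul]
  simp only [gradPoly_baryPoly, polyFun_baryPoly]

section Bounds

variable {K : Finset Plane} {κ : ℝ}

theorem IsTri.elementDiam_mul_norm_baryGrad_le (hK : IsTri K) (hκ : 0 < κ)
    (hb : ∃ c, Metric.closedBall c (κ * elementDiam K) ⊆ tri K) (p : Plane) :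
    elementDiam K * ‖baryGrad K p‖ ≤ 1 / (2 * κ) := by
  obtain ⟨c, hc⟩ := hb
  have := hK.norm_baryGrad_mul_le (mul_nonneg hκ.le hK.elementDiam_pos.le) hc p
  rw [le_div_iff₀ (by positivity)]
  linarith

theorem IsTri.elementDiam_mul_norm_gradPoly_hatPoly_le (hK : IsTri K) (hκ : 0 < κ)
    (hb : ∃ c, Metric.closedBall c (κ * elementDiam K) ⊆ tri K) {s : Finset Plane}
    (hs0 : s.Nonempty) (hs : s.card ≤ 2) {x : Plane} (hx : x ∈ tri K) :
    elementDiam K * ‖gradPoly (hatPoly s K) x‖ ≤ 1 / κ := by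
  have hh := hK.elementDiam_pos
  have hg := hK.elementDiam_mul_norm_baryGrad_le hκ hb
  have h2 : 1 / (2 * κ) + 1 / (2 * κ) = 1 / κ := by field_simp; norm_num
  have h3 : 0 < 1 / (2 * κ) := by positivity
  have hcard : s.card = 1 ∨ s.card = 2 := by
    have := Finset.card_pos.2 hs0
    omega
  rcases hcard with h | h
  · obtain ⟨p, rfl⟩ := Finset.card_eq_one.1 h
    rw [gradPoly_hatPoly_singleton]
    linarith [hg p]
  · obtain ⟨p, q, hpq, rfl⟩ := Finset.card_eq_two.1 h
    rw [gradPoly_hatPoly_pair K hpq]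
    have h4 : ∀ u v, ‖bary K u x • baryGrad K v‖ ≤ ‖baryGrad K v‖ := fun u v => by
      rw [norm_smul, Real.norm_of_nonneg (hK.bary_nonneg hx u)]
      exact mul_le_of_le_one_left (norm_nonneg _) (hK.bary_le_one hx u)
    have h5 := (norm_add_le _ _).trans (add_le_add (h4 p q) (h4 q p))
    nlinarith [hg p, hg q, mul_le_mul_of_nonneg_left h5 hh.le]

/-- The length of a face times the reciprocal of the height is bounded below. -/
theorem IsTri.le_arcLength_mul_norm_baryGrad (hK : IsTri K) (hκ : 0 < κ)
    (hb : ∃ c, Metric.closedBall c (κ * elementDiam K) ⊆ tri K) {p : Plane} (hp : p ∈ K) :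
    2 * κ ≤ arcLength.real (face K p) * ‖baryGrad K p‖ := by
  have hh := hK.elementDiam_pos
  obtain ⟨q, r, hqr, he, hf⟩ := hK.exists_face_eq_segment hp
  have hq : q ∈ K.erase p := by simp [he]
  have hr : r ∈ K.erase p := by simp [he]
  rw [hf, arcLength_segment]
  have h1 := hK.one_le_norm_baryGrad_mul_dist (Finset.mem_of_mem_erase hq)
    (Finset.mem_of_mem_erase hr) hqr.symm
  have h2 := hK.elementDiam_mul_norm_baryGrad_le hκ hb q
  have h3 := hK.one_le_norm_baryGrad_mul_elementDiam hp
  rw [le_div_iff₀ (by positivity)] at h2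
  -- The edge is at least as long as the height over `q`, which exceeds the diameter of the
  -- inscribed ball.
  have h4 : 2 * κ * elementDiam K ≤ dist q r := by
    have h5 : 0 < ‖baryGrad K q‖ := hK.norm_baryGrad_pos (Finset.mem_of_mem_erase hq)
    refine le_of_mul_le_mul_left ?_ h5
    nlinarith
  have h6 : 0 ≤ ‖baryGrad K p‖ := norm_nonneg _
  nlinarith [mul_le_mul_of_nonneg_right h4 h6]

theorem inner_baryGrad_faceNormal (K : Finset Plane) (p : Plane) :
    inner ℝ (baryGrad K p) (faceNormal K p) = -‖baryGrad K p‖ := by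
  rw [faceNormal, inner_neg_right, inner_smul_right, real_inner_self_eq_norm_sq, sq,
    ← mul_assoc]
  rcases eq_or_ne ‖baryGrad K p‖ 0 with h | h
  · simp [h]
  · rw [inv_mul_cancel₀ h, one_mul]

theorem setIntegral_face_const (K : Finset Plane) (p : Plane) (a : ℝ) :
    ∫ _ in face K p, a ∂arcLength = arcLength.real (face K p) * a := by
  rw [setIntegral_const, smul_eq_mul]

/-- The coordinate is at least `1 / 2` on the half of the face next to `q`; this crude bound
suffices. -/
theorem IsTri.le_integral_bary (hK : IsTri K) {p q : Plane} (hp : p ∈ K) (hq : q ∈ K)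
    (hqp : q ≠ p) :
    arcLength.real (face K p) / 4 ≤ ∫ x in face K p, bary K q x ∂arcLength := by
  obtain ⟨q', r', hqr', he, hf⟩ := hK.exists_face_eq_segment hp
  obtain ⟨r, hqr, hr, hf⟩ : ∃ r, q ≠ r ∧ r ∈ K ∧ face K p = segment ℝ q r := by
    have hmem : q ∈ K.erase p := Finset.mem_erase.2 ⟨hqp, hq⟩
    have h1 : q' ∈ K.erase p := by simp [he]
    have h2 : r' ∈ K.erase p := by simp [he]
    rw [he] at hmem
    rcases Finset.mem_insert.1 hmem with rfl | h
    · exact ⟨r', hqr', Finset.mem_of_mem_erase h2, hf⟩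
    · rw [Finset.mem_singleton] at h; subst h
      exact ⟨q', hqr'.symm, Finset.mem_of_mem_erase h1, by rw [hf, segment_symm]⟩
  have hsub : segment ℝ q (midpoint ℝ q r) ⊆ face K p := by
    rw [hf]
    exact (convex_segment q r).segment_subset (left_mem_segment ℝ q r)
      (midpoint_mem_segment q r)
  have hint : IntegrableOn (bary K q) (face K p) arcLength :=
    hK.integrableOn_face hp (continuous_bary K q)
  have hfin : arcLength (segment ℝ q (midpoint ℝ q r)) ≠ ⊤ := by
    rw [hausdorffMeasure_segment]; exact edist_ne_top _ _
  have hmeas : MeasurableSet (segment ℝ q (midpoint ℝ q r)) := by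
    rw [← convexHull_pair]
    exact ((Set.toFinite _).isCompact_convexHull ℝ).measurableSet
  have hhalf : ∀ x ∈ segment ℝ q (midpoint ℝ q r), 1 / 2 ≤ bary K q x := by
    have hm : bary K q (midpoint ℝ q r) = 1 / 2 := by
      rw [(bary K q).map_midpoint, hK.bary_self hq, hK.bary_of_ne hr hqr.symm,
        midpoint_eq_smul_add]
      simp
    have hc : Convex ℝ {x | 1 / 2 ≤ bary K q x} :=
      (convex_Ici (1 / 2 : ℝ)).affine_preimage (bary K q)
    refine hc.segment_subset ?_ ?_
    · change (1 / 2 : ℝ) ≤ _; rw [hK.bary_self hq]; norm_num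
    · change (1 / 2 : ℝ) ≤ _; rw [hm]
  calc arcLength.real (face K p) / 4
      = ∫ _ in segment ℝ q (midpoint ℝ q r), (1 / 2 : ℝ) ∂arcLength := by
        rw [setIntegral_const, smul_eq_mul, hf, arcLength_segment, arcLength_segment,
          dist_left_midpoint, Real.norm_of_nonneg (by norm_num)]
        ring
    _ ≤ ∫ x in segment ℝ q (midpoint ℝ q r), bary K q x ∂arcLength := by
        refine setIntegral_mono_on (integrableOn_const hfin) (hint.mono_set hsub) hmeas hhalf
    _ ≤ _ := by
        refine setIntegral_mono_set hint ?_ (Filter.Eventually.of_forall hsub)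
        refine (ae_restrict_iff' (isCompact_face K p).measurableSet).2
          (Filter.Eventually.of_forall fun x hx => ?_)
        exact hK.bary_nonneg (face_subset_tri K p hx) q

/-- The flux of a product of hat functions through a face that misses just the vertex `p`. -/
theorem IsTri.faceFlux_hatPoly_le (hK : IsTri K) (hκ : 0 < κ)
    (hb : ∃ c, Metric.closedBall c (κ * elementDiam K) ⊆ tri K) {p : Plane} {s : Finset Plane}
    (hs : s ⊆ K) (hp : p ∈ s) (hcard : s.card ≤ 2) : faceFlux (K, p) (hatPoly s K) ≤ -(κ / 2) := by
  have hpK := hs hp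
  have hlow := hK.le_arcLength_mul_norm_baryGrad hκ hb hpK
  have hc : s.card = 1 ∨ s.card = 2 := by
    have := Finset.card_pos.2 ⟨p, hp⟩
    omega
  rcases hc with h | h
  · obtain ⟨p', rfl⟩ := Finset.card_eq_one.1 h
    obtain rfl := Finset.mem_singleton.1 hp
    simp only [faceFlux, gradPoly_hatPoly_singleton, inner_baryGrad_faceNormal]
    rw [setIntegral_face_const]
    linarith
  · obtain ⟨q, hq⟩ : ∃ q, s = {p, q} ∧ p ≠ q := by
      obtain ⟨u, v, huv, rfl⟩ := Finset.card_eq_two.1 h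
      rcases Finset.mem_insert.1 hp with rfl | hp'
      · exact ⟨v, rfl, huv⟩
      · rw [Finset.mem_singleton] at hp'; subst hp'
        exact ⟨u, Finset.pair_comm _ _, huv.symm⟩
    obtain ⟨rfl, hpq⟩ := hq
    have hqK : q ∈ K := hs (by simp)
    -- On the face the coordinate of `p` vanishes, so only its own gradient, weighted by the
    -- coordinate of `q`, is left of the product rule.
    have h1 : faceFlux (K, p) (hatPoly {p, q} K)
        = -‖baryGrad K p‖ * ∫ x in face K p, bary K q x ∂arcLength := by
      rw [faceFlux, ← integral_const_mul]
      refine setIntegral_congr_fun (isCompact_face K p).measurableSet fun x hx => ?_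
      simp only [gradPoly_hatPoly_pair K hpq, hK.bary_mem_face hx, zero_smul, zero_add,
        real_inner_smul_left, inner_baryGrad_faceNormal]
      ring
    rw [h1]
    have h2 := hK.le_integral_bary hpK hqK hpq.symm
    nlinarith [mul_le_mul_of_nonneg_left h2 (norm_nonneg (baryGrad K p))]

/-- The faces of a triangle are proportional to the gradients of its barycentric coordinates. -/
theorem IsTri.exists_arcLength_eq (hK : IsTri K) :
    ∃ D : ℝ, ∀ p ∈ K, arcLength.real (face K p) = D * ‖baryGrad K p‖ := by
  obtain ⟨A, B, C, hAB, hAC, hBC, hKeq⟩ := Finset.card_eq_three.1 hK.card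
  have hA : A ∈ K := by simp [hKeq]
  have hB : B ∈ K := by simp [hKeq]
  have hC : C ∈ K := by simp [hKeq]
  set u := B - A with hu
  set w := C - A with hw
  set gB := baryGrad K B with hgB
  set gC := baryGrad K C with hgC
  have e1 : inner ℝ gB u = 1 := by
    rw [hgB, hu, ← bary_sub, hK.bary_self hB, hK.bary_of_ne hA hAB, sub_zero]
  have e2 : inner ℝ gB w = 0 := by
    rw [hgB, hw, ← bary_sub, hK.bary_of_ne hC hBC.symm, hK.bary_of_ne hA hAB, sub_zero]
  have e3 : inner ℝ gC u = 0 := by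
    rw [hgC, hu, ← bary_sub, hK.bary_of_ne hB hBC, hK.bary_of_ne hA hAC, sub_zero]
  have e4 : inner ℝ gC w = 1 := by
    rw [hgC, hw, ← bary_sub, hK.bary_self hC, hK.bary_of_ne hA hAC, sub_zero]
  have e5 : baryGrad K A = -(gB + gC) := by
    have := hK.sum_baryGrad
    rw [hKeq, Finset.sum_insert (by simp [hAB, hAC]), Finset.sum_pair hBC, ← hKeq] at this
    exact eq_neg_of_add_eq_zero_left this
  simp only [PiLp.inner_apply, Fin.sum_univ_two, RCLike.inner_apply, conj_trivial] at e1 e2 e3 e4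
  -- Up to sign `D` is twice the area, and `D` times a gradient is the opposite edge turned by a
  -- right angle.
  set D := u 0 * w 1 - u 1 * w 0 with hD
  have d1 : D * gB 0 = w 1 := by linear_combination w 1 * e1 - u 1 * e2
  have d2 : D * gB 1 = -w 0 := by linear_combination u 0 * e2 - w 0 * e1
  have d3 : D * gC 0 = -u 1 := by linear_combination w 1 * e3 - u 1 * e4
  have d4 : D * gC 1 = u 0 := by linear_combination u 0 * e4 - w 0 * e3
  have hnorm : ∀ x y : Plane, D * x 0 = y 1 → D * x 1 = - y 0 → ‖y‖ = |D| * ‖x‖ := by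
    intro x y h0 h1
    rw [← abs_of_nonneg (norm_nonneg y), ← abs_of_nonneg (norm_nonneg x), ← abs_mul,
      ← sq_eq_sq_iff_abs_eq_abs, mul_pow, EuclideanSpace.norm_sq_eq, EuclideanSpace.norm_sq_eq]
    simp only [Fin.sum_univ_two, Real.norm_eq_abs, sq_abs]
    linear_combination (-(D * x 0) - y 1) * h0 + (-(D * x 1) + y 0) * h1
  have hface : ∀ p q r, K.erase p = {q, r} → arcLength.real (face K p) = dist q r :=
    fun p q r h => by rw [face, h, Finset.coe_pair, convexHull_pair, arcLength_segment]
  refine ⟨|D|, fun p hp => ?_⟩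
  have hp' : p = A ∨ p = B ∨ p = C := by simpa [hKeq] using hp
  rcases hp' with rfl | rfl | rfl
  · rw [hface p B C (by ext z; simp [hKeq]; grind), e5, norm_neg, dist_eq_norm]
    have : B - C = -(w - u) := by rw [hw, hu]; abel
    rw [this, norm_neg]
    refine hnorm _ _ ?_ ?_
    · simp only [PiLp.add_apply, PiLp.sub_apply]; linear_combination d1 + d3
    · simp only [PiLp.add_apply, PiLp.sub_apply]; linear_combination d2 + d4
  · rw [hface p A C (by ext z; simp [hKeq]; grind), dist_comm, dist_eq_norm, ← hw]
    exact hnorm _ _ d1 d2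
  · rw [hface p A B (by ext z; simp [hKeq]; grind), dist_comm, dist_eq_norm, ← hu, ← norm_neg u]
    refine hnorm _ _ ?_ ?_
    · simpa using d3
    · simpa using d4

theorem faceFlux_hatPoly_singleton (K : Finset Plane) (A p : Plane) :
    faceFlux (K, p) (hatPoly {A} K)
      = arcLength.real (face K p) * inner ℝ (baryGrad K A) (faceNormal K p) := by
  simp only [faceFlux, gradPoly_hatPoly_singleton]
  exact setIntegral_face_const K p _

/-- The flux of a hat function through the two faces that meet in its vertex. -/
theorem IsTri.sum_faceFlux_hatPoly (hK : IsTri K) {A : Plane} (hA : A ∈ K) :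
    ∑ p ∈ K.erase A, faceFlux (K, p) (hatPoly {A} K)
      = arcLength.real (face K A) * ‖baryGrad K A‖ := by
  obtain ⟨D, hD⟩ := hK.exists_arcLength_eq
  have h1 : ∀ p ∈ K.erase A, faceFlux (K, p) (hatPoly {A} K)
      = -D * inner ℝ (baryGrad K A) (baryGrad K p) := fun p hp => by
    have hp := Finset.mem_of_mem_erase hp
    have := hK.norm_baryGrad_pos hp
    rw [faceFlux_hatPoly_singleton, hD p hp, faceNormal, inner_neg_right, inner_smul_right]
    field_simp
  -- The divergence theorem for a constant field: the fluxes through the three faces cancel.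
  have h2 : ∑ p ∈ K.erase A, baryGrad K p = - baryGrad K A := by
    rw [eq_neg_iff_add_eq_zero, Finset.sum_erase_add _ _ hA, hK.sum_baryGrad]
  rw [Finset.sum_congr rfl h1, ← Finset.mul_sum, ← inner_sum, h2, inner_neg_right,
    real_inner_self_eq_norm_sq, hD A hA]
  ring

end Bounds

/-! ### The test functions -/

section Mesh

variable {Ω : Set Plane} {T : Geometry.SimplicialComplex ℝ Plane} {k : ℕ}

theorem Represents.add {P Q : PolyFamily} {v w : Plane → ℝ} (hv : Represents T k P v)
    (hw : Represents T k Q w) : Represents T k (P + Q) (v + w) := fun K hK =>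
  ⟨(MvPolynomial.totalDegree_add _ _).trans (max_le (hv K hK).1 (hw K hK).1), fun x hx => by
    rw [Pi.add_apply, Pi.add_apply, polyFun_add, (hv K hK).2 x hx, (hw K hK).2 x hx]⟩

theorem Represents.smul {P : PolyFamily} {v : Plane → ℝ} (hv : Represents T k P v) (a : ℝ) :
    Represents T k (a • P) (a • v) := fun K hK =>
  ⟨(MvPolynomial.totalDegree_smul_le _ _).trans (hv K hK).1, fun x hx => by
    rw [Pi.smul_apply, Pi.smul_apply, polyFun_smul, (hv K hK).2 x hx, smul_eq_mul]⟩

theorem represents_zero : Represents T k 0 0 := fun _ _ => ⟨by simp, fun _ _ => by simp [polyFun]⟩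

theorem Represents.sum {G : Finset (Finset Plane)} {Q : Finset Plane → PolyFamily}
    {w : Finset Plane → Plane → ℝ} (h : ∀ s ∈ G, Represents T k (Q s) (w s)) :
    Represents T k (∑ s ∈ G, Q s) (∑ s ∈ G, w s) := by
  classical
  induction G using Finset.induction_on with
  | empty => simpa using represents_zero
  | insert s G hs ih =>
    rw [Finset.sum_insert hs, Finset.sum_insert hs]
    exact (h s (Finset.mem_insert_self _ _)).add
      (ih fun t ht => h t (Finset.mem_insert_of_mem ht))

/-- Products of hat functions belong to the finite element space. -/
theorem exists_represents_hatPoly (T : Geometry.SimplicialComplex ℝ Plane) {s : Finset Plane}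
    (hs : s.card ≤ k) : ∃ v, Represents T k (hatPoly s) v := by
  classical
  -- The value at `x` does not depend on the chosen element, because barycentric coordinates agree
  -- where elements meet.
  refine ⟨fun x => if h : ∃ K ∈ elements T, x ∈ tri K then polyFun (hatPoly s h.choose) x else 0,
    fun K hK => ⟨(totalDegree_hatPoly s K).trans hs, fun x hx => ?_⟩⟩
  have hex : ∃ K ∈ elements T, x ∈ tri K := ⟨K, hK, hx⟩
  simp only [dif_pos hex, polyFun_hatPoly]
  exact Finset.prod_congr rfl fun p _ =>
    bary_eq_of_mem_inter hex.choose_spec.1 hK hex.choose_spec.2 hx p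

/-- A simplex of an element with a boundary face that lies on no boundary face. -/
def IsFittedTriangulation.IsInner (hT : IsFittedTriangulation Ω T) (s : Finset Plane) : Prop :=
  (∃ c ∈ hT.bdryPairs, s ⊆ c.1) ∧ ∀ c ∈ hT.bdryPairs, ¬ s ⊆ c.1.erase c.2

/-- A vertex of just one element, of which exactly the two faces at this vertex lie on the
boundary. -/
def IsFittedTriangulation.IsEar (hT : IsFittedTriangulation Ω T) (A : Plane) : Prop :=
  ∃ K ∈ hT.elems, A ∈ K ∧ (∀ K' ∈ hT.elems, A ∈ K' → K' = K) ∧ (K, A) ∉ hT.bdryPairs ∧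
    ∀ p ∈ K, p ≠ A → (K, p) ∈ hT.bdryPairs

open Classical in
/-- The simplices whose hat functions serve as test functions. -/
noncomputable def IsFittedTriangulation.testSimplices (hT : IsFittedTriangulation Ω T) (k : ℕ) :
    Finset (Finset Plane) :=
  (hT.elems.biUnion Finset.powerset).filter fun s =>
    s.Nonempty ∧ s.card ≤ k ∧ s.card ≤ 2 ∧ (hT.IsInner s ∨ ∃ A, s = {A} ∧ hT.IsEar A)

open Classical in
/-- The test functions, with the sign that makes their boundary flux negative. -/
noncomputable def IsFittedTriangulation.testPoly (hT : IsFittedTriangulation Ω T)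
    (s : Finset Plane) : PolyFamily :=
  if hT.IsInner s then hatPoly s else -hatPoly s

theorem IsFittedTriangulation.mem_testSimplices (hT : IsFittedTriangulation Ω T)
    {s : Finset Plane} : s ∈ hT.testSimplices k ↔ (∃ K ∈ hT.elems, s ⊆ K) ∧
      s.Nonempty ∧ s.card ≤ k ∧ s.card ≤ 2 ∧ (hT.IsInner s ∨ ∃ A, s = {A} ∧ hT.IsEar A) := by
  simp [testSimplices]

theorem IsFittedTriangulation.testPoly_eq_or (hT : IsFittedTriangulation Ω T)
    (s : Finset Plane) :
    hT.testPoly s = hatPoly s ∨ hT.testPoly s = (-1 : ℝ) • hatPoly s := by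
  rw [testPoly]
  split_ifs
  · exact Or.inl rfl
  · right; simp

theorem IsFittedTriangulation.exists_represents_testPoly (hT : IsFittedTriangulation Ω T)
    {s : Finset Plane} (hs : s ∈ hT.testSimplices k) : ∃ v, Represents T k (hT.testPoly s) v := by
  obtain ⟨v, hv⟩ := exists_represents_hatPoly T (hT.mem_testSimplices.1 hs).2.2.1
  rcases hT.testPoly_eq_or s with h | h
  · exact ⟨v, h ▸ hv⟩
  · exact ⟨_, h ▸ hv.smul (-1)⟩

theorem faceFlux_of_not_subset (c : Finset Plane × Plane) {s : Finset Plane} (h : ¬ s ⊆ c.1) :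
    faceFlux c (hatPoly s c.1) = 0 := by
  have : ∀ x, gradPoly (0 : MvPolynomial (Fin 2) ℝ) x = 0 := fun x => by
    simpa using gradPoly_smul 0 0 x
  simp [faceFlux, hatPoly_of_not_subset h, this]

theorem faceFlux_neg (c : Finset Plane × Plane) (p : MvPolynomial (Fin 2) ℝ) :
    faceFlux c (-p) = - faceFlux c p := by
  have : ∀ x, gradPoly (-p) x = -gradPoly p x := fun x => by
    simpa using gradPoly_smul (-1) p x
  simp only [faceFlux, this, inner_neg_left]
  exact integral_neg _

/-- If the element of a boundary face contains `s`, the vertex off that face belongs to `s`, since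
otherwise `s` would lie in the face. So no contribution is positive, and there is at least one
negative contribution of the required size. -/
theorem IsFittedTriangulation.IsInner.sum_faceFlux_le {hT : IsFittedTriangulation Ω T}
    {s : Finset Plane} (h : hT.IsInner s) {κ : ℝ} (hκ : 0 < κ) (hb : HasInscribedBalls κ T)
    (hcard : s.card ≤ 2) :
    ∑ c ∈ hT.bdryPairs, faceFlux c (hatPoly s c.1) ≤ -(κ / 2) := by
  have hsub : ∀ c ∈ hT.bdryPairs, s ⊆ c.1 → faceFlux c (hatPoly s c.1) ≤ -(κ / 2) := by
    intro c hc hs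
    have hK := hT.fst_mem_elems hc
    have hmem : c.2 ∈ s := by
      by_contra hcon
      refine h.2 c hc fun q hq => Finset.mem_erase.2 ⟨?_, hs hq⟩
      rintro rfl; exact hcon hq
    exact (hT.isTri hK).faceFlux_hatPoly_le hκ (hb _ (hT.mem_elems.1 hK)) hs hmem hcard
  obtain ⟨c₀, hc₀, hs₀⟩ := h.1
  have hle : ∀ c ∈ hT.bdryPairs, faceFlux c (hatPoly s c.1) ≤ 0 := by
    intro c hc
    by_cases hs : s ⊆ c.1
    · exact (hsub c hc hs).trans (by linarith)
    · rw [faceFlux_of_not_subset c hs]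
  calc _ ≤ faceFlux c₀ (hatPoly s c₀.1) := by
        rw [← Finset.add_sum_erase _ _ hc₀]
        have := Finset.sum_nonpos (s := hT.bdryPairs.erase c₀) fun c hc =>
          hle c (Finset.mem_of_mem_erase hc)
        linarith
    _ ≤ _ := hsub c₀ hc₀ hs₀

/-- The hat function lives on one element, and its boundary flux passes through exactly the two
faces at `A`. It is positive, which is why `testPoly` reverses the sign for ears. -/
theorem IsFittedTriangulation.IsEar.le_sum_faceFlux {hT : IsFittedTriangulation Ω T}
    {A : Plane} (h : hT.IsEar A) {κ : ℝ} (hκ : 0 < κ) (hb : HasInscribedBalls κ T) :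
    2 * κ ≤ ∑ c ∈ hT.bdryPairs, faceFlux c (hatPoly {A} c.1) := by
  obtain ⟨K, hK, hA, huniq, hnot, hfaces⟩ := h
  have h1 : ∑ c ∈ hT.bdryPairs, faceFlux c (hatPoly {A} c.1)
      = ∑ p ∈ K.erase A, faceFlux (K, p) (hatPoly {A} K) := by
    symm
    have hinj : Set.InjOn (fun p : Plane => (K, p)) (K.erase A : Set Plane) :=
      fun p _ q _ hpq => (Prod.mk.inj hpq).2
    rw [← Finset.sum_image (f := fun c : Finset Plane × Plane => faceFlux c (hatPoly {A} c.1))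
      (s := K.erase A) (g := fun p => (K, p)) hinj]
    refine Finset.sum_subset (fun c hc => ?_) fun c hc hc' => ?_
    · obtain ⟨p, hp, rfl⟩ := Finset.mem_image.1 hc
      exact hfaces p (Finset.mem_of_mem_erase hp) (Finset.ne_of_mem_erase hp)
    · refine faceFlux_of_not_subset c fun hs => hc' ?_
      have hcK := huniq c.1 (hT.fst_mem_elems hc) (hs (Finset.mem_singleton_self A))
      refine Finset.mem_image.2 ⟨c.2, Finset.mem_erase.2 ⟨?_, ?_⟩, Prod.ext hcK.symm rfl⟩
      · intro hcA
        exact hnot (by rw [← hcK, ← hcA]; exact hc)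
      · rw [← hcK]; exact hT.snd_mem hc
  rw [h1, (hT.isTri hK).sum_faceFlux_hatPoly hA]
  exact (hT.isTri hK).le_arcLength_mul_norm_baryGrad hκ (hb _ (hT.mem_elems.1 hK)) hA

/-- In the last constant, `8` counts the subsets of the vertex set of an element, and the square
bounds the number of elements at a vertex. -/
theorem IsFittedTriangulation.isTestFamily (hT : IsFittedTriangulation Ω T) (k : ℕ) {κ cq : ℝ}
    (hκ : 0 < κ) (hcq : 0 < cq) (hb : HasInscribedBalls κ T) (hq : IsQuasiUniform cq T) :
    IsTestFamily hT (hT.testSimplices k) hT.testPoly (1 + 1 / κ) (κ / 2)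
      (8 + (cq ^ 2 / κ) ^ 2) := by
  have hκ' : 0 < 1 / κ := by positivity
  constructor
  · intro s hs K hK hsK
    rcases hT.testPoly_eq_or s with h | h <;> simp [h, hatPoly_of_not_subset hsK]
  · intro s hs K hK x hx
    have := (hT.isTri hK).abs_polyFun_hatPoly_le s hx
    rcases hT.testPoly_eq_or s with h | h
    · rw [h]; linarith
    · rw [h, Pi.smul_apply, polyFun_smul, abs_mul, abs_neg, abs_one, one_mul]; linarith
  · intro s hs K hK x hx
    obtain ⟨-, h0, -, h2, -⟩ := hT.mem_testSimplices.1 hs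
    have := (hT.isTri hK).elementDiam_mul_norm_gradPoly_hatPoly_le hκ
      (hb K (hT.mem_elems.1 hK)) h0 h2 hx
    rcases hT.testPoly_eq_or s with h | h
    · rw [h]; linarith
    · rw [h, Pi.smul_apply, gradPoly_smul, norm_smul, norm_neg, norm_one, one_mul]; linarith
  · intro s hs
    obtain ⟨-, h0, -, h2, h3⟩ := hT.mem_testSimplices.1 hs
    by_cases hin : hT.IsInner s
    · rw [testPoly, if_pos hin]
      exact hin.sum_faceFlux_le hκ hb h2
    · obtain ⟨A, rfl, hA⟩ := h3.resolve_left hin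
      have := hA.le_sum_faceFlux hκ hb
      simp only [testPoly, if_neg hin, Pi.neg_apply, faceFlux_neg, Finset.sum_neg_distrib]
      linarith
  · intro s hs
    obtain ⟨-, ⟨z, hz⟩, -⟩ := hT.mem_testSimplices.1 hs
    have h1 := hT.card_star_le hκ hcq hb hq z
    have h2 : (hT.elems.filter fun K => s ⊆ K).card ≤ (hT.elems.filter fun K => z ∈ K).card :=
      Finset.card_le_card fun K hK => by
        rw [Finset.mem_filter] at hK ⊢
        exact ⟨hK.1, hK.2 hz⟩
    have h3 : ((hT.elems.filter fun K => s ⊆ K).card : ℝ)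
        ≤ (hT.elems.filter fun K => z ∈ K).card := by exact_mod_cast h2
    linarith
  · intro K hK
    have h1 : ((hT.testSimplices k).filter fun s => s ⊆ K).card ≤ 8 := by
      refine (Finset.card_le_card (t := K.powerset) fun s hs => ?_).trans ?_
      · exact Finset.mem_powerset.2 (Finset.mem_filter.1 hs).2
      · rw [Finset.card_powerset, (hT.isTri hK).card]; norm_num
    have h2 : (((hT.testSimplices k).filter fun s => s ⊆ K).card : ℝ) ≤ 8 := by exact_mod_cast h1
    have : 0 ≤ (cq ^ 2 / κ) ^ 2 := by positivity
    linarith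

end Mesh

/-! ### Oscillation across several elements and the boundary norm -/

section Mesh

variable {Ω : Set Plane} {T : Geometry.SimplicialComplex ℝ Plane} {k : ℕ}

/-- Along a connected set, a finite element function oscillates by at most the sum of the
oscillations on the elements that cover the set. -/
theorem Represents.abs_sub_le_sum {P : PolyFamily} {v : Plane → ℝ} (hv : Represents T k P v)
    (hT : IsFittedTriangulation Ω T) {γ : Finset Plane → ℝ}
    (hγ : ∀ K ∈ hT.elems, ∀ x ∈ tri K, elementDiam K * ‖gradPoly (P K) x‖ ≤ γ K)
    {𝒦 : Finset (Finset Plane)} (h𝒦 : 𝒦 ⊆ hT.elems) {s : Set Plane} (hs : IsPreconnected s)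
    (hcov : ∀ x ∈ s, ∃ K ∈ 𝒦, x ∈ tri K) {x y : Plane} (hx : x ∈ s) (hy : y ∈ s) :
    |v x - v y| ≤ ∑ K ∈ 𝒦, γ K := by
  have hsΩ : s ⊆ closure Ω := fun z hz => by
    obtain ⟨K, hK, hzK⟩ := hcov z hz
    exact hT.tri_subset_closure (hT.mem_elems.1 (h𝒦 hK)) hzK
  have hcont : ContinuousOn v s := ((mem_feSpace_iff hT).2 ⟨P, hv⟩).1.mono hsΩ
  have hord := (hs.image v hcont).ordConnected
  have hγ0 : ∀ K ∈ 𝒦, 0 ≤ γ K := fun K hK => by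
    obtain ⟨z, hz⟩ := (hT.isTri (h𝒦 hK)).interior_nonempty
    have := (hT.isTri (h𝒦 hK)).elementDiam_pos
    exact (by positivity : 0 ≤ elementDiam K * ‖gradPoly (P K) z‖).trans
      (hγ K (h𝒦 hK) z (interior_subset hz))
  -- The image of a connected set is an interval, here covered by the images of the elements.
  -- Comparing lengths avoids arranging the elements in a chain.
  have hsub : Set.uIcc (v y) (v x) ⊆ ⋃ K ∈ 𝒦, v '' tri K := by
    refine (hord.uIcc_subset (Set.mem_image_of_mem v hy) (Set.mem_image_of_mem v hx)).trans ?_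
    rintro _ ⟨z, hz, rfl⟩
    obtain ⟨K, hK, hzK⟩ := hcov z hz
    exact Set.mem_biUnion hK (Set.mem_image_of_mem v hzK)
  have hvol : ∀ K ∈ 𝒦, volume (v '' tri K) ≤ ENNReal.ofReal (γ K) := fun K hK => by
    refine (Real.volume_le_diam _).trans (Metric.ediam_le ?_)
    rintro _ ⟨z, hz, rfl⟩ _ ⟨z', hz', rfl⟩
    have hKe := hT.mem_elems.1 (h𝒦 hK)
    rw [edist_dist, Real.dist_eq, (hv K hKe).2 z hz, (hv K hKe).2 z' hz']
    exact ENNReal.ofReal_le_ofReal ((hT.isTri (h𝒦 hK)).abs_sub_le (hγ K (h𝒦 hK)) hz hz')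
  have h1 : ENNReal.ofReal |v x - v y| ≤ ENNReal.ofReal (∑ K ∈ 𝒦, γ K) := by
    calc ENNReal.ofReal |v x - v y| = volume (Set.uIcc (v y) (v x)) := by rw [Real.volume_interval]
      _ ≤ volume (⋃ K ∈ 𝒦, v '' tri K) := measure_mono hsub
      _ ≤ ∑ K ∈ 𝒦, volume (v '' tri K) := measure_biUnion_finset_le _ _
      _ ≤ ∑ K ∈ 𝒦, ENNReal.ofReal (γ K) := Finset.sum_le_sum hvol
      _ = _ := (ENNReal.ofReal_sum_of_nonneg hγ0).symm
  exact (ENNReal.ofReal_le_ofReal_iff (Finset.sum_nonneg hγ0)).1 h1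

theorem Represents.abs_sub_le_sqrt {P : PolyFamily} {v : Plane → ℝ} (hv : Represents T k P v)
    (hT : IsFittedTriangulation Ω T) {C N : ℝ} (hC : 0 ≤ C)
    (hγ : ∀ K ∈ hT.elems, ∀ x ∈ tri K,
      elementDiam K * ‖gradPoly (P K) x‖ ≤ C * √(energy K (P K) (P K)))
    {𝒦 : Finset (Finset Plane)} (h𝒦 : 𝒦 ⊆ hT.elems) (hN : (𝒦.card : ℝ) ≤ N) {s : Set Plane}
    (hs : IsPreconnected s) (hcov : ∀ x ∈ s, ∃ K ∈ 𝒦, x ∈ tri K) {x y : Plane} (hx : x ∈ s)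
    (hy : y ∈ s) : |v x - v y| ≤ N * C * √(hT.dirichlet P) := by
  refine (hv.abs_sub_le_sum hT hγ h𝒦 hs hcov hx hy).trans ?_
  have h1 : ∀ K ∈ 𝒦, C * √(energy K (P K) (P K)) ≤ C * √(hT.dirichlet P) := fun K hK => by
    refine mul_le_mul_of_nonneg_left (Real.sqrt_le_sqrt ?_) hC
    exact Finset.single_le_sum (f := fun K => energy K (P K) (P K))
      (fun K _ => energy_self_nonneg K _) (h𝒦 hK)
  refine (Finset.sum_le_sum h1).trans ?_
  rw [Finset.sum_const, nsmul_eq_mul, mul_assoc]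
  exact mul_le_mul_of_nonneg_right hN (by positivity)

/-- The boundary norm is controlled by the values at the test simplices and the Dirichlet energy,
if there are few boundary faces without a test simplex nearby. -/
theorem IsTestFamily.mass_le {hT : IsFittedTriangulation Ω T} {G : Finset (Finset Plane)}
    {Q : Finset Plane → PolyFamily} {b c₀ M : ℝ} (h : IsTestFamily hT G Q b c₀ M) {P : PolyFamily}
    {C C' N : ℝ} (hN : 0 ≤ N) {a : Finset Plane → ℝ}
    (ha : ∀ s ∈ G, ∀ K ∈ hT.elems, s ⊆ K → ∀ x ∈ tri K,
      |polyFun (P K) x - a s| ≤ C * √(energy K (P K) (P K)))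
    {B' : Finset (Finset Plane × Plane)} (hcard : (B'.card : ℝ) ≤ N)
    (hgood : ∀ c ∈ hT.bdryPairs, c ∉ B' → ∃ s ∈ G, s ⊆ c.1)
    (hbad : ∀ c ∈ hT.bdryPairs, c ∈ B' → ∃ s ∈ G, ∀ x ∈ tri c.1,
      |polyFun (P c.1) x - a s| ≤ C' * √(hT.dirichlet P)) :
    hT.mass P ≤ (6 * M + 6 * C ^ 2 + 2 * N + 2 * N * C' ^ 2)
      * (∑ s ∈ G, a s ^ 2 + hT.dirichlet P) := by
  classical
  set S := ∑ s ∈ G, a s ^ 2 with hS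
  set D := hT.dirichlet P with hD
  have hS0 : 0 ≤ S := Finset.sum_nonneg fun _ _ => sq_nonneg _
  have hD0 : 0 ≤ D := hT.dirichlet_nonneg P
  have hsq : ∀ t a e : ℝ, |t - a| ≤ e → t ^ 2 ≤ 2 * a ^ 2 + 2 * e ^ 2 := fun t a e hte => by
    have h1 : (t - a) ^ 2 ≤ e ^ 2 := by
      rw [← sq_abs]; exact pow_le_pow_left₀ (abs_nonneg _) hte 2
    nlinarith [sq_nonneg (t - 2 * a)]
  -- The local bound on good elements. A bad one is charged the global quantities `S` and `D`
  -- instead, which is affordable because there are at most `N` of them.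
  set f : Finset Plane → ℝ := fun K => 2 * (∑ s ∈ G with s ⊆ K, a s ^ 2)
    + 2 * C ^ 2 * energy K (P K) (P K) with hf
  have hf0 : ∀ K ∈ hT.elems, 0 ≤ f K := fun K _ => by
    have := energy_self_nonneg K (P K)
    have : 0 ≤ ∑ s ∈ G with s ⊆ K, a s ^ 2 := Finset.sum_nonneg fun _ _ => sq_nonneg _
    positivity
  have hloc : ∀ c ∈ hT.bdryPairs, faceMass c (P c.1)
      ≤ f c.1 + if c ∈ B' then 2 * S + 2 * C' ^ 2 * D else 0 := by
    intro c hc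
    have hK := hT.fst_mem_elems hc
    by_cases hcB : c ∈ B'
    · obtain ⟨s, hs, hx⟩ := hbad c hc hcB
      rw [if_pos hcB]
      refine ((hT.isTri hK).faceMass_le (hT.snd_mem hc) (b := 2 * S + 2 * C' ^ 2 * D)
        fun x hxK => ?_).trans (le_add_of_nonneg_left (hf0 _ hK))
      refine (hsq _ _ _ (hx x hxK)).trans ?_
      rw [mul_pow, Real.sq_sqrt hD0]
      have : a s ^ 2 ≤ S := Finset.single_le_sum (f := fun s => a s ^ 2)
        (fun _ _ => sq_nonneg _) hs
      linarith
    · obtain ⟨s, hs, hsK⟩ := hgood c hc hcB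
      rw [if_neg hcB, add_zero]
      refine (hT.isTri hK).faceMass_le (hT.snd_mem hc) fun x hxK => ?_
      refine (hsq _ _ _ (ha s hs _ hK hsK x hxK)).trans ?_
      rw [mul_pow, Real.sq_sqrt (energy_self_nonneg _ _)]
      have : a s ^ 2 ≤ ∑ s ∈ G with s ⊆ c.1, a s ^ 2 :=
        Finset.single_le_sum (f := fun s => a s ^ 2)
          (fun _ _ => sq_nonneg _) (Finset.mem_filter.2 ⟨hs, hsK⟩)
      simp only [hf]
      linarith
  have h1 : ∑ c ∈ hT.bdryPairs, f c.1 ≤ 3 * (2 * (M * S) + 2 * C ^ 2 * D) := by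
    refine (hT.sum_bdryPairs_le hf0).trans ?_
    simp only [hf, Finset.sum_add_distrib, ← Finset.mul_sum]
    have := h.sum_elems_le (f := fun s => a s ^ 2) fun _ _ => sq_nonneg _
    rw [hD, IsFittedTriangulation.dirichlet]
    linarith
  have h2 : ∑ c ∈ hT.bdryPairs, (if c ∈ B' then 2 * S + 2 * C' ^ 2 * D else 0)
      ≤ N * (2 * S + 2 * C' ^ 2 * D) := by
    rw [← Finset.sum_filter, Finset.sum_const, nsmul_eq_mul]
    refine mul_le_mul_of_nonneg_right (le_trans ?_ hcard) (by positivity)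
    exact_mod_cast Finset.card_le_card fun c hc => (Finset.mem_filter.1 hc).2
  have h3 := Finset.sum_le_sum hloc
  rw [Finset.sum_add_distrib] at h3
  have hM : 0 ≤ M * S := by
    have := h.sum_elems_le (f := fun s => a s ^ 2) fun _ _ => sq_nonneg _
    exact (Finset.sum_nonneg fun _ _ => Finset.sum_nonneg fun _ _ => sq_nonneg _).trans this
  have h4 : hT.mass P ≤ 3 * (2 * (M * S) + 2 * C ^ 2 * D) + N * (2 * S + 2 * C' ^ 2 * D) :=
    h3.trans (add_le_add h1 h2)
  -- `M` is known to be nonnegative only if there is an element; otherwise mass and energy both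
  -- vanish.
  rcases hT.elems.eq_empty_or_nonempty with he | ⟨K, hK⟩
  · have hm : hT.mass P = 0 := by
      refine Finset.sum_eq_zero fun c hc => ?_
      have := hT.fst_mem_elems hc
      simp [he] at this
    have hD' : D = 0 := by simp [hD, IsFittedTriangulation.dirichlet, he]
    rw [hm, hD', add_zero]
    have : 0 ≤ (6 * C ^ 2 + 2 * N + 2 * N * C' ^ 2) * S := by positivity
    nlinarith
  · have hM0 : 0 ≤ M := (Nat.cast_nonneg _).trans (h.card_family K hK)
    have : 0 ≤ (6 * M + 2 * N) * D + (6 * C ^ 2 + 2 * N * C' ^ 2) * S := by positivity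
    nlinarith

theorem IsFittedTriangulation.dirichlet_smul (hT : IsFittedTriangulation Ω T) (t : ℝ)
    (Q : PolyFamily) : hT.dirichlet (t • Q) = t ^ 2 * hT.dirichlet Q := by
  simp only [IsFittedTriangulation.dirichlet, Finset.mul_sum]
  refine Finset.sum_congr rfl fun K _ => ?_
  simp only [energy, Pi.smul_apply, gradPoly_smul, inner_smul_right, real_inner_smul_left,
    ← integral_const_mul]
  congr 1
  funext x
  ring

theorem IsFittedTriangulation.mass_smul (hT : IsFittedTriangulation Ω T) (t : ℝ)
    (Q : PolyFamily) : hT.mass (t • Q) = t ^ 2 * hT.mass Q := by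
  simp only [IsFittedTriangulation.mass, Finset.mul_sum]
  refine Finset.sum_congr rfl fun c _ => ?_
  simp only [faceMass, Pi.smul_apply, polyFun_smul, mul_pow, integral_const_mul]
  ring

/-- The Nitsche form is bounded on the unit ball of the finite element space. -/
theorem IsFittedTriangulation.exists_abs_form_le (hT : IsFittedTriangulation Ω T) {C : ℝ}
    (hC : 0 ≤ C) (P : PolyFamily) : ∃ A : ℝ, ∀ Q : PolyFamily,
      (∀ K ∈ hT.elems, ∀ x ∈ tri K,
        elementDiam K * ‖gradPoly (Q K) x‖ ≤ C * √(energy K (Q K) (Q K))) →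
      hT.dirichlet Q + hT.mass Q ≤ 1 → |hT.form P Q| ≤ A := by
  choose b hb using fun K => (isCompact_tri K).exists_bound_of_continuousOn
    (continuous_polyFun (P K)).continuousOn
  -- The first two sums use that a product is at most the sum of the squares. The norm does not
  -- contain the normal derivative of `Q`, so the third one needs the inverse estimate.
  refine ⟨∑ K ∈ hT.elems, (energy K (P K) (P K) + 1)
    + ∑ c ∈ hT.bdryPairs, ((∫ x in face c.1 c.2,
        inner ℝ (gradPoly (P c.1) x) (faceNormal c.1 c.2) ^ 2 ∂arcLength) + elementDiam c.1)
    + ∑ c ∈ hT.bdryPairs, C * b c.1, fun Q hQ hQ1 => ?_⟩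
  have hd1 : hT.dirichlet Q ≤ 1 := by linarith [hT.mass_nonneg Q]
  have hm1 : hT.mass Q ≤ 1 := by linarith [hT.dirichlet_nonneg Q]
  have hE : ∀ K ∈ hT.elems, energy K (Q K) (Q K) ≤ 1 := fun K hK =>
    (Finset.single_le_sum (f := fun K => energy K (Q K) (Q K))
      (fun K _ => energy_self_nonneg K _) hK).trans hd1
  have hF : ∀ c ∈ hT.bdryPairs, faceMass c (Q c.1) ≤ 1 := fun c hc =>
    (Finset.single_le_sum (f := fun c : Finset Plane × Plane => faceMass c (Q c.1))
      (fun c _ => faceMass_nonneg c _) hc).trans hm1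
  have h1 : |∑ K ∈ hT.elems, energy K (P K) (Q K)|
      ≤ ∑ K ∈ hT.elems, (energy K (P K) (P K) + 1) := by
    refine (Finset.abs_sum_le_sum_abs _ _).trans (Finset.sum_le_sum fun K hK => ?_)
    refine le_trans ?_ (add_le_add le_rfl (hE K hK))
    have hi : ∀ r s : MvPolynomial (Fin 2) ℝ,
        IntegrableOn (fun x => inner ℝ (gradPoly r x) (gradPoly s x)) (tri K) := fun r s =>
      integrableOn_tri K ((continuous_gradPoly _).inner (continuous_gradPoly _))
    rw [energy, energy, energy, ← integral_add (hi _ _) (hi _ _)]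
    refine (abs_integral_le_integral_abs).trans
      (integral_mono (hi _ _).abs ((hi _ _).add (hi _ _)) fun x => ?_)
    simp only [real_inner_self_eq_norm_sq]
    have h2 := abs_real_inner_le_norm (gradPoly (P K) x) (gradPoly (Q K) x)
    nlinarith [sq_nonneg (‖gradPoly (P K) x‖ - ‖gradPoly (Q K) x‖),
      norm_nonneg (gradPoly (P K) x), norm_nonneg (gradPoly (Q K) x)]
  have h2 : |∑ c ∈ hT.bdryPairs, fluxForm c (P c.1) (Q c.1)|
      ≤ ∑ c ∈ hT.bdryPairs, ((∫ x in face c.1 c.2,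
        inner ℝ (gradPoly (P c.1) x) (faceNormal c.1 c.2) ^ 2 ∂arcLength) + elementDiam c.1) := by
    refine (Finset.abs_sum_le_sum_abs _ _).trans (Finset.sum_le_sum fun c hc => ?_)
    have hK := hT.isTri (hT.fst_mem_elems hc)
    have hz := hT.snd_mem hc
    have hm := hF c hc
    rw [faceMass, inv_mul_le_iff₀ hK.elementDiam_pos, mul_one] at hm
    refine le_trans ?_ (add_le_add le_rfl hm)
    have hi1 : IntegrableOn (fun x => inner ℝ (gradPoly (P c.1) x) (faceNormal c.1 c.2) ^ 2)
        (face c.1 c.2) arcLength :=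
      hK.integrableOn_face hz (((continuous_gradPoly _).inner continuous_const).pow 2)
    have hi2 : IntegrableOn (fun x => polyFun (Q c.1) x ^ 2) (face c.1 c.2) arcLength :=
      hK.integrableOn_face hz ((continuous_polyFun _).pow 2)
    rw [fluxForm, ← integral_add hi1 hi2]
    refine (abs_integral_le_integral_abs).trans
      (integral_mono (hK.integrableOn_fluxForm hz _ _).abs (hi1.add hi2) fun x => ?_)
    rw [abs_le]
    constructor <;> nlinarith [sq_nonneg (inner ℝ (gradPoly (P c.1) x) (faceNormal c.1 c.2)
      - polyFun (Q c.1) x), sq_nonneg (inner ℝ (gradPoly (P c.1) x) (faceNormal c.1 c.2)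
      + polyFun (Q c.1) x)]
  have h3 : |∑ c ∈ hT.bdryPairs, fluxForm c (Q c.1) (P c.1)|
      ≤ ∑ c ∈ hT.bdryPairs, C * b c.1 := by
    refine (Finset.abs_sum_le_sum_abs _ _).trans (Finset.sum_le_sum fun c hc => ?_)
    have hKe := hT.fst_mem_elems hc
    refine (hT.isTri hKe).abs_fluxForm_le (hT.snd_mem hc) (fun x hx => ?_) (fun x hx => hb _ x hx)
    refine (hQ _ hKe x hx).trans (mul_le_of_le_one_right hC ?_)
    rw [Real.sqrt_le_one]
    exact hE _ hKe
  rw [hT.form_apply]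
  rw [abs_le] at h1 h2 h3 ⊢
  constructor <;> linarith

/-! ### The supremum of the quotients -/

/-- The set of quotients in the inf-sup condition. -/
def quotients (Ω : Set Plane) (T : Geometry.SimplicialComplex ℝ Plane) (k : ℕ) (v : Plane → ℝ) :
    Set ℝ :=
  {r : ℝ | ∃ w ∈ feSpace Ω T k, norm1h Ω T w ≠ 0 ∧ r = nitscheForm Ω v w / norm1h Ω T w}

/-- Needed because the real `sSup` of an unbounded set is `0`. The bound may depend on `v` and on
the mesh. -/
theorem bddAbove_quotients (hT : IsFittedTriangulation Ω T) (hreg : interior (closure Ω) = Ω)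
    (hperf : Preperfect (frontier Ω)) {κ : ℝ} (hκ : 0 < κ) (hb : HasInscribedBalls κ T)
    {v : Plane → ℝ} (hv : v ∈ feSpace Ω T k) : BddAbove (quotients Ω T k v) := by
  obtain ⟨P, hP⟩ := (mem_feSpace_iff hT).1 hv
  obtain ⟨C, hC, hinv⟩ := exists_inverse_estimate k hκ
  obtain ⟨A, hA⟩ := hT.exists_abs_form_le hC.le P
  refine ⟨A, ?_⟩
  rintro r ⟨w, hw, hw0, rfl⟩
  obtain ⟨Q, hQ⟩ := (mem_feSpace_iff hT).1 hw
  have hn : 0 < norm1h Ω T w := lt_of_le_of_ne (Real.sqrt_nonneg _) hw0.symm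
  set t := (norm1h Ω T w)⁻¹ with ht
  have htQ := hQ.smul t
  have h1 : nitscheForm Ω v w / norm1h Ω T w = hT.form P (t • Q) := by
    rw [map_smul, hT.nitscheForm_eq hreg hperf hP hQ, smul_eq_mul, ht, inv_mul_eq_div]
  rw [h1]
  refine (le_abs_self _).trans (hA _ (fun K hK x hx => ?_) ?_)
  · exact hinv K (hT.isTri hK) (hb K (hT.mem_elems.1 hK)) _ (htQ K (hT.mem_elems.1 hK)).1 x hx
  · have h2 : hT.dirichlet Q + hT.mass Q = norm1h Ω T w ^ 2 := by
      rw [hT.norm1h_eq hreg hperf hQ,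
        Real.sq_sqrt (add_nonneg (hT.dirichlet_nonneg Q) (hT.mass_nonneg Q))]
    rw [hT.dirichlet_smul, hT.mass_smul, ← mul_add, h2, ht]
    field_simp
    exact le_rfl

/-- With `w` also `-w` is admissible, with the opposite quotient; the `sSup` of the empty set is
`0`. -/
theorem nonneg_sSup_quotients (hT : IsFittedTriangulation Ω T) (hreg : interior (closure Ω) = Ω)
    (hperf : Preperfect (frontier Ω)) {v : Plane → ℝ} (hv : v ∈ feSpace Ω T k)
    (hbdd : BddAbove (quotients Ω T k v)) : 0 ≤ sSup (quotients Ω T k v) := by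
  rcases (quotients Ω T k v).eq_empty_or_nonempty with he | ⟨r, w, hw, hw0, rfl⟩
  · rw [he, Real.sSup_empty]
  · obtain ⟨P, hP⟩ := (mem_feSpace_iff hT).1 hv
    obtain ⟨Q, hQ⟩ := (mem_feSpace_iff hT).1 hw
    have hQ' := hQ.smul (-1)
    have hnorm : norm1h Ω T ((-1 : ℝ) • w) = norm1h Ω T w := by
      rw [hT.norm1h_eq hreg hperf hQ, hT.norm1h_eq hreg hperf hQ', hT.dirichlet_smul,
        hT.mass_smul]
      norm_num
    have hform : nitscheForm Ω v ((-1 : ℝ) • w) = - nitscheForm Ω v w := by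
      rw [hT.nitscheForm_eq hreg hperf hP hQ, hT.nitscheForm_eq hreg hperf hP hQ', map_smul]
      simp
    have h1 : nitscheForm Ω v w / norm1h Ω T w ≤ sSup (quotients Ω T k v) :=
      le_csSup hbdd ⟨w, hw, hw0, rfl⟩
    have h2 : -(nitscheForm Ω v w / norm1h Ω T w) ≤ sSup (quotients Ω T k v) := by
      refine le_csSup hbdd ⟨(-1 : ℝ) • w, (mem_feSpace_iff hT).2 ⟨_, hQ'⟩, ?_, ?_⟩
      · rwa [hnorm]
      · rw [hnorm, hform, neg_div]
    linarith

/-- A single good test function yields the inf-sup bound. -/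
theorem le_sSup_quotients (hT : IsFittedTriangulation Ω T) (hreg : interior (closure Ω) = Ω)
    (hperf : Preperfect (frontier Ω)) {κ : ℝ} (hκ : 0 < κ) (hb : HasInscribedBalls κ T)
    {P Q : PolyFamily} {v w : Plane → ℝ} (hv : Represents T k P v) (hw : Represents T k Q w)
    {cs : ℝ} (hcs : 0 < cs) (h1 : cs * (hT.dirichlet P + hT.mass P) ≤ hT.form P Q)
    (h2 : cs * √(hT.dirichlet P + hT.mass P) * √(hT.dirichlet Q + hT.mass Q) ≤ hT.form P Q) :
    cs * norm1h Ω T v ≤ sSup (quotients Ω T k v) := by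
  have hvfe := (mem_feSpace_iff hT).2 ⟨P, hv⟩
  have hwfe := (mem_feSpace_iff hT).2 ⟨Q, hw⟩
  have hbdd := bddAbove_quotients hT hreg hperf hκ hb hvfe
  have hN0 : 0 ≤ hT.dirichlet P + hT.mass P :=
    add_nonneg (hT.dirichlet_nonneg P) (hT.mass_nonneg P)
  rcases hN0.eq_or_lt with h0 | h0
  · rw [hT.norm1h_eq hreg hperf hv, ← h0, Real.sqrt_zero, mul_zero]
    exact nonneg_sSup_quotients hT hreg hperf hvfe hbdd
  · have hpos : 0 < hT.form P Q := (mul_pos hcs h0).trans_le h1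
    have hnw : norm1h Ω T w ≠ 0 := by
      intro hz
      obtain ⟨C, hC, hinv⟩ := exists_inverse_estimate k hκ
      obtain ⟨A, hA⟩ := hT.exists_abs_form_le hC.le P
      rw [hT.norm1h_eq hreg hperf hw, Real.sqrt_eq_zero
        (add_nonneg (hT.dirichlet_nonneg Q) (hT.mass_nonneg Q))] at hz
      -- If `w` had norm zero, so would its multiple by `t`, but the form there is `|A| + 1` and
      -- exceeds the bound `A`.
      set t := (|A| + 1) / hT.form P Q with ht
      have htQ := hw.smul t
      have hd : hT.dirichlet Q = 0 := by linarith [hT.dirichlet_nonneg Q, hT.mass_nonneg Q]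
      have hm : hT.mass Q = 0 := by linarith [hT.dirichlet_nonneg Q, hT.mass_nonneg Q]
      have h5 := hA (t • Q) (fun K hK x hx => hinv K (hT.isTri hK) (hb K (hT.mem_elems.1 hK)) _
        (htQ K (hT.mem_elems.1 hK)).1 x hx) (by rw [hT.dirichlet_smul, hT.mass_smul, hd, hm]; norm_num)
      rw [map_smul, smul_eq_mul, ht, div_mul_cancel₀ _ hpos.ne'] at h5
      have := le_abs_self A
      have h6 := le_abs_self (|A| + 1)
      linarith
    have hnw0 : 0 < norm1h Ω T w := lt_of_le_of_ne (Real.sqrt_nonneg _) hnw.symm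
    refine le_trans ?_ (le_csSup hbdd ⟨w, hwfe, hnw, rfl⟩)
    rw [le_div_iff₀ hnw0, hT.nitscheForm_eq hreg hperf hv hw, hT.norm1h_eq hreg hperf hv,
      hT.norm1h_eq hreg hperf hw]
    exact h2

end Mesh

/-! ### Local structure of the polygonal boundary -/

/-- A connected set that meets a set and its complement meets the frontier. -/
theorem IsPreconnected.exists_mem_frontier {t s : Set Plane} (ht : IsPreconnected t)
    (h1 : (t ∩ s).Nonempty) (h2 : (t ∩ sᶜ).Nonempty) : (t ∩ frontier s).Nonempty := by
  by_contra hne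
  rw [Set.not_nonempty_iff_eq_empty] at hne
  have hnf : ∀ x ∈ t, x ∉ frontier s := fun x hx hxf =>
    Set.notMem_empty x (hne ▸ (⟨hx, hxf⟩ : x ∈ t ∩ frontier s))
  obtain ⟨x, hx, hxs⟩ := h1
  obtain ⟨y, hy, hys⟩ := h2
  obtain ⟨z, -, hz1, hz2⟩ := ht (interior s) (closure s)ᶜ isOpen_interior
    isClosed_closure.isOpen_compl
    (fun z hz => by
      by_cases h : z ∈ closure s
      · exact Or.inl (by_contra fun hi => hnf z hz ⟨h, hi⟩)
      · exact Or.inr h)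
    ⟨x, hx, by_contra fun hi => hnf x hx ⟨subset_closure hxs, hi⟩⟩
    ⟨y, hy, fun h => hnf y hy ⟨h, fun hi => hys (interior_subset hi)⟩⟩
  exact hz2 (subset_closure (interior_subset hz1))

section Domain

variable {Ω : Set Plane} {m : ℕ} {a b : Fin m → Plane}

theorem segment_subset_frontier (hΩ : IsPolygonalDomain Ω a b) (i : Fin m) :
    segment ℝ (a i) (b i) ⊆ frontier Ω := by
  rw [hΩ.frontier_eq]
  exact Set.subset_iUnion (fun i => segment ℝ (a i) (b i)) i

theorem isClosed_segment (x y : Plane) : IsClosed (segment ℝ x y) := by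
  rw [← convexHull_pair]
  exact ((Set.toFinite _).isCompact_convexHull ℝ).isClosed

/-- Each boundary point lies on a nondegenerate segment of the boundary. -/
theorem IsPolygonalDomain.preperfect (hΩ : IsPolygonalDomain Ω a b) : Preperfect (frontier Ω) := by
  intro x hx
  rw [hΩ.frontier_eq] at hx
  obtain ⟨i, hi⟩ := Set.mem_iUnion.1 hx
  have h1 : Preperfect (segment ℝ (a i) (b i)) :=
    (convex_segment (𝕜 := ℝ) (a i) (b i)).isPreconnected.preperfect_of_nontrivial
      ⟨a i, left_mem_segment ℝ _ _, b i, right_mem_segment ℝ _ _, hΩ.ne i⟩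
  exact (h1 x hi).mono (Filter.principal_mono.2 (segment_subset_frontier hΩ i))

theorem mem_segment_iff_exists {x y z : Plane} :
    z ∈ segment ℝ x y ↔ ∃ t : ℝ, 0 ≤ t ∧ t ≤ 1 ∧ z = x + t • (y - x) := by
  rw [segment_eq_image']
  constructor
  · rintro ⟨t, ⟨h0, h1⟩, rfl⟩; exact ⟨t, h0, h1, rfl⟩
  · rintro ⟨t, h0, h1, rfl⟩; exact ⟨t, ⟨h0, h1⟩, rfl⟩

/-- Near each of its points, the boundary consists of at most two rays. -/
theorem IsPolygonalDomain.exists_rays (hΩ : IsPolygonalDomain Ω a b) {A : Plane}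
    (hA : A ∈ frontier Ω) : ∃ u w : Plane, ∀ᶠ y in 𝓝 A, y ∈ frontier Ω →
      (∃ t : ℝ, 0 ≤ t ∧ y = A + t • u) ∨ ∃ t : ℝ, 0 ≤ t ∧ y = A + t • w := by
  suffices h : ∃ u w : Plane, ∀ l, A ∈ segment ℝ (a l) (b l) → ∀ y ∈ segment ℝ (a l) (b l),
      (∃ t : ℝ, 0 ≤ t ∧ y = A + t • u) ∨ ∃ t : ℝ, 0 ≤ t ∧ y = A + t • w by
    obtain ⟨u, w, h⟩ := h
    refine ⟨u, w, ?_⟩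
    have h1 : ∀ l, ∀ᶠ y in 𝓝 A, y ∈ segment ℝ (a l) (b l) → A ∈ segment ℝ (a l) (b l) := by
      intro l
      by_cases hl : A ∈ segment ℝ (a l) (b l)
      · exact Filter.Eventually.of_forall fun _ _ => hl
      · filter_upwards [(isClosed_segment (a l) (b l)).isOpen_compl.mem_nhds hl] with y hy hy'
        exact absurd hy' hy
    filter_upwards [Filter.eventually_all.2 h1] with y hy hyf
    rw [hΩ.frontier_eq] at hyf
    obtain ⟨l, hl⟩ := Set.mem_iUnion.1 hyf
    exact h l (hy l hl) y hl
  have hend : ∀ l, (A = a l ∨ A = b l) → ∃ o, ∀ y ∈ segment ℝ (a l) (b l),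
      ∃ t : ℝ, 0 ≤ t ∧ y = A + t • o := by
    rintro l (rfl | rfl)
    · refine ⟨b l - a l, fun y hy => ?_⟩
      obtain ⟨t, h0, -, h⟩ := mem_segment_iff_exists.1 hy
      exact ⟨t, h0, h⟩
    · refine ⟨a l - b l, fun y hy => ?_⟩
      rw [segment_symm] at hy
      obtain ⟨t, h0, -, h⟩ := mem_segment_iff_exists.1 hy
      exact ⟨t, h0, h⟩
  have hA' := hA
  rw [hΩ.frontier_eq] at hA'
  obtain ⟨i, hi⟩ := Set.mem_iUnion.1 hA'
  by_cases hiA : A = a i ∨ A = b i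
  · obtain ⟨j, -, hj⟩ : ∃! j, j ≠ i ∧ (A = a j ∨ A = b j) := by
      rcases hiA with h | h
      · simpa only [← h] using hΩ.left_shared i
      · simpa only [← h] using hΩ.right_shared i
    by_cases hjA : A = a j ∨ A = b j
    · obtain ⟨u, hu⟩ := hend i hiA
      obtain ⟨w, hw⟩ := hend j hjA
      refine ⟨u, w, fun l hl y hy => ?_⟩
      by_cases hli : l = i
      · subst hli; exact Or.inl (hu y hy)
      · have h1 := (hΩ.inter l i hli ⟨hl, hi⟩).1
        have h2 : l = j := hj l ⟨hli, by simpa using h1⟩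
        subst h2; exact Or.inr (hw y hy)
    · obtain ⟨u, hu⟩ := hend i hiA
      refine ⟨u, u, fun l hl y hy => ?_⟩
      by_cases hli : l = i
      · subst hli; exact Or.inl (hu y hy)
      · have h1 := (hΩ.inter l i hli ⟨hl, hi⟩).1
        have h2 : l = j := hj l ⟨hli, by simpa using h1⟩
        subst h2; exact absurd (by simpa using h1) hjA
  -- `A` is an inner point of the side `i`, hence on no other side; the rays point to the two ends
  -- of the side.
  · refine ⟨a i - A, b i - A, fun l hl y hy => ?_⟩
    have hli : l = i := by
      by_contra hli
      exact hiA (by simpa using (hΩ.inter l i hli ⟨hl, hi⟩).2)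
    subst hli
    obtain ⟨t, ht0, ht1, hAt⟩ := mem_segment_iff_exists.1 hl
    obtain ⟨s, hs0, hs1, hys⟩ := mem_segment_iff_exists.1 hy
    have ht0' : 0 < t := by
      refine lt_of_le_of_ne ht0 fun h => hiA (Or.inl ?_)
      rw [hAt, ← h]; simp
    have ht1' : t < 1 := by
      refine lt_of_le_of_ne ht1 fun h => hiA (Or.inr ?_)
      rw [hAt, h]; simp
    have hy' : y = A + (s - t) • (b l - a l) := by rw [hys, hAt]; module
    rcases le_total s t with hst | hst
    · refine Or.inl ⟨(t - s) / t, div_nonneg (by linarith) ht0, ?_⟩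
      have h1 : a l - A = (-t) • (b l - a l) := by rw [hAt]; module
      rw [hy', h1, smul_smul]
      congr 2
      field_simp
      ring
    · refine Or.inr ⟨(s - t) / (1 - t), div_nonneg (by linarith) (by linarith), ?_⟩
      have h1 : b l - A = (1 - t) • (b l - a l) := by rw [hAt]; module
      rw [hy', h1, smul_smul]
      congr 2
      have : 1 - t ≠ 0 := by linarith
      field_simp

end Domain

/-! ### Ears, interior vertices and interior edges -/

section Mesh

variable {Ω : Set Plane} {T : Geometry.SimplicialComplex ℝ Plane} {m : ℕ} {a b : Fin m → Plane}
  {K : Finset Plane} {k : ℕ}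

theorem IsPolygonalDomain.notMem_of_frontier (hΩ : IsPolygonalDomain Ω a b) {x : Plane}
    (hx : x ∈ frontier Ω) : x ∉ Ω := by
  have := hx.2
  rwa [hΩ.isOpen.interior_eq] at this

theorem mem_face_of_mem {q p : Plane} (hq : q ∈ K) (hqp : q ≠ p) : q ∈ face K p :=
  subset_convexHull ℝ _ (by simpa using ⟨hq, hqp⟩)

/-- If the domain is not just one triangle, no element has all its faces on the boundary. -/
theorem exists_notMem_bdryPairs (hΩ : IsPolygonalDomain Ω a b) (hT : IsFittedTriangulation Ω T)
    (h5 : ∀ i, 5 ≤ (facesIn T (segment ℝ (a i) (b i))).ncard) (hK : K ∈ hT.elems) :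
    ∃ p ∈ K, (K, p) ∉ hT.bdryPairs := by
  by_contra hcon
  push Not at hcon
  have hKe := hT.mem_elems.1 hK
  have hKt := hT.isTri hK
  -- The connected set `Ω` then cannot leave `K`, so `K` is the only element. The mesh has just
  -- three edges, fewer than the five required on one side.
  have hfr : frontier (tri K) ⊆ frontier Ω := by
    intro x hx
    have hxK : x ∈ tri K := (isClosed_tri K).frontier_subset hx
    obtain ⟨p, hp, hp0⟩ : ∃ p ∈ K, bary K p x = 0 := by
      by_contra hne
      push Not at hne
      refine hx.2 (hKt.mem_interior_tri_iff.2 fun p hp => ?_)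
      exact lt_of_le_of_ne (hKt.bary_nonneg hxK p) (hne p hp).symm
    exact hT.face_subset_frontier (hcon p hp) (hKt.mem_face_of_bary_eq_zero hxK hp0)
  have hsub : Ω ⊆ tri K := by
    by_contra hns
    obtain ⟨y, hy, hyK⟩ := Set.not_subset.1 hns
    obtain ⟨x, hx⟩ := hKt.interior_nonempty
    have hxΩ : x ∈ Ω := by
      rw [← hΩ.regular]
      exact interior_mono (hT.tri_subset_closure hKe) hx
    obtain ⟨z, hz, hzf⟩ := hΩ.isConnected.isPreconnected.exists_mem_frontier
      ⟨x, hxΩ, interior_subset hx⟩ ⟨y, hy, hyK⟩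
    exact hΩ.notMem_of_frontier (hfr hzf) hz
  have hcl : closure Ω ⊆ tri K := closure_minimal hsub (isClosed_tri K)
  have huniq : ∀ K' ∈ elements T, K' = K := by
    intro K' hK'
    obtain ⟨x, hx⟩ := (isTri_of_mem_elements hK').interior_nonempty
    exact (eq_of_mem_interior hK' hKe hx
      (hcl (hT.tri_subset_closure hK' (interior_subset hx)))).symm
  obtain ⟨p, hp⟩ : K.Nonempty := Finset.card_pos.1 (by rw [hKt.card]; norm_num)
  obtain ⟨x, hx⟩ : (face K p).Nonempty := by
    obtain ⟨q, r, -, -, h⟩ := hKt.exists_face_eq_segment hp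
    rw [h]; exact ⟨q, left_mem_segment ℝ _ _⟩
  have hxf := hT.face_subset_frontier (hcon p hp) hx
  rw [hΩ.frontier_eq] at hxf
  obtain ⟨i, -⟩ := Set.mem_iUnion.1 hxf
  have h1 : facesIn T (segment ℝ (a i) (b i)) ⊆ (K.powersetCard 2 : Set (Finset Plane)) := by
    rintro e ⟨he, hc, -⟩
    obtain ⟨K', hK', heK'⟩ := hT.pure e he
    rw [huniq K' hK'] at heK'
    exact Finset.mem_coe.2 (Finset.mem_powersetCard.2 ⟨heK', hc⟩)
  have h2 := Set.ncard_le_ncard h1 (Finset.finite_toSet _)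
  rw [Set.ncard_coe_finset, Finset.card_powersetCard, hKt.card] at h2
  have := h5 i
  have h3 : Nat.choose 3 2 = 3 := rfl
  omega

/-- A connected set that meets the domain and its complement meets the boundary. -/
theorem exists_mem_frontier_of_segments {x y z : Plane} (hx : x ∈ Ω) (hy : y ∉ Ω) :
    ∃ t ∈ segment ℝ x z ∪ segment ℝ z y, t ∈ frontier Ω := by
  have h1 : IsPreconnected (segment ℝ x z ∪ segment ℝ z y) :=
    (convex_segment (𝕜 := ℝ) x z).isPreconnected.union z (right_mem_segment ℝ _ _)
      (left_mem_segment ℝ _ _) (convex_segment (𝕜 := ℝ) z y).isPreconnected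
  obtain ⟨t, ht, htf⟩ := h1.exists_mem_frontier
    ⟨x, Or.inl (left_mem_segment ℝ _ _), hx⟩ ⟨y, Or.inr (right_mem_segment ℝ _ _), hy⟩
  exact ⟨t, ht, htf⟩

theorem bary_smul_add (K : Finset Plane) (p A B : Plane) (t : ℝ) :
    bary K p (A + t • (B - A)) = (1 - t) * bary K p A + t * bary K p B := by
  rw [bary_add, inner_smul_right, ← bary_sub]
  ring

/-- The only element at a vertex between two boundary faces of the same element. -/
theorem eq_of_mem_of_two_faces (hΩ : IsPolygonalDomain Ω a b) (hT : IsFittedTriangulation Ω T)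
    (hK : K ∈ hT.elems) {A B C : Plane} (hKeq : K = {A, B, C}) (hAB : A ≠ B) (hAC : A ≠ C)
    (hBC : B ≠ C) (hB : (K, B) ∈ hT.bdryPairs) (hC : (K, C) ∈ hT.bdryPairs)
    {K' : Finset Plane} (hK' : K' ∈ hT.elems) (hA' : A ∈ K') : K' = K := by
  have hKe := hT.mem_elems.1 hK
  have hKt := hT.isTri hK
  have hAK : A ∈ K := by simp [hKeq]
  have hBK : B ∈ K := by simp [hKeq]
  have hCK : C ∈ K := by simp [hKeq]
  have hfAB : segment ℝ A B ⊆ frontier Ω := by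
    refine Set.Subset.trans ?_ (hT.face_subset_frontier hC)
    exact (convex_convexHull ℝ _).segment_subset (mem_face_of_mem hAK hAC)
      (mem_face_of_mem hBK hBC)
  have hfAC : segment ℝ A C ⊆ frontier Ω := by
    refine Set.Subset.trans ?_ (hT.face_subset_frontier hB)
    exact (convex_convexHull ℝ _).segment_subset (mem_face_of_mem hAK hAB)
      (mem_face_of_mem hCK hBC.symm)
  have hAf : A ∈ frontier Ω := hfAB (left_mem_segment ℝ _ _)
  have hBA0 : bary K B A = 0 := hKt.bary_of_ne hAK hAB
  have hCA0 : bary K C A = 0 := hKt.bary_of_ne hAK hAC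
  have hBC0 : bary K B C = 0 := hKt.bary_of_ne hCK hBC.symm
  have hCB0 : bary K C B = 0 := hKt.bary_of_ne hBK hBC
  have hBB := hKt.bary_self hBK
  have hCC := hKt.bary_self hCK
  -- near `A`, the boundary lies in the cone of `K`
  have hcone : ∀ᶠ y in 𝓝 A, y ∈ frontier Ω → 0 ≤ bary K B y ∧ 0 ≤ bary K C y := by
    obtain ⟨u, w, huw⟩ := hΩ.exists_rays hAf
    -- Both boundary faces at `A` run along the rays. They cannot share a ray, as `A`, `B`, `C` are
    -- not collinear, so the rays are exactly the edges of the cone.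
    have hdir : ∀ X : Plane, X ≠ A → segment ℝ A X ⊆ frontier Ω →
        ∃ σ : ℝ, 0 < σ ∧ (X - A = σ • u ∨ X - A = σ • w) := by
      intro X hX hsegX
      have ht : Filter.Tendsto (fun t : ℝ => A + t • (X - A)) (𝓝[>] 0) (𝓝 A) := by
        have : Continuous fun t : ℝ => A + t • (X - A) := by fun_prop
        have h0 := this.tendsto 0
        rw [zero_smul, add_zero] at h0
        exact h0.mono_left nhdsWithin_le_nhds
      obtain ⟨t, ht1, ht0, ht⟩ := ((ht.eventually huw).and (Ioo_mem_nhdsGT one_pos)).exists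
      have hpos : ∀ e : Plane, (∃ s : ℝ, 0 ≤ s ∧ A + t • (X - A) = A + s • e) →
          ∃ σ : ℝ, 0 < σ ∧ X - A = σ • e := by
        rintro e ⟨s, hs, hse⟩
        have h1 : t • (X - A) = s • e := add_left_cancel hse
        have h2 : X - A = (s / t) • e := by
          rw [div_eq_inv_mul, mul_smul, ← h1, smul_smul, inv_mul_cancel₀ ht0.ne', one_smul]
        refine ⟨s / t, div_pos (lt_of_le_of_ne hs fun h0 => hX ?_) ht0, h2⟩
        rw [← h0, zero_div, zero_smul, sub_eq_zero] at h2
        exact h2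
      rcases ht1 (hsegX (mem_segment_iff_exists.2 ⟨t, ht0.le, ht.le, rfl⟩)) with h | h
      · obtain ⟨σ, h0, h1⟩ := hpos u h; exact ⟨σ, h0, Or.inl h1⟩
      · obtain ⟨σ, h0, h1⟩ := hpos w h; exact ⟨σ, h0, Or.inr h1⟩
    obtain ⟨σ, hσ, hσB⟩ := hdir B hAB.symm hfAB
    obtain ⟨τ, hτ, hτC⟩ := hdir C hAC.symm hfAC
    have hpar : ∀ e : Plane, B - A = σ • e → C - A = τ • e → False := by
      intro e h1 h2
      have h3 : C = A + (τ / σ) • (B - A) := by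
        rw [h1, smul_smul, div_mul_cancel₀ _ hσ.ne', ← h2]; abel
      have h4 := bary_smul_add K B A B (τ / σ)
      rw [← h3, hBC0, hBA0, hBB, mul_zero, zero_add, mul_one] at h4
      exact (div_pos hτ hσ).ne h4
    have hB' : ∀ e : Plane, B - A = σ • e → ∀ t : ℝ, 0 ≤ t →
        0 ≤ bary K B (A + t • e) ∧ 0 ≤ bary K C (A + t • e) := by
      intro e he t ht
      have h1 : A + t • e = A + (t / σ) • (B - A) := by
        rw [he, smul_smul, div_mul_cancel₀ _ hσ.ne']
      rw [h1, bary_smul_add, bary_smul_add, hBA0, hBB, hCA0, hCB0]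
      have : 0 ≤ t / σ := by positivity
      constructor <;> linarith
    have hC' : ∀ e : Plane, C - A = τ • e → ∀ t : ℝ, 0 ≤ t →
        0 ≤ bary K B (A + t • e) ∧ 0 ≤ bary K C (A + t • e) := by
      intro e he t ht
      have h1 : A + t • e = A + (t / τ) • (C - A) := by
        rw [he, smul_smul, div_mul_cancel₀ _ hτ.ne']
      rw [h1, bary_smul_add, bary_smul_add, hBA0, hBC0, hCA0, hCC]
      have : 0 ≤ t / τ := by positivity
      constructor <;> linarith
    filter_upwards [huw] with y hy hyf
    rcases hσB with hσB | hσB <;> rcases hτC with hτC | hτC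
    · exact (hpar u hσB hτC).elim
    · rcases hy hyf with ⟨t, ht, rfl⟩ | ⟨t, ht, rfl⟩
      · exact hB' u hσB t ht
      · exact hC' w hτC t ht
    · rcases hy hyf with ⟨t, ht, rfl⟩ | ⟨t, ht, rfl⟩
      · exact hC' u hτC t ht
      · exact hB' w hσB t ht
    · exact (hpar w hσB hτC).elim
  have hApos : ∀ᶠ y in 𝓝 A, 0 < bary K A y :=
    (continuous_bary K A).continuousAt.eventually
      (lt_mem_nhds (by rw [hKt.bary_self hAK]; exact one_pos))
  obtain ⟨r, hr, hball⟩ := Metric.eventually_nhds_iff_ball.1 (hcone.and hApos)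
  have hnotin : ∀ y ∈ Metric.ball A r, y ∉ tri K → bary K B y < 0 ∨ bary K C y < 0 := by
    intro y hy hyK
    by_contra hcon
    push Not at hcon
    refine hyK (hKt.mem_tri_iff.2 fun p hp => ?_)
    have hp' : p = A ∨ p = B ∨ p = C := by simpa [hKeq] using hp
    rcases hp' with rfl | rfl | rfl
    · exact (hball y hy).2.le
    · exact hcon.1
    · exact hcon.2
  -- a point near `A` on the opposite side of the cone
  obtain ⟨z, hzball, hzB, hzC⟩ : ∃ z ∈ Metric.ball A r, bary K B z < 0 ∧ bary K C z < 0 := by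
    have ht : Filter.Tendsto (fun t : ℝ => A + t • (A - B + (A - C))) (𝓝[>] 0) (𝓝 A) := by
      have : Continuous fun t : ℝ => A + t • (A - B + (A - C)) := by fun_prop
      have h0 := this.tendsto 0
      rw [zero_smul, add_zero] at h0
      exact h0.mono_left nhdsWithin_le_nhds
    obtain ⟨t, ht1, ht0⟩ := ((ht.eventually (Metric.ball_mem_nhds A hr)).and
      self_mem_nhdsWithin).exists
    have ht0 : 0 < t := ht0
    refine ⟨_, ht1, ?_, ?_⟩
    · rw [bary_add, inner_smul_right, inner_add_right, ← bary_sub, ← bary_sub, hBA0, hBB, hBC0]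
      linarith
    · rw [bary_add, inner_smul_right, inner_add_right, ← bary_sub, ← bary_sub, hCA0, hCB0, hCC]
      linarith
  -- A coordinate that is negative at `y` is negative at `z` as well, hence on the whole segment,
  -- which therefore misses the cone.
  have havoid : ∀ y ∈ Metric.ball A r, y ∉ tri K → ∀ t ∈ segment ℝ y z, t ∉ frontier Ω := by
    intro y hy hyK t ht htf
    have htb : t ∈ Metric.ball A r := (convex_ball A r).segment_subset hy hzball ht
    have hneg : ∀ p, Convex ℝ {q | bary K p q < 0} := fun p =>
      (convex_Iio (0 : ℝ)).affine_preimage (bary K p)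
    have h1 := (hball t htb).1 htf
    rcases hnotin y hy hyK with h | h
    · exact absurd ((hneg B).segment_subset h hzB ht) (not_lt.2 h1.1)
    · exact absurd ((hneg C).segment_subset h hzC ht) (not_lt.2 h1.2)
  -- A second element at `A` would give a point of `Ω` outside the cone; joined through `z` to a
  -- point outside the closure, it would force a boundary point outside the cone.
  by_contra hne
  -- a point of `Ω` near `A` outside `K`
  obtain ⟨x, hxball, hxi⟩ : ∃ x ∈ Metric.ball A r, x ∈ interior (tri K') := by
    have hcl : A ∈ closure (interior (tri K')) := by
      rw [(convex_tri K').closure_interior_eq_closure_of_nonempty_interior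
        (hT.isTri hK').interior_nonempty]
      exact subset_closure (mem_tri_of_mem hA')
    obtain ⟨x, hx, hxr⟩ := Metric.mem_closure_iff.1 hcl r hr
    exact ⟨x, by rwa [Metric.mem_ball, dist_comm], hx⟩
  have hxK : x ∉ tri K := fun h =>
    hne (eq_of_mem_interior (hT.mem_elems.1 hK') hKe hxi h).symm
  have hxΩ : x ∈ Ω := by
    rw [← hΩ.regular]
    exact interior_mono (hT.tri_subset_closure (hT.mem_elems.1 hK')) hxi
  -- a point near `A` outside the closure of `Ω`
  obtain ⟨y, hyball, hycl⟩ : ∃ y ∈ Metric.ball A r, y ∉ closure Ω := by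
    by_contra hcon
    push Not at hcon
    refine hΩ.notMem_of_frontier hAf ?_
    rw [← hΩ.regular, mem_interior_iff_mem_nhds]
    exact Filter.mem_of_superset (Metric.ball_mem_nhds A hr) hcon
  have hyK : y ∉ tri K := fun h => hycl (hT.tri_subset_closure hKe h)
  obtain ⟨t, ht, htf⟩ := exists_mem_frontier_of_segments (z := z) hxΩ
    (fun h => hycl (subset_closure h))
  rcases ht with ht | ht
  · exact havoid x hxball hxK t ht htf
  · rw [segment_symm] at ht
    exact havoid y hyball hyK t ht htf

/-- An element with two boundary faces has an ear vertex. -/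
theorem exists_isEar (hΩ : IsPolygonalDomain Ω a b) (hT : IsFittedTriangulation Ω T)
    (h5 : ∀ i, 5 ≤ (facesIn T (segment ℝ (a i) (b i))).ncard) {B C : Plane} (hBC : B ≠ C)
    (hB : (K, B) ∈ hT.bdryPairs) (hC : (K, C) ∈ hT.bdryPairs) : ∃ A ∈ K, hT.IsEar A := by
  have hK : K ∈ hT.elems := hT.fst_mem_elems hB
  have hBK : B ∈ K := hT.snd_mem hB
  have hCK : C ∈ K := hT.snd_mem hC
  obtain ⟨A, hA, hAnot⟩ := exists_notMem_bdryPairs hΩ hT h5 hK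
  have hAB : A ≠ B := by rintro rfl; exact hAnot hB
  have hAC : A ≠ C := by rintro rfl; exact hAnot hC
  have hKeq : K = {A, B, C} := by
    symm
    refine Finset.eq_of_subset_of_card_le (fun q hq => ?_) ?_
    · simp only [Finset.mem_insert, Finset.mem_singleton] at hq
      rcases hq with rfl | rfl | rfl <;> assumption
    · rw [(hT.isTri hK).card, Finset.card_eq_three.2 ⟨A, B, C, hAB, hAC, hBC, rfl⟩]
  refine ⟨A, hA, K, hK, hA, fun K' hK' hA' =>
    eq_of_mem_of_two_faces hΩ hT hK hKeq hAB hAC hBC hB hC hK' hA', hAnot, fun p hp hpA => ?_⟩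
  have hp' : p = A ∨ p = B ∨ p = C := by rw [hKeq] at hp; simpa using hp
  rcases hp' with rfl | rfl | rfl
  · exact absurd rfl hpA
  · exact hB
  · exact hC

theorem singleton_ear_mem (hT : IsFittedTriangulation Ω T) (hk : 1 ≤ k) (hK : K ∈ hT.elems)
    {A : Plane} (hA : A ∈ K) (h : hT.IsEar A) : {A} ∈ hT.testSimplices k :=
  hT.mem_testSimplices.2 ⟨⟨K, hK, by simpa using hA⟩, by simp, by simpa using hk, by simp,
    Or.inr ⟨A, rfl, h⟩⟩

theorem singleton_inner_mem (hΩ : IsPolygonalDomain Ω a b) (hT : IsFittedTriangulation Ω T)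
    (hk : 1 ≤ k) {c : Finset Plane × Plane} (hc : c ∈ hT.bdryPairs) {x : Plane} (hx : x ∈ c.1)
    (hxΩ : x ∈ Ω) : {x} ∈ hT.testSimplices k := by
  refine hT.mem_testSimplices.2 ⟨⟨c.1, hT.fst_mem_elems hc, by simpa using hx⟩, by simp,
    by simpa using hk, by simp, Or.inl ⟨⟨c, hc, by simpa using hx⟩, fun d hd hsub => ?_⟩⟩
  have h1 : x ∈ d.1.erase d.2 := hsub (Finset.mem_singleton_self x)
  exact hΩ.notMem_of_frontier (hT.face_subset_frontier hd (subset_convexHull ℝ _ h1)) hxΩ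

/-- In the case of at least quadratic elements, every element with a boundary face contains an
interior face. -/
theorem exists_edge_mem (hΩ : IsPolygonalDomain Ω a b) (hT : IsFittedTriangulation Ω T)
    (h5 : ∀ i, 5 ≤ (facesIn T (segment ℝ (a i) (b i))).ncard) (hk : 2 ≤ k)
    {c : Finset Plane × Plane} (hc : c ∈ hT.bdryPairs) :
    ∃ s ∈ hT.testSimplices k, s ⊆ c.1 := by
  have hK := hT.fst_mem_elems hc
  have hKt := hT.isTri hK
  obtain ⟨q, hq, hqnot⟩ := exists_notMem_bdryPairs hΩ hT h5 hK
  have hcard := hKt.erase_card hq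
  refine ⟨c.1.erase q, hT.mem_testSimplices.2 ⟨⟨c.1, hK, Finset.erase_subset _ _⟩,
    Finset.card_pos.1 (by rw [hcard]; norm_num), by rw [hcard]; exact hk, hcard.le,
    Or.inl ⟨⟨c, hc, Finset.erase_subset _ _⟩, fun d hd hsub => hqnot ?_⟩⟩, Finset.erase_subset _ _⟩
  obtain ⟨h1, h2, h3⟩ := hT.mem_bdryPairs.1 hd
  have heq : c.1.erase q = d.1.erase d.2 :=
    Finset.eq_of_subset_of_card_le hsub (by rw [hcard, h3.2.1])
  exact hT.mem_bdryPairs.2 ⟨hT.mem_elems.1 hK, hq, by simpa only [heq] using h3⟩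

theorem exists_erase_eq {e : Finset Plane} (hT : IsFittedTriangulation Ω T) (hK : K ∈ hT.elems)
    (he : e ∈ facesIn T (frontier Ω)) (heK : e ⊆ K) :
    ∃ p ∈ K, e = K.erase p ∧ (K, p) ∈ hT.bdryPairs := by
  obtain ⟨p, hp, hpe⟩ : ∃ p ∈ K, p ∉ e := by
    refine Finset.exists_mem_notMem_of_card_lt_card ?_
    rw [he.2.1, (hT.isTri hK).card]; norm_num
  have heq : e = K.erase p := by
    refine Finset.eq_of_subset_of_card_le (fun q hq => Finset.mem_erase.2 ⟨?_, heK hq⟩) ?_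
    · rintro rfl; exact hpe hq
    · rw [(hT.isTri hK).erase_card hp, he.2.1]
  exact ⟨p, hp, heq, hT.mem_bdryPairs.2 ⟨hT.mem_elems.1 hK, hp, by simpa only [← heq] using he⟩⟩

/-- A vertex in `Ω` is an inner simplex, and two boundary faces produce an ear. -/
theorem ResolvesBoundary.exists_testSimplex (h : ResolvesBoundary Ω T)
    (hΩ : IsPolygonalDomain Ω a b) (hT : IsFittedTriangulation Ω T)
    (h5 : ∀ i, 5 ≤ (facesIn T (segment ℝ (a i) (b i))).ncard) (hk : 1 ≤ k) :
    ∃ s, s ∈ hT.testSimplices k := by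
  obtain ⟨K, hK, e, he, heK, h | h⟩ := h
  · obtain ⟨x, hxK, hxΩ⟩ := h
    obtain ⟨p, hp, -, hc⟩ := exists_erase_eq hT (hT.mem_elems.2 hK) he heK
    exact ⟨{x}, singleton_inner_mem hΩ hT hk hc hxK hxΩ⟩
  · obtain ⟨e', he', heK', hne⟩ := h
    obtain ⟨p, hp, hep, hc⟩ := exists_erase_eq hT (hT.mem_elems.2 hK) he heK
    obtain ⟨p', hp', hep', hc'⟩ := exists_erase_eq hT (hT.mem_elems.2 hK) he' heK'
    have hpp : p ≠ p' := by rintro rfl; exact hne (hep'.trans hep.symm)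
    obtain ⟨A, hA, hear⟩ := exists_isEar hΩ hT h5 hpp hc hc'
    exact ⟨{A}, singleton_ear_mem hT hk (hT.mem_elems.2 hK) hA hear⟩

end Mesh

/-! ### Separation of the sides of the polygon -/

/-- A subset of a line, given by its normal, is collinear. -/
theorem collinear_of_inner_eq_zero {s : Set Plane} {g p : Plane} (hg : g ≠ 0)
    (h : ∀ x ∈ s, inner ℝ g (x - p) = 0) : Collinear ℝ s := by
  refine collinear_iff_exists_forall_eq_smul_vadd (k := ℝ) s |>.2 ⟨p, !₂[-g 1, g 0], fun x hx => ?_⟩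
  have h1 := h x hx
  simp only [PiLp.inner_apply, Fin.sum_univ_two, PiLp.sub_apply, RCLike.inner_apply, conj_trivial]
    at h1
  have hN : g 0 ^ 2 + g 1 ^ 2 ≠ 0 := by
    intro h0
    refine hg ?_
    ext i
    fin_cases i
    · simpa using (by nlinarith [sq_nonneg (g 0), sq_nonneg (g 1)] : g 0 ^ 2 = 0)
    · simpa using (by nlinarith [sq_nonneg (g 0), sq_nonneg (g 1)] : g 1 ^ 2 = 0)
  refine ⟨(g 0 * (x 1 - p 1) - g 1 * (x 0 - p 0)) / (g 0 ^ 2 + g 1 ^ 2), ?_⟩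
  ext i
  fin_cases i
  · simp only [Fin.zero_eta, vadd_eq_add, PiLp.add_apply, PiLp.smul_apply, smul_eq_mul,
      Matrix.cons_val_zero]
    field_simp
    linear_combination g 0 * h1
  · simp only [Fin.mk_one, vadd_eq_add, PiLp.add_apply, PiLp.smul_apply, smul_eq_mul,
      Matrix.cons_val_one, Matrix.cons_val_fin_one]
    field_simp
    linear_combination g 1 * h1

/-- Two segments with a common end point that are not collinear diverge linearly. -/
theorem exists_dist_le_mul_dist {p e f : Plane} (h : ¬ Collinear ℝ {p, e, f}) :
    ∃ C : ℝ, ∀ x ∈ segment ℝ p e, ∀ y ∈ segment ℝ p f, dist x p ≤ C * dist x y := by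
  have hfp : f ≠ p := by
    rintro rfl
    refine h ?_
    have : ({f, e, f} : Set Plane) = {f, e} := by ext; simp; tauto
    rw [this]
    exact collinear_pair ℝ f e
  -- A normal of the second segment: the inner product with `g` ignores `y` and grows linearly with
  -- the distance of `x` from `p`.
  set g : Plane := !₂[(f - p) 1, -(f - p) 0] with hgdef
  have hgf : inner ℝ g (f - p) = 0 := by
    simp only [hgdef, PiLp.inner_apply, Fin.sum_univ_two, RCLike.inner_apply, conj_trivial,
      Matrix.cons_val_zero, Matrix.cons_val_one, Matrix.cons_val_fin_one]
    ring
  have hg : g ≠ 0 := by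
    intro h0
    refine hfp (sub_eq_zero.1 ?_)
    have h1 : g 0 = 0 := by rw [h0]; rfl
    have h2 : g 1 = 0 := by rw [h0]; rfl
    ext i
    fin_cases i
    · have h3 : -(f - p) 0 = 0 := h2
      exact neg_eq_zero.1 h3
    · simpa [hgdef] using h1
  have hge : inner ℝ g (e - p) ≠ 0 := by
    intro h0
    refine h (collinear_of_inner_eq_zero (p := p) hg ?_)
    rintro x (rfl | rfl | rfl)
    · simp
    · exact h0
    · exact hgf
  refine ⟨‖g‖ * ‖e - p‖ / |inner ℝ g (e - p)|, fun x hx y hy => ?_⟩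
  obtain ⟨s, hs0, -, rfl⟩ := mem_segment_iff_exists.1 hx
  obtain ⟨t, -, -, rfl⟩ := mem_segment_iff_exists.1 hy
  have h1 : inner ℝ g (p + s • (e - p) - (p + t • (f - p))) = s * inner ℝ g (e - p) := by
    rw [add_sub_add_left_eq_sub, inner_sub_right, inner_smul_right, inner_smul_right, hgf]
    ring
  have h2 := abs_real_inner_le_norm g (p + s • (e - p) - (p + t • (f - p)))
  rw [h1, abs_mul, abs_of_nonneg hs0, ← dist_eq_norm] at h2
  have h3 : dist (p + s • (e - p)) p = s * ‖e - p‖ := by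
    rw [dist_eq_norm, add_sub_cancel_left, norm_smul, Real.norm_eq_abs, abs_of_nonneg hs0]
  rw [h3, div_mul_eq_mul_div, le_div_iff₀ (abs_pos.2 hge)]
  calc s * ‖e - p‖ * |inner ℝ g (e - p)| = ‖e - p‖ * (s * |inner ℝ g (e - p)|) := by ring
    _ ≤ ‖e - p‖ * (‖g‖ * dist (p + s • (e - p)) (p + t • (f - p))) := by gcongr
    _ = _ := by ring

theorem exists_pos_forall_le {ι : Type*} [Finite ι] {f : ι → ℝ} (hf : ∀ i, 0 < f i) :
    ∃ d : ℝ, 0 < d ∧ ∀ i, d ≤ f i := by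
  have h1 : ∀ᶠ d in 𝓝[>] (0 : ℝ), ∀ i, d ≤ f i :=
    Filter.eventually_all.2 fun i => Filter.mem_of_superset (Ioc_mem_nhdsGT (hf i)) fun _ h => h.2
  obtain ⟨d, hd, hd0⟩ := (h1.and self_mem_nhdsWithin).exists
  exact ⟨d, hd0, hd⟩

theorem exists_forall_le_of_finite {ι : Type*} [Finite ι] (f : ι → ℝ) :
    ∃ C : ℝ, 0 ≤ C ∧ ∀ i, f i ≤ C := by
  obtain ⟨C, hC⟩ := (Set.finite_range f).bddAbove
  exact ⟨max C 0, le_max_right _ _, fun i => (hC ⟨i, rfl⟩).trans (le_max_left _ _)⟩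

section Domain

variable {Ω : Set Plane} {m : ℕ} {a b : Fin m → Plane}

/-- Disjoint sides have a positive distance; sides that meet do so in a common end point and diverge
linearly from it. -/
theorem IsPolygonalDomain.exists_common_point (hΩ : IsPolygonalDomain Ω a b) {i j : Fin m}
    (hij : i ≠ j) : ∃ d C : ℝ, 0 < d ∧ ∀ x ∈ segment ℝ (a i) (b i), ∀ y ∈ segment ℝ (a j) (b j),
      dist x y < d →
        ∃ p ∈ segment ℝ (a i) (b i) ∩ segment ℝ (a j) (b j), dist x p ≤ C * dist x y := by
  rcases (segment ℝ (a i) (b i) ∩ segment ℝ (a j) (b j)).eq_empty_or_nonempty with he | hne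
  · have hcpt : IsCompact (segment ℝ (a i) (b i)) := by
      rw [← convexHull_pair]
      exact (Set.toFinite _).isCompact_convexHull ℝ
    obtain ⟨r, hr, h⟩ := Metric.exists_pos_forall_lt_edist hcpt (isClosed_segment (a j) (b j))
      (Set.disjoint_iff_inter_eq_empty.2 he)
    refine ⟨r, 0, hr, fun x hx y hy hxy => ?_⟩
    have h1 := h x hx y hy
    rw [edist_nndist, ENNReal.coe_lt_coe, ← NNReal.coe_lt_coe, coe_nndist] at h1
    exact absurd h1 hxy.le.not_gt
  · have hcol := hΩ.not_collinear i j hij hne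
    obtain ⟨p, hpi, hpj⟩ := hne
    obtain ⟨h1, h2⟩ := hΩ.inter i j hij ⟨hpi, hpj⟩
    have hend : ∀ l, p ∈ ({a l, b l} : Set Plane) →
        ∃ e, segment ℝ (a l) (b l) = segment ℝ p e ∧ ({a l, b l} : Set Plane) = {p, e} := by
      rintro l (rfl | rfl)
      · exact ⟨_, rfl, rfl⟩
      · exact ⟨a l, segment_symm _ _ _, Set.pair_comm _ _⟩
    obtain ⟨e, he, he'⟩ := hend i h1
    obtain ⟨f, hf, hf'⟩ := hend j h2
    have hcol' : ¬ Collinear ℝ {p, e, f} := by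
      intro hc
      refine hcol (hc.subset ?_)
      have : ({a i, b i, a j, b j} : Set Plane) = {a i, b i} ∪ {a j, b j} := by
        ext; simp only [Set.mem_insert_iff, Set.mem_singleton_iff, Set.mem_union]; tauto
      rw [this, he', hf']
      intro z
      simp only [Set.mem_insert_iff, Set.mem_singleton_iff, Set.mem_union]
      tauto
    obtain ⟨C, hC⟩ := exists_dist_le_mul_dist hcol'
    exact ⟨1, C, one_pos, fun x hx y hy _ => ⟨p, ⟨hpi, hpj⟩, hC x (he ▸ hx) y (hf ▸ hy)⟩⟩

/-- Sides that come close to each other do so near a common end point, and the corners have a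
positive distance to the other sides. -/
theorem IsPolygonalDomain.exists_separation (hΩ : IsPolygonalDomain Ω a b) :
    ∃ d C : ℝ, 0 < d ∧ 0 ≤ C ∧
      (∀ i j, i ≠ j → ∀ x ∈ segment ℝ (a i) (b i), ∀ y ∈ segment ℝ (a j) (b j), dist x y < d →
        ∃ p ∈ segment ℝ (a i) (b i) ∩ segment ℝ (a j) (b j), dist x p ≤ C * dist x y) ∧
      ∀ i l j, i ≠ l → ∀ p ∈ segment ℝ (a i) (b i) ∩ segment ℝ (a l) (b l),
        p ∉ segment ℝ (a j) (b j) → ∀ y ∈ segment ℝ (a j) (b j), d ≤ dist p y := by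
  choose d₁ C₁ hd₁ h₁ using fun c : {c : Fin m × Fin m // c.1 ≠ c.2} =>
    hΩ.exists_common_point c.2
  have h2 : ∀ (q : Plane) (j : Fin m), ∃ d : ℝ, 0 < d ∧
      (q ∉ segment ℝ (a j) (b j) → ∀ y ∈ segment ℝ (a j) (b j), d ≤ dist q y) := by
    intro q j
    by_cases hq : q ∈ segment ℝ (a j) (b j)
    · exact ⟨1, one_pos, fun h => absurd hq h⟩
    · obtain ⟨r, hr, hball⟩ := Metric.isOpen_iff.1 (isClosed_segment (a j) (b j)).isOpen_compl q hq
      refine ⟨r, hr, fun _ y hy => ?_⟩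
      by_contra hlt
      push Not at hlt
      exact hball (by rwa [Metric.mem_ball, dist_comm]) hy
  choose d₂ hd₂ h₂ using h2
  obtain ⟨C, hC0, hC⟩ := exists_forall_le_of_finite C₁
  obtain ⟨e₁, he₁, he₁'⟩ := exists_pos_forall_le hd₁
  obtain ⟨e₂, he₂, he₂'⟩ := exists_pos_forall_le
    (f := fun c : Fin m × Fin m => d₂ (a c.1) c.2) fun c => hd₂ _ _
  obtain ⟨e₃, he₃, he₃'⟩ := exists_pos_forall_le
    (f := fun c : Fin m × Fin m => d₂ (b c.1) c.2) fun c => hd₂ _ _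
  refine ⟨min e₁ (min e₂ e₃), C, lt_min he₁ (lt_min he₂ he₃), hC0, ?_, ?_⟩
  · intro i j hij x hx y hy hxy
    obtain ⟨p, hp, hpx⟩ := h₁ ⟨(i, j), hij⟩ x hx y hy
      (hxy.trans_le ((min_le_left _ _).trans (he₁' _)))
    exact ⟨p, hp, hpx.trans (mul_le_mul_of_nonneg_right (hC _) dist_nonneg)⟩
  · intro i l j hil p hp hpj y hy
    rcases (hΩ.inter i l hil hp).1 with rfl | rfl
    · exact ((min_le_right _ _).trans ((min_le_left _ _).trans (he₂' (i, j)))).trans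
        (h₂ _ j hpj y hy)
    · exact ((min_le_right _ _).trans ((min_le_right _ _).trans (he₃' (i, j)))).trans
        (h₂ _ j hpj y hy)

end Domain

/-! ### Linking boundary elements to test functions -/

section Mesh

variable {Ω : Set Plane} {T : Geometry.SimplicialComplex ℝ Plane} {m : ℕ} {a b : Fin m → Plane}
  {K : Finset Plane} {k : ℕ}

theorem IsPolygonalDomain.exists_side (hΩ : IsPolygonalDomain Ω a b) {x : Plane}
    (hx : x ∈ frontier Ω) : ∃ i, x ∈ segment ℝ (a i) (b i) := by
  rw [hΩ.frontier_eq] at hx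
  exact Set.mem_iUnion.1 hx

theorem baryGrad_ne_zero (hK : IsTri K) {p : Plane} (hp : p ∈ K) : baryGrad K p ≠ 0 := by
  intro h0
  obtain ⟨q, hq, hqp⟩ : ∃ q ∈ K, q ≠ p := by
    refine Finset.exists_mem_ne ?_ p
    rw [hK.card]; norm_num
  have h1 := bary_sub K p q p
  rw [h0, inner_zero_left, hK.bary_self hp, hK.bary_of_ne hq hqp] at h1
  norm_num at h1

/-- The corners of the domain are vertices of boundary faces. -/
theorem exists_bdryPair_of_corner (hΩ : IsPolygonalDomain Ω a b) (hT : IsFittedTriangulation Ω T)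
    {i l : Fin m} (hil : i ≠ l) {p : Plane}
    (hp : p ∈ segment ℝ (a i) (b i) ∩ segment ℝ (a l) (b l)) :
    ∃ c ∈ hT.bdryPairs, p ∈ c.1.erase c.2 := by
  have hpf : p ∈ frontier Ω := segment_subset_frontier hΩ i hp.1
  obtain ⟨c, hc, hpc⟩ := hT.exists_bdryPair hΩ.regular hΩ.preperfect hpf
  refine ⟨c, hc, ?_⟩
  have hKe := hT.fst_mem_elems hc
  have hKt := hT.isTri hKe
  have hC := hT.snd_mem hc
  have hp0 : bary c.1 c.2 p = 0 := hKt.bary_mem_face hpc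
  have hpK : p ∈ tri c.1 := face_subset_tri _ _ hpc
  by_cases hmem : p ∈ c.1
  · refine Finset.mem_erase.2 ⟨?_, hmem⟩
    rintro rfl
    rw [hKt.bary_self hC] at hp0
    exact one_ne_zero hp0
  exfalso
  have hon : OnFace c.1 c.2 p := by
    refine ⟨hC, hp0, fun q hq hqp => lt_of_le_of_ne (hKt.bary_nonneg hpK q) fun h => hmem ?_⟩
    exact hKt.mem_of_two_eq_zero hC hq hqp.symm hp0 h.symm
  -- In the relative interior of a face the boundary is locally a line, so both sides through `p`
  -- would be collinear.
  have hev : ∀ᶠ y in 𝓝 p, y ∈ frontier Ω → bary c.1 c.2 y = 0 := by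
    filter_upwards [hon.eventually_mem_iff hT hΩ.regular (hT.mem_elems.1 hKe)
      (hT.isOuterFace hΩ.regular hc), hon.eventually_closure hT (hT.mem_elems.1 hKe)
      (hT.isOuterFace hΩ.regular hc)] with y h1 h2 hy
    refine le_antisymm ?_ (hKt.bary_nonneg (h2.1 hy.1) _)
    by_contra hlt
    push Not at hlt
    exact hΩ.notMem_of_frontier hy (h1.2 hlt)
  have hside : ∀ j, p ∈ segment ℝ (a j) (b j) → ∀ e ∈ segment ℝ (a j) (b j),
      inner ℝ (baryGrad c.1 c.2) (e - p) = 0 := by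
    intro j hpj e he
    have ht : Filter.Tendsto (fun t : ℝ => p + t • (e - p)) (𝓝[>] 0) (𝓝 p) := by
      have : Continuous fun t : ℝ => p + t • (e - p) := by fun_prop
      have h0 := this.tendsto 0
      rw [zero_smul, add_zero] at h0
      exact h0.mono_left nhdsWithin_le_nhds
    obtain ⟨t, ht1, ht0, ht⟩ := ((ht.eventually hev).and (Ioo_mem_nhdsGT one_pos)).exists
    have h1 := ht1 (segment_subset_frontier hΩ j ((convex_segment (𝕜 := ℝ) _ _).segment_subset
      hpj he (mem_segment_iff_exists.2 ⟨t, ht0.le, ht.le, rfl⟩)))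
    rw [bary_smul_add, hp0, mul_zero, zero_add] at h1
    rw [← bary_sub, hp0, sub_zero]
    exact (mul_eq_zero.1 h1).resolve_left ht0.ne'
  refine hΩ.not_collinear i l hil ⟨p, hp⟩
    (collinear_of_inner_eq_zero (p := p) (baryGrad_ne_zero hKt hC) ?_)
  rintro x (rfl | rfl | rfl | rfl)
  · exact hside i hp.1 _ (left_mem_segment ℝ _ _)
  · exact hside i hp.1 _ (right_mem_segment ℝ _ _)
  · exact hside l hp.2 _ (left_mem_segment ℝ _ _)
  · exact hside l hp.2 _ (right_mem_segment ℝ _ _)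

/-- An element with a boundary face contains the support of a test function if its third vertex
lies only on sides that contain a given vertex of the boundary face. -/
theorem exists_testSimplex_of_sides (hΩ : IsPolygonalDomain Ω a b)
    (hT : IsFittedTriangulation Ω T)
    (h5 : ∀ i, 5 ≤ (facesIn T (segment ℝ (a i) (b i))).ncard) (hk : 1 ≤ k)
    {c : Finset Plane × Plane} (hc : c ∈ hT.bdryPairs) {q : Plane} (hq : q ∈ c.1.erase c.2)
    (h : ∀ l, c.2 ∈ segment ℝ (a l) (b l) → q ∈ segment ℝ (a l) (b l)) :
    ∃ s ∈ hT.testSimplices k, s ⊆ c.1 := by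
  have hKe := hT.fst_mem_elems hc
  have hKt := hT.isTri hKe
  have hC := hT.snd_mem hc
  obtain ⟨hqC, hqK⟩ := Finset.mem_erase.1 hq
  by_cases hCΩ : c.2 ∈ Ω
  · exact ⟨{c.2}, singleton_inner_mem hΩ hT hk hc hC hCΩ, by simpa using hC⟩
  have hCf : c.2 ∈ frontier Ω :=
    ⟨hT.tri_subset_closure (hT.mem_elems.1 hKe) (mem_tri_of_mem hC), by
      rwa [hΩ.isOpen.interior_eq]⟩
  obtain ⟨l, hl⟩ := hΩ.exists_side hCf
  have hsub : ({q, c.2} : Finset Plane) ⊆ c.1 := by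
    intro z hz
    rcases Finset.mem_insert.1 hz with rfl | hz
    · exact hqK
    · rw [Finset.mem_singleton.1 hz]; exact hC
  -- `q` and the third vertex lie on one side, so their edge is a second boundary face of the
  -- element.
  have he : ({q, c.2} : Finset Plane) ∈ facesIn T (frontier Ω) := by
    refine ⟨T.down_closed (hT.mem_elems.1 hKe).1 hsub ⟨q, by simp⟩, Finset.card_pair hqC, ?_⟩
    rw [Finset.coe_pair, convexHull_pair]
    exact ((convex_segment (𝕜 := ℝ) _ _).segment_subset (h l hl) hl).trans
      (segment_subset_frontier hΩ l)
  obtain ⟨r, hr, her, hcr⟩ := exists_erase_eq hT hKe he hsub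
  have hrC : r ≠ c.2 := by
    rintro rfl
    have : c.2 ∈ c.1.erase c.2 := her ▸ (by simp : c.2 ∈ ({q, c.2} : Finset Plane))
    simp at this
  obtain ⟨A, hA, hear⟩ := exists_isEar hΩ hT h5 hrC hcr hc
  exact ⟨{A}, singleton_ear_mem hT hk hKe hA hear, by simpa using hA⟩

/-- In a fine mesh, every element with a boundary face that contains no support of a test function
is close to a corner at which there is one. -/
theorem exists_corner_of_fine (hΩ : IsPolygonalDomain Ω a b) (hT : IsFittedTriangulation Ω T)
    (h5 : ∀ i, 5 ≤ (facesIn T (segment ℝ (a i) (b i))).ncard) (hk : 1 ≤ k) {d C : ℝ}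
    (hC : 0 ≤ C)
    (hd₁ : ∀ i j, i ≠ j → ∀ x ∈ segment ℝ (a i) (b i), ∀ y ∈ segment ℝ (a j) (b j), dist x y < d →
        ∃ p ∈ segment ℝ (a i) (b i) ∩ segment ℝ (a j) (b j), dist x p ≤ C * dist x y)
    (hd₂ : ∀ i l j, i ≠ l → ∀ p ∈ segment ℝ (a i) (b i) ∩ segment ℝ (a l) (b l),
        p ∉ segment ℝ (a j) (b j) → ∀ y ∈ segment ℝ (a j) (b j), d ≤ dist p y)
    (hfine : ∀ K ∈ hT.elems, elementDiam K < d) {c : Finset Plane × Plane}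
    (hc : c ∈ hT.bdryPairs) (hbad : ¬ ∃ s ∈ hT.testSimplices k, s ⊆ c.1) :
    ∃ p, (∃ i, p = a i ∨ p = b i) ∧ ∃ A ∈ c.1, segment ℝ A p ⊆ closure Ω ∧
      dist A p ≤ C * elementDiam c.1 ∧
      ∃ K ∈ hT.elems, p ∈ K ∧ ∃ s ∈ hT.testSimplices k, s ⊆ K := by
  have hKe := hT.fst_mem_elems hc
  obtain ⟨A, hA⟩ : (c.1.erase c.2).Nonempty :=
    Finset.card_pos.1 (by rw [(hT.isTri hKe).erase_card (hT.snd_mem hc)]; norm_num)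
  have hAK : A ∈ c.1 := Finset.mem_of_mem_erase hA
  -- The element spans two different sides. Being small, it must be near a common end point `p` of
  -- them.
  obtain ⟨l, hCl, hAl⟩ : ∃ l, c.2 ∈ segment ℝ (a l) (b l) ∧ A ∉ segment ℝ (a l) (b l) := by
    by_contra hcon
    push Not at hcon
    exact hbad (exists_testSimplex_of_sides hΩ hT h5 hk hc hA hcon)
  obtain ⟨i, hAi⟩ := hΩ.exists_side (hT.face_subset_frontier hc (subset_convexHull ℝ _ hA))
  have hil : i ≠ l := by rintro rfl; exact hAl hAi
  have hAC : dist A c.2 ≤ elementDiam c.1 :=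
    dist_le_elementDiam (mem_tri_of_mem hAK) (mem_tri_of_mem (hT.snd_mem hc))
  obtain ⟨p, hp, hAp⟩ := hd₁ i l hil A hAi c.2 hCl (hAC.trans_lt (hfine _ hKe))
  obtain ⟨c', hc', hpc'⟩ := exists_bdryPair_of_corner hΩ hT hil hp
  have hKe' := hT.fst_mem_elems hc'
  have hpK' : p ∈ c'.1 := Finset.mem_of_mem_erase hpc'
  refine ⟨p, ⟨i, by simpa using (hΩ.inter i l hil hp).1⟩, A, hAK, ?_, ?_, c'.1, hKe', hpK',
    exists_testSimplex_of_sides hΩ hT h5 hk hc' hpc' fun j hj => ?_⟩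
  · exact ((convex_segment (𝕜 := ℝ) _ _).segment_subset hAi hp.1).trans
      ((segment_subset_frontier hΩ i).trans frontier_subset_closure)
  · exact hAp.trans (mul_le_mul_of_nonneg_left hAC hC)
  -- A side that misses the corner `p` is too far away to contain the third vertex of an element at
  -- `p`.
  · by_contra hpj
    have h1 := hd₂ i l j hil p hp hpj _ hj
    have h2 : dist p c'.2 ≤ elementDiam c'.1 :=
      dist_le_elementDiam (mem_tri_of_mem hpK') (mem_tri_of_mem (hT.snd_mem hc'))
    linarith [hfine _ hKe']

/-- The elements with a boundary face outside a set of at most `N` elements contain the support of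
a test function, and the remaining ones are connected to one by a chain of at most `N` elements. -/
structure IsLinked (hT : IsFittedTriangulation Ω T) (G : Finset (Finset Plane)) (N : ℝ)
    (B : Finset (Finset Plane × Plane)) : Prop where
  card_le : (B.card : ℝ) ≤ N
  good : ∀ c ∈ hT.bdryPairs, c ∉ B → ∃ s ∈ G, s ⊆ c.1
  bad : ∀ c ∈ hT.bdryPairs, c ∈ B → ∃ s ∈ G, ∃ 𝒦 ⊆ hT.elems, (𝒦.card : ℝ) ≤ N ∧
    ∃ S : Set Plane, IsPreconnected S ∧ (∀ x ∈ S, ∃ K ∈ 𝒦, x ∈ tri K) ∧ tri c.1 ⊆ S ∧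
      (s : Set Plane) ⊆ S

theorem IsLinked.mono {hT : IsFittedTriangulation Ω T} {G : Finset (Finset Plane)} {N N' : ℝ}
    {B : Finset (Finset Plane × Plane)} (h : IsLinked hT G N B) (hN : N ≤ N') :
    IsLinked hT G N' B := by
  refine ⟨h.card_le.trans hN, h.good, fun c hc hcB => ?_⟩
  obtain ⟨s, hs, 𝒦, h𝒦, hcard, hS⟩ := h.bad c hc hcB
  exact ⟨s, hs, 𝒦, h𝒦, hcard.trans hN, hS⟩

open Classical in
theorem IsFittedTriangulation.card_filter_mem_le (hT : IsFittedTriangulation Ω T)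
    {𝒦 : Finset (Finset Plane)} (h𝒦 : 𝒦 ⊆ hT.elems) :
    (hT.bdryPairs.filter fun c => c.1 ∈ 𝒦).card ≤ 3 * 𝒦.card := by
  have h1 : ∀ c ∈ hT.bdryPairs.filter fun c => c.1 ∈ 𝒦, c.1 ∈ 𝒦 := fun c hc =>
    (Finset.mem_filter.1 hc).2
  rw [Finset.card_eq_sum_card_fiberwise h1, mul_comm, ← smul_eq_mul]
  refine Finset.sum_le_card_nsmul _ _ _ fun K hK => ?_
  refine le_trans (Finset.card_le_card ?_) (hT.card_filter_bdryPairs_le (h𝒦 hK))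
  intro c hc
  simp only [Finset.mem_filter] at hc ⊢
  exact ⟨hc.1.1, hc.2⟩

/-- One large element makes all elements large, and the boundedness of `Ω` limits their number. So
every boundary face may count as bad, linked through the whole closure of `Ω` to a single test
simplex. -/
theorem exists_isLinked_of_coarse (hΩ : IsPolygonalDomain Ω a b) {κ cq d : ℝ} (hκ : 0 < κ)
    (hcq : 0 < cq) (hd : 0 < d) : ∃ N : ℝ, ∀ (T : Geometry.SimplicialComplex ℝ Plane)
      (hT : IsFittedTriangulation Ω T), HasInscribedBalls κ T → IsQuasiUniform cq T →
      (∃ K ∈ hT.elems, d ≤ elementDiam K) → (∃ s, s ∈ hT.testSimplices k) →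
      ∃ B, IsLinked hT (hT.testSimplices k) N B := by
  obtain ⟨R, hR⟩ := hΩ.isBounded.closure.subset_closedBall (0 : Plane)
  have hR0 : 0 ≤ R := by
    obtain ⟨x, hx⟩ := hΩ.isConnected.nonempty
    exact dist_nonneg.trans (Metric.mem_closedBall.1 (hR (subset_closure hx)))
  set N := (R / (κ * (d / cq))) ^ 2 with hN
  have hN0 : 0 ≤ N := sq_nonneg _
  refine ⟨3 * N, fun T hT hb hq ⟨K₁, hK₁, hdK⟩ ⟨s, hs⟩ => ⟨hT.bdryPairs, ?_⟩⟩
  have hδ : 0 < κ * (d / cq) := by positivity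
  have hcard : (hT.elems.card : ℝ) ≤ N := by
    have h1 := hT.card_mul_le hκ hb (Finset.Subset.refl _) (δ := d / cq) (R := R) (x := 0)
      (by positivity) hR0
      (fun K hK => (hT.tri_subset_closure (hT.mem_elems.1 hK)).trans hR) (fun K hK => by
        rw [div_le_iff₀' hcq]
        exact hdK.trans (hq K (hT.mem_elems.1 hK) K₁ (hT.mem_elems.1 hK₁)))
    rw [hN, div_pow, le_div_iff₀ (by positivity)]
    exact h1
  refine ⟨?_, fun c hc h => absurd hc h, fun c hc _ => ⟨s, hs, hT.elems, Finset.Subset.refl _,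
    by linarith, closure Ω, hΩ.isConnected.isPreconnected.closure, fun x hx => ?_,
    hT.tri_subset_closure (hT.mem_elems.1 (hT.fst_mem_elems hc)), ?_⟩⟩
  · classical
    have h1 := hT.card_filter_mem_le (Finset.Subset.refl _)
    rw [Finset.filter_true_of_mem fun c hc => hT.fst_mem_elems hc] at h1
    have h2 : (hT.bdryPairs.card : ℝ) ≤ 3 * hT.elems.card := by exact_mod_cast h1
    linarith
  · obtain ⟨K, hK, hxK⟩ := hT.exists_mem_tri hx
    exact ⟨K, hT.mem_elems.2 hK, hxK⟩
  · obtain ⟨⟨K, hK, hsK⟩, -⟩ := hT.mem_testSimplices.1 hs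
    exact fun x hx => hT.tri_subset_closure (hT.mem_elems.1 hK) (mem_tri_of_mem (hsK hx))

-- Bad elements lie within a fixed multiple of the mesh size of an end point of a side. By
-- comparison of areas, boundedly many elements fit there, however fine the mesh.
open Classical in
theorem exists_isLinked_of_fine (hΩ : IsPolygonalDomain Ω a b) (hk : 1 ≤ k) {κ cq : ℝ}
    (hκ : 0 < κ) (hcq : 0 < cq) : ∃ d N : ℝ, 0 < d ∧
      ∀ (T : Geometry.SimplicialComplex ℝ Plane) (hT : IsFittedTriangulation Ω T),
      HasInscribedBalls κ T → IsQuasiUniform cq T →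
      (∀ i, 5 ≤ (facesIn T (segment ℝ (a i) (b i))).ncard) →
      (∀ K ∈ hT.elems, elementDiam K < d) → ∃ B, IsLinked hT (hT.testSimplices k) N B := by
  obtain ⟨d, C, hd, hC, hd₁, hd₂⟩ := hΩ.exists_separation
  set N := ((C + 1) * cq ^ 2 / κ) ^ 2 with hN
  have hN0 : 0 ≤ N := sq_nonneg _
  -- `N` bounds the elements near one point; `6 * m * N` allows for `2 * m` end points and three
  -- faces per element.
  refine ⟨d, N + 6 * m * N, hd, fun T hT hb hq h5 hfine => ?_⟩
  have hNN : N ≤ N + 6 * m * N := by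
    have : 0 ≤ 6 * (m : ℝ) * N := by positivity
    linarith
  obtain ⟨K₀, hK₀⟩ : ∃ K, K ∈ hT.elems := by
    obtain ⟨x, hx⟩ := hΩ.isConnected.nonempty
    obtain ⟨K, hK, -⟩ := hT.exists_mem_tri (subset_closure hx)
    exact ⟨K, hT.mem_elems.2 hK⟩
  set H := cq * elementDiam K₀ with hH
  have hH0 : 0 < H := mul_pos hcq (hT.isTri hK₀).elementDiam_pos
  have hup : ∀ K ∈ hT.elems, elementDiam K ≤ H := fun K hK =>
    hq K₀ (hT.mem_elems.1 hK₀) K (hT.mem_elems.1 hK)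
  have hlow : ∀ K ∈ hT.elems, H / cq ^ 2 ≤ elementDiam K := fun K hK => by
    have h1 := hq K (hT.mem_elems.1 hK) K₀ (hT.mem_elems.1 hK₀)
    rw [div_le_iff₀ (by positivity), hH]
    nlinarith [mul_le_mul_of_nonneg_left h1 hcq.le]
  -- The segment to the corner stays within `C * H`, and an element that meets it reaches at most
  -- `H` further.
  set near : Plane → Finset (Finset Plane) := fun p =>
    hT.elems.filter fun K => tri K ⊆ Metric.closedBall p ((C + 1) * H) with hnear
  have hnear_sub : ∀ p, near p ⊆ hT.elems := fun p => Finset.filter_subset _ _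
  have hcard : ∀ p, ((near p).card : ℝ) ≤ N := by
    intro p
    have h1 := hT.card_mul_le hκ hb (hnear_sub p) (δ := H / cq ^ 2) (R := (C + 1) * H) (x := p)
      (by positivity) (by positivity) (fun K hK => (Finset.mem_filter.1 hK).2)
      (fun K hK => hlow K (hnear_sub p hK))
    have h2 : N = ((C + 1) * H) ^ 2 / (κ * (H / cq ^ 2)) ^ 2 := by
      rw [hN]; field_simp
    rw [h2, le_div_iff₀ (by positivity)]
    exact h1
  have hmem_near : ∀ p x, dist x p ≤ C * H → ∀ K ∈ hT.elems, x ∈ tri K → K ∈ near p := by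
    intro p x hx K hK hxK
    refine Finset.mem_filter.2 ⟨hK, fun y hy => ?_⟩
    rw [Metric.mem_closedBall]
    have h1 := (dist_le_elementDiam hy hxK).trans (hup K hK)
    linarith [dist_triangle y x p]
  set B := hT.bdryPairs.filter fun c => ¬ ∃ s ∈ hT.testSimplices k, s ⊆ c.1 with hB
  have hcorner := fun c (hc : c ∈ B) => exists_corner_of_fine hΩ hT h5 hk hC hd₁ hd₂ hfine
    (Finset.mem_filter.1 hc).1 (Finset.mem_filter.1 hc).2
  refine ⟨B, ?_, fun c hc hcB => ?_, fun c hc hcB => ?_⟩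
  · set E : Finset Plane := Finset.univ.image a ∪ Finset.univ.image b with hE
    have hEcard : E.card ≤ 2 * m := by
      refine (Finset.card_union_le _ _).trans ?_
      have h1 := Finset.card_image_le (s := (Finset.univ : Finset (Fin m))) (f := a)
      have h2 := Finset.card_image_le (s := (Finset.univ : Finset (Fin m))) (f := b)
      rw [Finset.card_univ, Fintype.card_fin] at h1 h2
      omega
    have hsub : B ⊆ E.biUnion fun p => hT.bdryPairs.filter fun c => c.1 ∈ near p := by
      intro c hc
      obtain ⟨p, ⟨i, hi⟩, A, hA, -, hAp, -⟩ := hcorner c hc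
      have hcb := (Finset.mem_filter.1 hc).1
      have hKe := hT.fst_mem_elems hcb
      refine Finset.mem_biUnion.2 ⟨p, ?_, Finset.mem_filter.2 ⟨hcb, hmem_near p A ?_ _ hKe
        (mem_tri_of_mem hA)⟩⟩
      · rcases hi with rfl | rfl <;> simp [hE]
      · exact hAp.trans (mul_le_mul_of_nonneg_left (hup _ hKe) hC)
    have h1 : (B.card : ℝ) ≤ ∑ p ∈ E, 3 * N := by
      refine (Nat.cast_le.2 ((Finset.card_le_card hsub).trans Finset.card_biUnion_le)).trans ?_
      rw [Nat.cast_sum]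
      refine Finset.sum_le_sum fun p _ => ?_
      have h2 : ((hT.bdryPairs.filter fun c => c.1 ∈ near p).card : ℝ) ≤ 3 * (near p).card := by
        exact_mod_cast hT.card_filter_mem_le (hnear_sub p)
      linarith [hcard p]
    rw [Finset.sum_const, nsmul_eq_mul] at h1
    have h2 : (E.card : ℝ) ≤ 2 * m := by exact_mod_cast hEcard
    nlinarith [mul_le_mul_of_nonneg_right h2 hN0]
  · by_contra h
    exact hcB (Finset.mem_filter.2 ⟨hc, h⟩)
  · obtain ⟨p, -, A, hA, hseg, hAp, K, hK, hpK, s, hs, hsK⟩ := hcorner c hcB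
    have hKe := hT.fst_mem_elems hc
    have hAp' : dist A p ≤ C * H := hAp.trans (mul_le_mul_of_nonneg_left (hup _ hKe) hC)
    refine ⟨s, hs, near p, hnear_sub p, (hcard p).trans hNN, tri c.1 ∪ segment ℝ A p ∪ tri K,
      ?_, ?_, fun x hx => Or.inl (Or.inl hx), fun x hx => Or.inr (mem_tri_of_mem (hsK hx))⟩
    · exact ((convex_tri c.1).isPreconnected.union A (mem_tri_of_mem hA) (left_mem_segment ℝ _ _)
        (convex_segment (𝕜 := ℝ) A p).isPreconnected).union p (Or.inr (right_mem_segment ℝ _ _))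
        (mem_tri_of_mem hpK) (convex_tri K).isPreconnected
    · rintro x ((hx | hx) | hx)
      · exact ⟨c.1, hmem_near p A hAp' _ hKe (mem_tri_of_mem hA), hx⟩
      · obtain ⟨K', hK', hxK'⟩ := hT.exists_mem_tri (hseg hx)
        refine ⟨K', hmem_near p x ?_ _ (hT.mem_elems.2 hK') hxK', hxK'⟩
        refine le_trans ?_ hAp'
        have h1 := (convex_closedBall p (dist A p)).segment_subset
          (Metric.mem_closedBall.2 le_rfl) (Metric.mem_closedBall_self dist_nonneg) hx
        exact h1
      · refine ⟨K, hmem_near p p ?_ _ hK (mem_tri_of_mem hpK), hx⟩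
        rw [dist_self]; positivity

/-- All elements with a boundary face are linked to the supports of test functions, with a constant
that depends only on the domain and on the mesh regularity. -/
theorem exists_isLinked (hΩ : IsPolygonalDomain Ω a b) (hk : 1 ≤ k) {κ cq : ℝ}
    (hκ : 0 < κ) (hcq : 0 < cq) : ∃ N : ℝ, 0 ≤ N ∧
      ∀ (T : Geometry.SimplicialComplex ℝ Plane) (hT : IsFittedTriangulation Ω T),
      HasInscribedBalls κ T → IsQuasiUniform cq T →
      (∀ i, 5 ≤ (facesIn T (segment ℝ (a i) (b i))).ncard) →
      (k = 1 → ResolvesBoundary Ω T) → ∃ B, IsLinked hT (hT.testSimplices k) N B := by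
  obtain ⟨d, N₁, hd, h₁⟩ := exists_isLinked_of_fine hΩ hk hκ hcq
  obtain ⟨N₂, h₂⟩ := exists_isLinked_of_coarse (k := k) hΩ hκ hcq hd
  refine ⟨max 0 (max N₁ N₂), le_max_left _ _, fun T hT hb hq h5 hres => ?_⟩
  rcases hk.eq_or_lt with h1 | h2
  · by_cases hfine : ∀ K ∈ hT.elems, elementDiam K < d
    · obtain ⟨B, hB⟩ := h₁ T hT hb hq h5 hfine
      exact ⟨B, hB.mono ((le_max_left _ _).trans (le_max_right _ _))⟩
    · push Not at hfine
      obtain ⟨B, hB⟩ := h₂ T hT hb hq hfine ((hres h1.symm).exists_testSimplex hΩ hT h5 hk)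
      exact ⟨B, hB.mono ((le_max_right _ _).trans (le_max_right _ _))⟩
  · exact ⟨∅, by simp, fun c hc _ => exists_edge_mem hΩ hT h5 h2 hc,
      fun c _ h => absurd h (Finset.notMem_empty c)⟩

end Mesh

/-! ### The inf-sup condition -/

theorem mainTheorem1 (Ω : Set Plane) {m : ℕ} (a b : Fin m → Plane)
    (hΩ : IsPolygonalDomain Ω a b) (k : ℕ) (hk : 1 ≤ k) (cρ cq : ℝ) :
    ∃ cs : ℝ, 0 < cs ∧
      ∀ T : Geometry.SimplicialComplex ℝ Plane,
        IsFittedTriangulation Ω T → IsShapeRegular cρ T → IsQuasiUniform cq T →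
        (∀ i, 5 ≤ (facesIn T (segment ℝ (a i) (b i))).ncard) →
        (k = 1 → ResolvesBoundary Ω T) →
        ∀ v ∈ feSpace Ω T k,
          cs * norm1h Ω T v ≤
            sSup {r : ℝ | ∃ w ∈ feSpace Ω T k, norm1h Ω T w ≠ 0 ∧
              r = nitscheForm Ω v w / norm1h Ω T w} := by
  classical
  set κ := 1 / (2 * max cρ 1) with hκdef
  have hκ : 0 < κ := by
    have : 0 < max cρ 1 := lt_max_of_lt_right one_pos
    positivity
  have hcq : 0 < max cq 1 := lt_max_of_lt_right one_pos
  obtain ⟨C, hC, hinv⟩ := exists_inverse_estimate k hκ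
  obtain ⟨N, hN, hlink⟩ := exists_isLinked hΩ hk hκ hcq
  set M := 8 + (max cq 1 ^ 2 / κ) ^ 2 with hM
  have hM0 : 0 < M := by positivity
  obtain ⟨cs, α, hcs, hmain⟩ := exists_infsup_constant (b := 1 + 1 / κ) (c₀ := κ / 2) (M := M)
    (C := C) (Cb := 6 * M + 6 * C ^ 2 + 2 * N + 2 * N * (N * C) ^ 2) (by positivity) (by positivity)
    hM0 (by positivity)
  refine ⟨cs, hcs, fun T hT hρ hq h5 hres v hv => ?_⟩
  have hb : HasInscribedBalls κ T := hρ.hasInscribedBalls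
  have hq' : IsQuasiUniform (max cq 1) T := fun K hK K' hK' => (hq K hK K' hK').trans
    (mul_le_mul_of_nonneg_right (le_max_left _ _) (isTri_of_mem_elements hK).elementDiam_pos.le)
  obtain ⟨B, hB⟩ := hlink T hT hb hq' h5 hres
  obtain ⟨P, hP⟩ := (mem_feSpace_iff hT).1 hv
  have hfam := hT.isTestFamily k hκ hcq hb hq'
  have hne : ∀ s ∈ hT.testSimplices k, s.Nonempty := fun s hs => (hT.mem_testSimplices.1 hs).2.1
  -- The coefficient is the value of `v` at some vertex of `s`; the default `0` never occurs for
  -- test simplices.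
  set val : Finset Plane → ℝ := fun s => if h : s.Nonempty then v h.choose else 0 with hval
  have hval' : ∀ s ∈ hT.testSimplices k, ∃ y ∈ s, val s = v y := fun s hs =>
    ⟨(hne s hs).choose, (hne s hs).choose_spec, dif_pos (hne s hs)⟩
  have hgrad : ∀ K ∈ hT.elems, ∀ x ∈ tri K,
      elementDiam K * ‖gradPoly (P K) x‖ ≤ C * √(energy K (P K) (P K)) := fun K hK =>
    hinv K (hT.isTri hK) (hb K (hT.mem_elems.1 hK)) _ (hP K (hT.mem_elems.1 hK)).1
  have hosc : ∀ s ∈ hT.testSimplices k, ∀ K ∈ hT.elems, s ⊆ K → ∀ x ∈ tri K,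
      |polyFun (P K) x - val s| ≤ C * √(energy K (P K) (P K)) := by
    intro s hs K hK hsK x hx
    obtain ⟨y, hy, hys⟩ := hval' s hs
    have hyK : y ∈ tri K := mem_tri_of_mem (hsK hy)
    rw [hys, (hP K (hT.mem_elems.1 hK)).2 y hyK]
    exact (hT.isTri hK).abs_sub_le (hgrad K hK) hx hyK
  -- Across at most `N` elements `v` oscillates by at most `C * √D` on each, which gives `N * C`.
  have hmass := hfam.mass_le hN hosc hB.card_le hB.good (C' := N * C) fun c hc hcB => by
    obtain ⟨s, hs, 𝒦, h𝒦, hcard, S, hS, hcov, hcS, hsS⟩ := hB.bad c hc hcB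
    refine ⟨s, hs, fun x hx => ?_⟩
    obtain ⟨y, hy, hys⟩ := hval' s hs
    rw [hys, ← (hP c.1 (hT.mem_elems.1 (hT.fst_mem_elems hc))).2 x hx]
    exact hP.abs_sub_le_sqrt hT hC.le hgrad h𝒦 hcard hS hcov (hcS hx) (hsS hy)
  obtain ⟨h1, h2⟩ := hmain Ω T hT _ _ hfam P val hgrad hosc hmass
  choose! w hw using fun s (hs : s ∈ hT.testSimplices k) => hT.exists_represents_testPoly hs
  have hR := hP.add ((Represents.sum fun s hs => (hw s hs).smul (val s)).smul α)
  exact le_sSup_quotients hT hΩ.regular hΩ.preperfect hκ hb hP hR hcs h1 h2
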